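/- Let $\Gamma$ be a nonempty closed (compact, without boundary) infinitely smooth manifold of dimension $n\ge 1$, equipped with a positive $C^\infty$-density $dx$. Let $\mathcal D'(\Gamma)$ be the space of distributions on $\Gamma$, i.e. of continuous antilinear functionals on $C^\infty(\Gamma)$; a continuous function $f$ is identified with the distribution $w\mapsto\int_\Gamma f\,\overline{w}\,dx$. Let $\mathcal M$ be the set of all Borel measurable functions $\varphi:[1,\infty)\to(0,\infty)$ such that $\varphi$ and $1/\varphi$ are bounded on every interval $[1,b]$, $1<b<\infty$, and $\lim_{t\to\infty}\varphi(\lambda t)/\varphi(t)=1$ for each $\lambda>0$. For $s\in\mathbb R$ and $\varphi\in\mathcal M$, let $H^{s,\varphi}(\mathbb R^n)$ be the space of all tempered distributions $u$ on $\mathbb R^n$ whose Fourier transform $\widehat u$ is a locally integrable function with $$\|u\|^2_{H^{s,\varphi}(\mathbb R^n)}:=\int_{\mathbb R^n}\langle\xi\rangle^{2s}\varphi^2(\langle\xi\rangle)\,|\widehat u(\xi)|^2\,d\xi<\infty,\qquad \langle\xi\rangle:=(1+|\xi|^2)^{1/2}.$$ Fix a finite atlas of $\Gamma$ from its $C^\infty$-structure,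 consisting of charts $\alpha_j:\mathbb R^n\leftrightarrow U_j$, $j=1,\dots,r$, and a $C^\infty$ partition of unity $\chi_1,\dots,\chi_r$ on $\Gamma$ with $\operatorname{supp}\chi_j\subset U_j$. Let $H^{s,\varphi}(\Gamma)$ be the space of all $h\in\mathcal D'(\Gamma)$ such that $(\chi_jh)\circ\alpha_j\in H^{s,\varphi}(\mathbb R^n)$ for every $j$, with the norm $\bigl(\sum_{j=1}^r\|(\chi_jh)\circ\alpha_j\|^2_{H^{s,\varphi}(\mathbb R^n)}\bigr)^{1/2}$, where $(\chi_jh)\circ\alpha_j$ is the representation of the distribution $\chi_jh$ in the chart $\alpha_j$. Let $\varphi\in\mathcal M$ and let $\rho\ge0$ be an integer. Then $$\int_1^\infty\frac{dt}{t\,\varphi^2(t)}<\infty$$ if and only if every $h\in H^{\rho+n/2,\varphi}(\Gamma)$ is a function in $C^\rho(\Gamma)$ and the resulting inclusion $H^{\rho+n/2,\varphi}(\Gamma)\hookrightarrow C^\rho(\Gamma)$ is continuous. Moreover, whenever this inclusion is defined and continuous, it is a compact operator. -/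

import Mathlib

open MeasureTheory Set Filter
open scoped Manifold ContDiff Topology SchwartzMap FourierTransform ComplexConjugate

noncomputable section

/-! ### The class of slowly varying parameters -/

/-- The class `𝓜`: Borel functions `φ : [1, ∞) → (0, ∞)` such that `φ` and `1/φ` are bounded on
every `[1, b]`, `1 < b < ∞`, and `φ` is slowly varying at `∞` in Karamata's sense.  Such a function
is represented by a function on `ℝ` of which only the values on `[1, ∞)` are ever used. -/
structure SlowlyVaryingClass (φ : ℝ → ℝ) : Prop where
  measurable : Measurable ((Ici (1 : ℝ)).domRestrict φ)
  pos : ∀ t, 1 ≤ t → 0 < φ t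
  bounded : ∀ b, 1 < b → ∃ C, ∀ t ∈ Icc 1 b, φ t ≤ C
  bounded_inv : ∀ b, 1 < b → ∃ C, ∀ t ∈ Icc 1 b, 1 / φ t ≤ C
  slowlyVarying : ∀ c : ℝ, 0 < c → Tendsto (fun t => φ (c * t) / φ t) atTop (𝓝 1)

/-! ### The spaces `H^{s,φ}(ℝⁿ)` -/

/-- The Euclidean space `ℝⁿ`. -/
abbrev EuclSp (n : ℕ) : Type := EuclideanSpace ℝ (Fin n)

/-- `⟨ξ⟩ = (1 + ξ₁² + … + ξₙ²)^{1/2}`. -/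
def japaneseBracket {n : ℕ} (ξ : EuclSp n) : ℝ := Real.sqrt (1 + ‖ξ‖ ^ 2)

/-- The weight `⟨ξ⟩^s φ(⟨ξ⟩)`. -/
def refinedWeight {n : ℕ} (s : ℝ) (φ : ℝ → ℝ) (ξ : EuclSp n) : ℝ :=
  japaneseBracket ξ ^ s * φ (japaneseBracket ξ)

/-- The Fourier transform of the tempered distribution `u` is the locally integrable function `f`
(as distributions, that is, tested against compactly supported smooth functions). -/
def HasFourierFunction {n : ℕ} (u : 𝓢'(EuclSp n, ℂ)) (f : EuclSp n → ℂ) : Prop :=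
  LocallyIntegrable f ∧
    ∀ g : 𝓢(EuclSp n, ℂ), HasCompactSupport g → (𝓕 u) g = ∫ ξ, g ξ * f ξ

theorem integrable_schwartz_mul {n : ℕ} {f : EuclSp n → ℂ} (hf : LocallyIntegrable f)
    (g : 𝓢(EuclSp n, ℂ)) (hg : HasCompactSupport g) : Integrable (fun ξ => g ξ * f ξ) := by
  simpa [smul_eq_mul] using hf.integrable_smul_left_of_hasCompactSupport g.continuous hg

theorem HasFourierFunction.add {n : ℕ} {u v : 𝓢'(EuclSp n, ℂ)} {f g : EuclSp n → ℂ}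
    (hu : HasFourierFunction u f) (hv : HasFourierFunction v g) :
    HasFourierFunction (u + v) (f + g) := by
  refine ⟨hu.1.add hv.1, fun w hw => ?_⟩
  have h1 : (𝓕 (u + v)) w = (𝓕 u) w + (𝓕 v) w := rfl
  rw [h1, hu.2 w hw, hv.2 w hw, ← integral_add (integrable_schwartz_mul hu.1 w hw)
    (integrable_schwartz_mul hv.1 w hw)]
  simp [mul_add]

theorem HasFourierFunction.smul {n : ℕ} {u : 𝓢'(EuclSp n, ℂ)} {f : EuclSp n → ℂ} (c : ℂ)
    (hu : HasFourierFunction u f) : HasFourierFunction (c • u) (c • f) := by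
  refine ⟨hu.1.smul c, fun w hw => ?_⟩
  have h1 : (𝓕 (c • u)) w = c * (𝓕 u) w := rfl
  rw [h1, hu.2 w hw, ← integral_const_mul]
  simp [mul_left_comm]

theorem HasFourierFunction.zero {n : ℕ} :
    HasFourierFunction (0 : 𝓢'(EuclSp n, ℂ)) (0 : EuclSp n → ℂ) := by
  refine ⟨locallyIntegrable_zero, fun w _ => ?_⟩
  simp

theorem HasFourierFunction.ae_eq {n : ℕ} {u : 𝓢'(EuclSp n, ℂ)} {f g : EuclSp n → ℂ}
    (hf : HasFourierFunction u f) (hg : HasFourierFunction u g) : f =ᵐ[volume] g := by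
  refine ae_eq_of_integral_contDiff_smul_eq hf.1 hg.1 fun w hw hw' => ?_
  have h1 : HasCompactSupport (Complex.ofRealCLM ∘ w) := hw'.comp_left rfl
  have h2 : ContDiff ℝ ∞ (Complex.ofRealCLM ∘ w) := by fun_prop
  have h3 : HasCompactSupport (h1.toSchwartzMap h2 : EuclSp n → ℂ) := h1
  simpa using (hf.2 (h1.toSchwartzMap h2) h3).symm.trans (hg.2 (h1.toSchwartzMap h2) h3)

/-- `H^{s,φ}(ℝⁿ)`: the tempered distributions `u` whose Fourier transform is a locally integrable
function `f` with `∫ ⟨ξ⟩^{2s} φ²(⟨ξ⟩) |f(ξ)|² dξ < ∞`. -/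
def refinedSubmodule (n : ℕ) (s : ℝ) (φ : ℝ → ℝ) : Submodule ℂ 𝓢'(EuclSp n, ℂ) where
  carrier := {u | ∃ f : EuclSp n → ℂ, HasFourierFunction u f ∧
    MemLp (fun ξ => (refinedWeight s φ ξ : ℂ) * f ξ) 2 volume}
  zero_mem' := ⟨0, .zero, by simp⟩
  add_mem' := by
    rintro u v ⟨f, hf, hf'⟩ ⟨g, hg, hg'⟩
    refine ⟨f + g, hf.add hg, ?_⟩
    convert hf'.add hg' using 1
    ext ξ
    simp [mul_add]
  smul_mem' := by
    rintro c u ⟨f, hf, hf'⟩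
    refine ⟨c • f, hf.smul c, ?_⟩
    convert hf'.const_mul c using 1
    ext ξ
    simp [mul_left_comm]

/-- The linear map `u ↦ ⟨ξ⟩^s φ(⟨ξ⟩) û(ξ)` from `H^{s,φ}(ℝⁿ)` to `L₂(ℝⁿ)`.  The inner product and
the norm of `H^{s,φ}(ℝⁿ)` are those of `L₂(ℝⁿ)` pulled back along this map. -/
def weightedFourier (n : ℕ) (s : ℝ) (φ : ℝ → ℝ) :
    refinedSubmodule n s φ →ₗ[ℂ] Lp ℂ 2 (volume : Measure (EuclSp n)) where
  toFun u := u.2.choose_spec.2.toLp _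
  map_add' u v := by
    rw [← MemLp.toLp_add]
    refine MemLp.toLp_congr _ _ ?_
    filter_upwards [(u + v).2.choose_spec.1.ae_eq
      (u.2.choose_spec.1.add v.2.choose_spec.1)] with ξ hξ
    simp only [Pi.add_apply] at hξ ⊢
    rw [hξ, mul_add]
  map_smul' c u := by
    rw [RingHom.id_apply, ← MemLp.toLp_const_smul]
    refine MemLp.toLp_congr _ _ ?_
    filter_upwards [(c • u).2.choose_spec.1.ae_eq (u.2.choose_spec.1.smul c)] with ξ hξ
    simp only [Pi.smul_apply, smul_eq_mul] at hξ ⊢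
    rw [hξ, mul_left_comm]

/-! ### `C^k` functions and distributions on a manifold -/

section Manifold

variable (n : ℕ) (Γ : Type*) [TopologicalSpace Γ] [ChartedSpace (EuclSp n) Γ]

/-- The complex vector space of `C^k` functions `Γ → ℂ`. -/
def ckSubmodule (k : ℕ∞) : Submodule ℂ (Γ → ℂ) where
  carrier := {u | ContMDiff (𝓡 n) 𝓘(ℝ, ℂ) k u}
  zero_mem' := contMDiff_const
  add_mem' := fun hu hv => hu.add hv
  smul_mem' := fun c u hu => by
    have h : ContMDiff (𝓡 n) 𝓘(ℝ, ℂ) k (fun x => c * u x) :=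
      (ContinuousLinearMap.mul ℝ ℂ c).contMDiff.comp hu
    exact h

/-- The space `C^k(Γ)` of complex-valued functions, `0 ≤ k ≤ ∞`; it is a copy of `ckSubmodule`
that carries the `C^k` topology instead of the topology of pointwise convergence. -/
def CkSpace (k : ℕ∞) : Type _ := ckSubmodule n Γ k

namespace CkSpace

variable {n Γ} {k : ℕ∞}

instance : AddCommGroup (CkSpace n Γ k) := inferInstanceAs (AddCommGroup (ckSubmodule n Γ k))

instance : Module ℂ (CkSpace n Γ k) := inferInstanceAs (Module ℂ (ckSubmodule n Γ k))

instance : CoeFun (CkSpace n Γ k) (fun _ => Γ → ℂ) := ⟨fun u => u.1⟩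

/-- The topology of `C^k(Γ)`: uniform convergence, on compact subsets of the range of every chart of
the `C^∞` structure, of all derivatives of order `i ≤ k` of the function in that chart. -/
instance : TopologicalSpace (CkSpace n Γ k) :=
  ⨅ (β : OpenPartialHomeomorph Γ (EuclSp n)) (_ : β ∈ IsManifold.maximalAtlas (𝓡 n) ∞ Γ)
    (i : ℕ) (_ : (i : ℕ∞) ≤ k),
    TopologicalSpace.induced
      (fun u : CkSpace n Γ k =>
        UniformOnFun.ofFun {K : Set (EuclSp n) | IsCompact K ∧ K ⊆ β.target}
          (iteratedFDeriv ℝ i ((u : Γ → ℂ) ∘ β.symm)))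
      inferInstance

end CkSpace

/-- `𝓓'(Γ)`: the continuous antilinear functionals on `C^∞(Γ)`. -/
abbrev DistributionOn : Type _ := CkSpace n Γ ⊤ →SL[starRingEnd ℂ] ℂ

/-- A positive `C^∞`-density `dx` on `Γ`: a Borel measure which, in every chart `β` of the `C^∞`
structure, is the Lebesgue measure times a positive `C^∞` function `dens β`. -/
structure SmoothDensity [MeasurableSpace Γ] where
  /-- the measure `dx` -/
  measure : Measure Γ
  /-- the density function of `dx` in the chart `β` -/
  dens : OpenPartialHomeomorph Γ (EuclSp n) → EuclSp n → ℝ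
  contDiffOn_dens : ∀ β ∈ IsManifold.maximalAtlas (𝓡 n) ∞ Γ, ContDiffOn ℝ ∞ (dens β) β.target
  dens_pos : ∀ β ∈ IsManifold.maximalAtlas (𝓡 n) ∞ Γ, ∀ x ∈ β.target, 0 < dens β x
  map_restrict : ∀ β ∈ IsManifold.maximalAtlas (𝓡 n) ∞ Γ,
    (measure.restrict β.source).map β =
      (volume.restrict β.target).withDensity (fun x => ENNReal.ofReal (dens β x))

/-- A finite atlas of charts `U_j ↔ ℝⁿ` from the `C^∞` structure of `Γ`, together with a `C^∞`
partition of unity `χ_j` with `supp χ_j ⊆ U_j`.  (The `chart j` maps `U_j` onto `ℝⁿ`.) -/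
structure AdaptedAtlas where
  /-- the number of charts -/
  r : ℕ
  /-- the charts -/
  chart : Fin r → OpenPartialHomeomorph Γ (EuclSp n)
  chart_mem : ∀ j, chart j ∈ IsManifold.maximalAtlas (𝓡 n) ∞ Γ
  chart_target : ∀ j, (chart j).target = univ
  chart_cover : (⋃ j, (chart j).source) = univ
  /-- the partition of unity -/
  χ : SmoothPartitionOfUnity (Fin r) (𝓡 n) Γ univ
  χ_subordinate : χ.IsSubordinate fun j => (chart j).source

end Manifold

/-! ### Distributions in local charts -/

section LocalRep

theorem exists_iteratedFDeriv_mul_comp_bound {n : ℕ} {O K : Set (EuclSp n)} (hO : IsOpen O)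
    (hK : IsCompact K) (hKO : K ⊆ O) {ψ : EuclSp n → ℂ} {τ : EuclSp n → EuclSp n}
    (hψ : ContDiffOn ℝ ∞ ψ O) (hτ : ContDiffOn ℝ ∞ τ O) (i : ℕ) :
    ∃ C : ℝ, 0 ≤ C ∧ ∀ g : 𝓢(EuclSp n, ℂ), ∀ x ∈ K,
      ‖iteratedFDeriv ℝ i (fun y => ψ y * conj (g (τ y))) x‖ ≤
        C * ∑ l ∈ Finset.range (i + 1), SchwartzMap.seminorm ℝ 0 l g := by
  have hbd : ∀ {F : Type} [NormedAddCommGroup F] [NormedSpace ℝ F] (f : EuclSp n → F),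
      ContDiffOn ℝ ∞ f O → ∃ B : ℝ, 1 ≤ B ∧ ∀ l ≤ i, ∀ x ∈ K,
        ‖iteratedFDerivWithin ℝ l f O x‖ ≤ B := by
    intro F _ _ f hf
    have h : ∀ l : ℕ, ∃ B : ℝ, ∀ x ∈ K, ‖iteratedFDerivWithin ℝ l f O x‖ ≤ B := fun l =>
      hK.exists_bound_of_continuousOn ((hf.continuousOn_iteratedFDerivWithin
        (mod_cast le_top) hO.uniqueDiffOn).mono hKO)
    choose B hB using h
    refine ⟨1 + ∑ l ∈ Finset.range (i + 1), |B l|, ?_, fun l hl x hx => ?_⟩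
    · have : 0 ≤ ∑ l ∈ Finset.range (i + 1), |B l| := Finset.sum_nonneg fun _ _ => abs_nonneg _
      linarith
    · have h1 : |B l| ≤ ∑ l ∈ Finset.range (i + 1), |B l| :=
        Finset.single_le_sum (f := fun l => |B l|) (fun _ _ => abs_nonneg _)
          (Finset.mem_range.2 (by omega))
      linarith [hB l x hx, le_abs_self (B l)]
  obtain ⟨A, hA1, hA⟩ := hbd ψ hψ
  obtain ⟨B, hB1, hB⟩ := hbd τ hτ
  refine ⟨∑ l ∈ Finset.range (i + 1), (i.choose l : ℝ) * A * ((i - l).factorial * B ^ (i - l)),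
    Finset.sum_nonneg fun _ _ => by positivity, fun g x hx => ?_⟩
  set p : ℝ := ∑ l ∈ Finset.range (i + 1), SchwartzMap.seminorm ℝ 0 l g with hp
  have hgs : ContDiff ℝ ∞ (fun y => conj (g y)) := Complex.conjCLE.contDiff.comp (g.smooth ⊤)
  have hxO := hKO hx
  have hg : ∀ m ≤ i, ‖iteratedFDerivWithin ℝ m (fun y => conj (g (τ y))) O x‖ ≤
      m.factorial * p * B ^ m := by
    intro m hm
    refine norm_iteratedFDerivWithin_comp_le (N := ∞) (g := fun y => conj (g y)) (t := univ)
      hgs.contDiffOn hτ (mod_cast le_top) uniqueDiffOn_univ hO.uniqueDiffOn (mapsTo_univ _ _) hxO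
      (fun l hl => ?_) (fun l hl1 hl => ?_)
    · rw [iteratedFDerivWithin_univ]
      have h1 : ‖iteratedFDeriv ℝ l (fun y => conj (g y)) (τ x)‖ =
          ‖iteratedFDeriv ℝ l g (τ x)‖ :=
        Complex.conjLIE.norm_iteratedFDeriv_comp_left (g : EuclSp n → ℂ) (τ x) l
      rw [h1]
      refine (SchwartzMap.norm_iteratedFDeriv_le_seminorm ℝ g l (τ x)).trans ?_
      exact Finset.single_le_sum (f := fun l => SchwartzMap.seminorm ℝ 0 l g)
        (fun _ _ => apply_nonneg _ _) (Finset.mem_range.2 (by omega))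
    · exact (hB l (by omega) x hx).trans (le_self_pow₀ hB1 (by omega))
  have hp0 : 0 ≤ p := Finset.sum_nonneg fun _ _ => apply_nonneg _ _
  rw [← iteratedFDerivWithin_of_isOpen i hO hxO, Finset.sum_mul]
  refine (norm_iteratedFDerivWithin_mul_le (N := ∞) hψ (hgs.comp_contDiffOn hτ) hO.uniqueDiffOn hxO
    (mod_cast le_top)).trans (Finset.sum_le_sum fun l hl => ?_)
  have hl' : l ≤ i := by have := Finset.mem_range.1 hl; omega
  calc _ ≤ (i.choose l : ℝ) * A * ((i - l).factorial * p * B ^ (i - l)) := by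
        gcongr
        · exact hA l hl' x hx
        · exact hg (i - l) (by omega)
    _ = _ := by ring

variable {n : ℕ} {Γ : Type*} [TopologicalSpace Γ] [ChartedSpace (EuclSp n) Γ]
  [MeasurableSpace Γ]

theorem contMDiffAt_chartTest (A : AdaptedAtlas n Γ) (d : SmoothDensity n Γ) (j : Fin A.r)
    {y : Γ} (hy : y ∈ (A.chart j).source) :
    ContMDiffAt (𝓡 n) 𝓘(ℝ, ℂ) ∞
      (fun y => ((A.χ j y * (d.dens (A.chart j) (A.chart j y))⁻¹ : ℝ) : ℂ)) y := by
  have hα : ContMDiffAt (𝓡 n) (𝓡 n) ∞ (A.chart j) y :=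
    (contMDiffOn_of_mem_maximalAtlas (A.chart_mem j)).contMDiffAt
      ((A.chart j).open_source.mem_nhds hy)
  have hyt := (A.chart j).map_source hy
  have hd : ContDiffAt ℝ ∞ (fun x => (d.dens (A.chart j) x)⁻¹) (A.chart j y) :=
    ((d.contDiffOn_dens _ (A.chart_mem j)).contDiffAt
      ((A.chart j).open_target.mem_nhds hyt)).inv (d.dens_pos _ (A.chart_mem j) _ hyt).ne'
  have h1 := (A.χ j).contMDiff.contMDiffAt (x := y) |>.mul (hd.contMDiffAt.comp y hα)
  exact (Complex.ofRealCLM.contDiff (n := ∞)).contMDiff.contMDiffAt.comp y h1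

/-- For a Schwartz function `g` on `ℝⁿ`, the `C^∞` function `χ_j · (conj g ∘ β) / (dens ∘ β)` on
`Γ`, where `β : U_j → ℝⁿ` is the `j`-th chart and `dens` the density of `dx` in it (the function
vanishes outside `U_j` since `χ_j` does). -/
def chartTest (A : AdaptedAtlas n Γ) (d : SmoothDensity n Γ) (j : Fin A.r)
    (g : 𝓢(EuclSp n, ℂ)) : CkSpace n Γ ⊤ :=
  ⟨fun y => ((A.χ j y * (d.dens (A.chart j) (A.chart j y))⁻¹ : ℝ) : ℂ) *
      conj (g (A.chart j y)), by
    refine contMDiff_of_tsupport fun y hy => ?_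
    have hy' : y ∈ (A.chart j).source := by
      refine A.χ_subordinate j (closure_mono ?_ hy)
      intro z hz hz'
      simp [hz'] at hz
    have hα : ContMDiffAt (𝓡 n) (𝓡 n) ∞ (A.chart j) y :=
      (contMDiffOn_of_mem_maximalAtlas (A.chart_mem j)).contMDiffAt
        ((A.chart j).open_source.mem_nhds hy')
    have hg : ContDiff ℝ ∞ (fun y => conj (g y)) := Complex.conjCLE.contDiff.comp (g.smooth ⊤)
    exact (contDiff_mul (𝕜 := ℝ) (n := ∞) (𝔸 := ℂ)).contMDiff.contMDiffAt.comp y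
      ((contMDiffAt_chartTest A d j hy').prodMk_space (hg.contMDiff.contMDiffAt.comp y hα))⟩

theorem chartTest_add (A : AdaptedAtlas n Γ) (d : SmoothDensity n Γ) (j : Fin A.r)
    (g g' : 𝓢(EuclSp n, ℂ)) : chartTest A d j (g + g') = chartTest A d j g + chartTest A d j g' :=
  Subtype.ext (funext fun y => by
    change _ * conj (g _ + g' _) = _ * conj (g _) + _ * conj (g' _)
    rw [map_add, mul_add])

theorem chartTest_smul (A : AdaptedAtlas n Γ) (d : SmoothDensity n Γ) (j : Fin A.r)
    (c : ℂ) (g : 𝓢(EuclSp n, ℂ)) : chartTest A d j (c • g) = conj c • chartTest A d j g :=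
  Subtype.ext (funext fun y => by
    change _ * conj (c * g _) = conj c * (_ * conj (g _))
    rw [map_mul, mul_left_comm])

theorem exists_chartTest_bound [IsManifold (𝓡 n) ∞ Γ] [T2Space Γ]
    (A : AdaptedAtlas n Γ) (d : SmoothDensity n Γ)
    (j : Fin A.r) {β : OpenPartialHomeomorph Γ (EuclSp n)}
    (hβ : β ∈ IsManifold.maximalAtlas (𝓡 n) ∞ Γ) {K : Set (EuclSp n)} (hK : IsCompact K)
    (hKβ : K ⊆ β.target) (i : ℕ) :
    ∃ C : ℝ, 0 ≤ C ∧ ∀ g : 𝓢(EuclSp n, ℂ), ∀ x ∈ K,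
      ‖iteratedFDeriv ℝ i ((chartTest A d j g : Γ → ℂ) ∘ β.symm) x‖ ≤
        C * ∑ l ∈ Finset.range (i + 1), SchwartzMap.seminorm ℝ 0 l g := by
  set α := A.chart j
  set O : Set (EuclSp n) := β.target ∩ β.symm ⁻¹' α.source
  have hO : IsOpen O := β.isOpen_inter_preimage_symm α.open_source
  set K' : Set (EuclSp n) := K ∩ β.symm ⁻¹' (tsupport (A.χ j))
  have hK' : IsCompact K' := by
    have h1 : IsClosed K' :=
      (β.continuousOn_symm.mono hKβ).preimage_isClosed_of_isClosed hK.isClosed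
        (isClosed_tsupport _)
    exact hK.of_isClosed_subset h1 inter_subset_left
  have hK'O : K' ⊆ O := fun x hx => ⟨hKβ hx.1, A.χ_subordinate j hx.2⟩
  have hsymm : ContMDiffOn (𝓡 n) (𝓡 n) ∞ β.symm O :=
    (contMDiffOn_symm_of_mem_maximalAtlas hβ).mono inter_subset_left
  have hψ : ContDiffOn ℝ ∞
      (fun x => ((A.χ j (β.symm x) * (d.dens α (α (β.symm x)))⁻¹ : ℝ) : ℂ)) O := by
    intro x hx
    have h1 := (contMDiffAt_chartTest A d j hx.2).comp_contMDiffWithinAt x (hsymm x hx)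
    exact h1.contDiffWithinAt
  have hτ : ContDiffOn ℝ ∞ (fun x => α (β.symm x)) O := by
    intro x hx
    have h1 := ((contMDiffOn_of_mem_maximalAtlas (A.chart_mem j)).contMDiffAt
      (α.open_source.mem_nhds hx.2)).comp_contMDiffWithinAt x (hsymm x hx)
    exact h1.contDiffWithinAt
  obtain ⟨C, hC0, hC⟩ := exists_iteratedFDeriv_mul_comp_bound hO hK' hK'O hψ hτ i
  refine ⟨C, hC0, fun g x hx => ?_⟩
  by_cases hxs : β.symm x ∈ tsupport (A.χ j)
  · exact hC g x ⟨hx, hxs⟩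
  · have h1 : ((chartTest A d j g : Γ → ℂ) ∘ β.symm) =ᶠ[𝓝 x] fun _ => 0 := by
      have h2 : ∀ᶠ z in 𝓝 x, β.symm z ∉ tsupport (A.χ j) :=
        (β.continuousAt_symm (hKβ hx)).eventually
          ((isClosed_tsupport _).isOpen_compl.mem_nhds hxs)
      filter_upwards [h2] with z hz
      have h3 : A.χ j (β.symm z) = 0 := image_eq_zero_of_notMem_tsupport hz
      simp [chartTest, h3]
    rw [(Filter.EventuallyEq.iteratedFDeriv ℝ h1 i).eq_of_nhds]
    have h4 : iteratedFDeriv ℝ i (fun _ : EuclSp n => (0 : ℂ)) x = 0 := by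
      simp
    rw [h4, norm_zero]
    exact mul_nonneg hC0 (Finset.sum_nonneg fun _ _ => apply_nonneg _ _)

theorem continuous_chartTest [IsManifold (𝓡 n) ∞ Γ] [T2Space Γ] (A : AdaptedAtlas n Γ)
    (d : SmoothDensity n Γ) (j : Fin A.r) : Continuous (chartTest A d j) := by
  refine continuous_iInf_rng.2 fun β => continuous_iInf_rng.2 fun hβ =>
    continuous_iInf_rng.2 fun i => continuous_iInf_rng.2 fun _ => continuous_induced_rng.2 ?_
  refine continuous_iff_continuousAt.2 fun g₀ => ?_
  rw [ContinuousAt, UniformOnFun.tendsto_iff_tendstoUniformlyOn]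
  rintro K ⟨hK, hKβ⟩
  obtain ⟨C, hC0, hC⟩ := exists_chartTest_bound A d j hβ hK hKβ i
  rw [Metric.tendstoUniformlyOn_iff]
  intro ε hε
  have hlim : Tendsto (fun g : 𝓢(EuclSp n, ℂ) => C * ∑ l ∈ Finset.range (i + 1),
      SchwartzMap.seminorm ℝ 0 l (g - g₀)) (𝓝 g₀) (𝓝 0) := by
    have hc : Continuous (fun g : 𝓢(EuclSp n, ℂ) => C * ∑ l ∈ Finset.range (i + 1),
        SchwartzMap.seminorm ℝ 0 l (g - g₀)) := by
      refine continuous_const.mul (continuous_finsetSum _ fun l _ => ?_)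
      exact ((schwartz_withSeminorms ℝ (EuclSp n) ℂ).continuous_seminorm (0, l)).comp
        (continuous_id.sub continuous_const)
    simpa using hc.tendsto g₀
  filter_upwards [hlim.eventually (gt_mem_nhds hε)] with g hg x hx
  refine lt_of_le_of_lt ?_ hg
  refine le_trans (le_of_eq ?_) (hC (g - g₀) x hx)
  have hsm : ∀ f : 𝓢(EuclSp n, ℂ),
      ContDiffAt ℝ i ((chartTest A d j f : Γ → ℂ) ∘ β.symm) x := by
    intro f
    have h1 : ContMDiff (𝓡 n) 𝓘(ℝ, ℂ) ∞ (chartTest A d j f : Γ → ℂ) := (chartTest A d j f).2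
    have h2 : ContMDiffAt (𝓡 n) (𝓡 n) ∞ β.symm x :=
      (contMDiffOn_symm_of_mem_maximalAtlas hβ).contMDiffAt
        (β.open_target.mem_nhds (hKβ hx))
    exact ((h1.contMDiffAt.comp x h2).contDiffAt).of_le (mod_cast le_top)
  have hadd : (chartTest A d j g : Γ → ℂ) ∘ β.symm =
      (chartTest A d j (g - g₀) : Γ → ℂ) ∘ β.symm + (chartTest A d j g₀ : Γ → ℂ) ∘ β.symm := by
    have h1 := chartTest_add A d j (g - g₀) g₀
    rw [sub_add_cancel] at h1
    rw [h1]
    rfl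
  rw [dist_comm, dist_eq_norm]
  change ‖iteratedFDeriv ℝ i ((chartTest A d j g : Γ → ℂ) ∘ β.symm) x -
    iteratedFDeriv ℝ i ((chartTest A d j g₀ : Γ → ℂ) ∘ β.symm) x‖ = _
  rw [hadd, iteratedFDeriv_add_apply (hsm _) (hsm _), add_sub_cancel_right]

/-- The representation `(χ_j h) ∘ α_j` of `χ_j h` in the `j`-th chart `α_j : ℝⁿ ↔ U_j`, a tempered
distribution on `ℝⁿ`.  If `h` is a function, i.e. `h(w) = ∫ h · conj w dx`, this is the function
`x ↦ (χ_j h)(α_j x)`, because `∫ (χ_j h)(α_j x) g(x) dx` over `ℝⁿ` (Lebesgue measure) is the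
integral of `h · χ_j · (g ∘ α_j⁻¹) / (dens ∘ α_j⁻¹)` over `Γ`. -/
def localRep [IsManifold (𝓡 n) ∞ Γ] [T2Space Γ] (A : AdaptedAtlas n Γ) (d : SmoothDensity n Γ)
    (j : Fin A.r) : DistributionOn n Γ →ₗ[ℂ] 𝓢'(EuclSp n, ℂ) where
  toFun h := ContinuousLinearMap.toPointwiseConvergenceCLM ℂ (RingHom.id ℂ) 𝓢(EuclSp n, ℂ) ℂ
    { toFun := fun g => h (chartTest A d j g)
      map_add' := fun g g' => by rw [chartTest_add, map_add]
      map_smul' := fun c g => by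
        rw [chartTest_smul, map_smulₛₗ, Complex.conj_conj, RingHom.id_apply]
      cont := h.continuous.comp (continuous_chartTest A d j) }
  map_add' _ _ := rfl
  map_smul' _ _ := rfl

end LocalRep

/-! ### The refined scale over a manifold -/

section RefinedSpace

variable {n : ℕ} {Γ : Type*} [TopologicalSpace Γ] [ChartedSpace (EuclSp n) Γ]
  [IsManifold (𝓡 n) ∞ Γ] [T2Space Γ] [MeasurableSpace Γ]

/-- The distributions `h ∈ 𝓓'(Γ)` such that `(χ_j h) ∘ α_j ∈ H^{s,φ}(ℝⁿ)` for every `j`. -/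
def refinedSubmoduleOn (A : AdaptedAtlas n Γ) (d : SmoothDensity n Γ) (s : ℝ) (φ : ℝ → ℝ) :
    Submodule ℂ (DistributionOn n Γ) where
  carrier := {h | ∀ j, localRep A d j h ∈ refinedSubmodule n s φ}
  zero_mem' := fun j => by rw [map_zero]; exact Submodule.zero_mem _
  add_mem' := fun hf hg j => by rw [map_add]; exact Submodule.add_mem _ (hf j) (hg j)
  smul_mem' := fun c _ hf j => by rw [map_smul]; exact Submodule.smul_mem _ c (hf j)

/-- The space `H^{s,φ}(Γ)`; it is a copy of `refinedSubmoduleOn` that carries its own norm instead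
of the topology of distributions. -/
def RefinedSpaceOn (A : AdaptedAtlas n Γ) (d : SmoothDensity n Γ) (s : ℝ) (φ : ℝ → ℝ) : Type _ :=
  refinedSubmoduleOn A d s φ

namespace RefinedSpaceOn

variable {A : AdaptedAtlas n Γ} {d : SmoothDensity n Γ} {s : ℝ} {φ : ℝ → ℝ}

instance : AddCommGroup (RefinedSpaceOn A d s φ) :=
  inferInstanceAs (AddCommGroup (refinedSubmoduleOn A d s φ))

instance : Module ℂ (RefinedSpaceOn A d s φ) :=
  inferInstanceAs (Module ℂ (refinedSubmoduleOn A d s φ))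

/-- The underlying distribution of an element of `H^{s,φ}(Γ)`. -/
def toDistribution (h : RefinedSpaceOn A d s φ) : DistributionOn n Γ := h.1

variable (A d s φ) in
/-- The linear map which sends `h` to the family of the functions
`⟨ξ⟩^s φ(⟨ξ⟩) û_j(ξ)`, `u_j = (χ_j h) ∘ α_j`, in the Hilbert sum of `r` copies of `L₂(ℝⁿ)`. -/
def toL2 : RefinedSpaceOn A d s φ →ₗ[ℂ]
    PiLp 2 (fun _ : Fin A.r => Lp ℂ 2 (volume : Measure (EuclSp n))) where
  toFun h := WithLp.toLp 2 fun j => weightedFourier n s φ ⟨localRep A d j h.1, h.2 j⟩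
  map_add' f g := by
    ext1 j
    exact ((weightedFourier n s φ).map_add ⟨localRep A d j f.1, f.2 j⟩
      ⟨localRep A d j g.1, g.2 j⟩ :)
  map_smul' c f := by
    ext1 j
    exact ((weightedFourier n s φ).map_smul c ⟨localRep A d j f.1, f.2 j⟩ :)

/-- The norm of `H^{s,φ}(Γ)`: its square is the sum over `j` of the squares of the norms of
`(χ_j h) ∘ α_j` in `H^{s,φ}(ℝⁿ)`. -/
instance : SeminormedAddCommGroup (RefinedSpaceOn A d s φ) :=
  SeminormedAddCommGroup.induced _ _ (toL2 A d s φ)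

/-- The inner product of `H^{s,φ}(Γ)`: the sum over `j` of the inner products of `(χ_j f) ∘ α_j` and
`(χ_j g) ∘ α_j` in `H^{s,φ}(ℝⁿ)`. -/
instance : InnerProductSpace ℂ (RefinedSpaceOn A d s φ) where
  norm_smul_le c f := by
    change ‖toL2 A d s φ (c • f)‖ ≤ ‖c‖ * ‖toL2 A d s φ f‖
    rw [map_smul, norm_smul]
  inner f g := inner ℂ (toL2 A d s φ f) (toL2 A d s φ g)
  norm_sq_eq_re_inner f := norm_sq_eq_re_inner (𝕜 := ℂ) (toL2 A d s φ f)
  conj_inner_symm f g := inner_conj_symm (toL2 A d s φ f) (toL2 A d s φ g)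
  add_left f g h := by rw [map_add, inner_add_left]
  smul_left f g c := by rw [map_smul, inner_smul_left]

/-- The map `T : H^{s,φ}(Γ) → C^k(Γ)` is the natural inclusion: for every `h`, the function `T h`
is `h`, i.e. `h(w) = ∫ (T h) · conj w dx` for all `w ∈ C^∞(Γ)`. -/
def IsInclusion {k : ℕ∞} (T : RefinedSpaceOn A d s φ → CkSpace n Γ k) : Prop :=
  ∀ (h : RefinedSpaceOn A d s φ) (w : CkSpace n Γ ⊤),
    h.toDistribution w = ∫ x, T h x * conj (w x) ∂d.measure

end RefinedSpaceOn

end RefinedSpace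

end

/-!
A slowly varying function changes only by bounded factors on dyadic blocks (Karamata's uniform
convergence theorem) and more slowly than any power (Potter's bounds). Hence the integral condition
is equivalent to `∑ φ(2^m)⁻² < ∞`, and, in polar coordinates, to the square integrability of the
quotient of `⟨ξ⟩^ρ` by the weight of `H^{ρ+n/2,φ}(ℝⁿ)`.

If the condition holds, Fourier inversion in the charts recovers a distribution from its weighted
Fourier transforms by an integral whose derivatives up to order `ρ` are inner products in `L₂`. On
bounded sets this recovery is continuous from the weak topology of `L₂` to `C^ρ(Γ)`, so the
inclusion is continuous, and it is compact by the Banach–Alaoglu theorem.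

Conversely, the rescaled bumps `φ(2^m)⁻² 2^{-mρ} ψ(2^m (x - x₀))` are almost orthogonal in
`H^{ρ+n/2,φ}`: the squared norm of the sum of the first `M` of them is at most a constant times
`σ_M = ∑_{m < M} φ(2^m)⁻²`, while the derivative of order `ρ` at `x₀` is `σ_M` times that of `ψ` at
`0`. Continuity of the inclusion therefore bounds `σ_M`.
-/

/-! ### Slowly varying functions -/

section UniformConvergence

variable {f : ℝ → ℝ} {ε a : ℝ}

theorem tendsto_volume_setOf_le_abs_sub (hf : Measurable f)
    (h : ∀ u, Tendsto (fun x => f (x + u) - f x) atTop (𝓝 0)) (hε : 0 < ε) (a : ℝ) :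
    Tendsto (fun x => volume {v ∈ Icc 0 a | ε ≤ |f (x + v) - f x|}) atTop (𝓝 0) := by
  refine tendsto_of_seq_tendsto fun y hy => ?_
  have hmeas : TendstoInMeasure (volume.restrict (Icc 0 a))
      (fun k v => f (y k + v) - f (y k)) atTop (fun _ => (0 : ℝ)) :=
    tendstoInMeasure_of_tendsto_ae
      (fun k => ((hf.comp (measurable_const_add _)).sub_const _).aestronglyMeasurable)
      (ae_of_all _ fun v => (h v).comp hy)
  refine tendsto_of_tendsto_of_tendsto_of_le_of_le tendsto_const_nhds
    (tendstoInMeasure_iff_norm.1 hmeas ε hε) (fun _ => zero_le) fun k => ?_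
  refine (measure_mono ?_).trans (Measure.le_restrict_apply _ _)
  rintro v ⟨hv, hv'⟩
  exact ⟨by simpa using hv', hv⟩

/-- The uniform convergence theorem of Karamata's theory, in additive form. -/
theorem eventually_forall_mem_Icc_abs_sub_lt (hf : Measurable f)
    (h : ∀ u, Tendsto (fun x => f (x + u) - f x) atTop (𝓝 0)) (hε : 0 < ε) (ha : 0 < a) :
    ∀ᶠ x in atTop, ∀ u ∈ Icc 0 a, |f (x + u) - f x| < ε := by
  let bad (x : ℝ) : Set ℝ := {v ∈ Icc 0 (2 * a) | ε / 2 ≤ |f (x + v) - f x|}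
  obtain ⟨X, hX⟩ := eventually_atTop.1
    ((tendsto_volume_setOf_le_abs_sub hf h (half_pos hε) (2 * a)).eventually
      (gt_mem_nhds (show 0 < ENNReal.ofReal (a / 2) by simpa using ha)))
  filter_upwards [eventually_ge_atTop X] with x hx u hu
  by_contra! hxu
  -- A displacement `v ∈ [a, 2a]` that is good for `x`, and for `x + u` when seen from there,
  -- would make `f (x + u)` close to `f x`; so the two small bad sets cover `[a, 2a]`.
  have hcover : Icc a (2 * a) ⊆ bad x ∪ (fun v => v + -u) ⁻¹' bad (x + u) := by
    intro v hv
    by_contra hgood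
    simp only [bad, mem_union, mem_preimage, mem_ofPred_eq, mem_Icc, not_or, not_and,
      not_le] at hgood
    have hx_good := hgood.1 ⟨by linarith [hv.1], hv.2⟩
    have hu_good := hgood.2 ⟨by linarith [hv.1, hu.2], by linarith [hv.2, hu.1]⟩
    rw [show x + u + (v + -u) = x + v by ring] at hu_good
    rw [abs_lt] at hx_good hu_good
    rcases le_abs.1 hxu with h | h <;> linarith
  have hvol : volume (Icc a (2 * a)) < ENNReal.ofReal (a / 2) + ENNReal.ofReal (a / 2) :=
    calc volume (Icc a (2 * a)) ≤ volume (bad x) + volume (bad (x + u)) := by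
          refine (measure_mono hcover).trans ((measure_union_le _ _).trans_eq ?_)
          rw [measure_preimage_add_right]
      _ < _ := ENNReal.add_lt_add (hX x hx) (hX _ (by linarith [hu.1]))
  rw [Real.volume_Icc, ← ENNReal.ofReal_add (by positivity) (by positivity), add_halves,
    two_mul, add_sub_cancel_right] at hvol
  exact hvol.false

end UniformConvergence

namespace SlowlyVaryingClass

variable {φ : ℝ → ℝ} {ε : ℝ}

theorem inv (hφ : SlowlyVaryingClass φ) : SlowlyVaryingClass fun t => (φ t)⁻¹ where
  measurable := hφ.measurable.inv
  pos t ht := inv_pos.2 (hφ.pos t ht)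
  bounded b hb := by simpa using hφ.bounded_inv b hb
  bounded_inv b hb := by simpa using hφ.bounded b hb
  slowlyVarying c hc := by
    simpa [div_eq_mul_inv, mul_comm] using (hφ.slowlyVarying c hc).inv₀ one_ne_zero

theorem measurable_comp (hφ : SlowlyVaryingClass φ) {α : Type*} [MeasurableSpace α] {f : α → ℝ}
    (hf : Measurable f) (h1 : ∀ x, 1 ≤ f x) : Measurable fun x => φ (f x) :=
  hφ.measurable.comp (hf.subtype_mk (p := fun t => t ∈ Ici (1 : ℝ)) (h := h1))

theorem tendsto_log_comp_exp_add_sub (hφ : SlowlyVaryingClass φ) (u : ℝ) :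
    Tendsto (fun x => Real.log (φ (Real.exp (max (x + u) 0))) -
      Real.log (φ (Real.exp (max x 0)))) atTop (𝓝 0) := by
  have hratio := (Real.continuousAt_log one_ne_zero).tendsto.comp
    ((hφ.slowlyVarying _ (Real.exp_pos u)).comp Real.tendsto_exp_atTop)
  rw [Real.log_one] at hratio
  refine hratio.congr' ?_
  filter_upwards [eventually_ge_atTop 0, eventually_ge_atTop (-u)] with x hx hx'
  have hxu : 0 ≤ x + u := by linarith
  rw [max_eq_left hx, max_eq_left hxu, add_comm x u, Real.exp_add]
  refine Real.log_div (hφ.pos _ ?_).ne' (hφ.pos _ (Real.one_le_exp hx)).ne'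
  rw [← Real.exp_add, add_comm]
  exact Real.one_le_exp hxu

theorem eventually_forall_mem_Icc_le_mul (hφ : SlowlyVaryingClass φ) {q b : ℝ} (hq : 1 < q)
    (hb : 1 < b) : ∀ᶠ t in atTop, ∀ c ∈ Icc 1 b, φ (c * t) ≤ q * φ t := by
  have hf : Measurable fun x => Real.log (φ (Real.exp (max x 0))) := Real.measurable_log.comp
    (hφ.measurable_comp (by fun_prop) fun x => Real.one_le_exp (le_max_right _ _))
  have hunif := Real.tendsto_log_atTop.eventually (eventually_forall_mem_Icc_abs_sub_lt hf
    hφ.tendsto_log_comp_exp_add_sub (Real.log_pos hq) (Real.log_pos hb))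
  filter_upwards [hunif, eventually_ge_atTop 1] with t ht ht1 c hc
  have ht0 : 0 < t := zero_lt_one.trans_le ht1
  have hc0 : 0 < c := zero_lt_one.trans_le hc.1
  have hlogt : 0 ≤ Real.log t := Real.log_nonneg ht1
  have hlogc : 0 ≤ Real.log c := Real.log_nonneg hc.1
  have h := ht (Real.log c) ⟨hlogc, Real.log_le_log hc0 hc.2⟩
  rw [max_eq_left hlogt, max_eq_left (add_nonneg hlogt hlogc), Real.exp_add, Real.exp_log ht0,
    Real.exp_log hc0, mul_comm t c] at h
  have hφt := hφ.pos t ht1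
  have hφct := hφ.pos (c * t) (one_le_mul_of_one_le_of_one_le hc.1 ht1)
  rw [← Real.log_le_log_iff hφct (by positivity), Real.log_mul (by positivity) hφt.ne']
  linarith [(abs_lt.1 h).2]

theorem eventually_forall_le_mul_rpow (hφ : SlowlyVaryingClass φ) (hε : 0 < ε) :
    ∀ᶠ x in atTop, ∀ y, x ≤ y → φ y ≤ 2 ^ ε * (y / x) ^ ε * φ x := by
  obtain ⟨X, hX⟩ := eventually_atTop.1
    (hφ.eventually_forall_mem_Icc_le_mul (Real.one_lt_rpow one_lt_two hε) one_lt_two)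
  filter_upwards [eventually_ge_atTop X, eventually_ge_atTop 1] with x hxX hx1 y hxy
  have hx0 : 0 < x := zero_lt_one.trans_le hx1
  have hφx := hφ.pos x hx1
  have hX_le : ∀ k : ℕ, X ≤ 2 ^ k * x := fun k =>
    hxX.trans (le_mul_of_one_le_left hx0.le (one_le_pow₀ one_le_two))
  have hpow : ∀ k : ℕ, φ (2 ^ k * x) ≤ ((2 : ℝ) ^ ε) ^ k * φ x := by
    intro k
    induction k with
    | zero => simp
    | succ k ih =>
      calc φ (2 ^ (k + 1) * x) = φ (2 * (2 ^ k * x)) := by rw [pow_succ', mul_assoc]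
        _ ≤ 2 ^ ε * φ (2 ^ k * x) := hX _ (hX_le k) 2 ⟨one_le_two, le_rfl⟩
        _ ≤ 2 ^ ε * (((2 : ℝ) ^ ε) ^ k * φ x) := by gcongr
        _ = _ := by rw [pow_succ', mul_assoc]
  obtain ⟨k, hk, hk'⟩ := exists_nat_pow_near ((one_le_div hx0).2 hxy) one_lt_two
  have hc : y / x / 2 ^ k ∈ Icc (1 : ℝ) 2 :=
    ⟨(one_le_div (by positivity)).2 hk,
      (div_le_iff₀ (by positivity)).2 (pow_succ' (2 : ℝ) k ▸ hk'.le)⟩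
  calc φ y = φ (y / x / 2 ^ k * (2 ^ k * x)) := by congr 1; field_simp
    _ ≤ 2 ^ ε * φ (2 ^ k * x) := hX _ (hX_le k) _ hc
    _ ≤ 2 ^ ε * (((2 : ℝ) ^ ε) ^ k * φ x) := by gcongr; exact hpow k
    _ = 2 ^ ε * ((2 : ℝ) ^ k) ^ ε * φ x := by rw [← mul_assoc, Real.rpow_pow_comm two_pos.le]
    _ ≤ 2 ^ ε * (y / x) ^ ε * φ x := by gcongr

theorem exists_forall_mem_Icc_le_mul (hφ : SlowlyVaryingClass φ) {b : ℝ} (hb : 1 < b) :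
    ∃ C, 1 ≤ C ∧ ∀ x ∈ Icc 1 b, ∀ y ∈ Icc 1 b, φ y ≤ C * φ x := by
  obtain ⟨B, hB⟩ := hφ.bounded b hb
  obtain ⟨D, hD⟩ := hφ.bounded_inv b hb
  refine ⟨max 1 (B * D), le_max_left _ _, fun x hx y hy => ?_⟩
  have hφx := hφ.pos x hx.1
  have hB0 : 0 ≤ B := (hφ.pos y hy.1).le.trans (hB y hy)
  calc φ y ≤ B * (1 / φ x * φ x) := by rw [one_div_mul_cancel hφx.ne', mul_one]; exact hB y hy
    _ ≤ B * (D * φ x) := by gcongr; exact hD x hx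
    _ = B * D * φ x := (mul_assoc _ _ _).symm
    _ ≤ max 1 (B * D) * φ x := by gcongr; exact le_max_right _ _

theorem exists_le_mul_rpow (hφ : SlowlyVaryingClass φ) (hε : 0 < ε) :
    ∃ C, 1 ≤ C ∧ ∀ x y, 1 ≤ x → x ≤ y → φ y ≤ C * (y / x) ^ ε * φ x := by
  obtain ⟨X, hX, hX1⟩ :=
    ((eventually_forall_ge_atTop.2 (hφ.eventually_forall_le_mul_rpow hε)).and
      (eventually_gt_atTop 1)).exists
  obtain ⟨C, hC1, hC⟩ := hφ.exists_forall_mem_Icc_le_mul hX1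
  have h2ε : (1 : ℝ) ≤ 2 ^ ε := Real.one_le_rpow one_le_two hε.le
  refine ⟨2 ^ ε * C, one_le_mul_of_one_le_of_one_le h2ε hC1, fun x y hx hxy => ?_⟩
  have hφx := hφ.pos x hx
  have hyx : 1 ≤ (y / x) ^ ε := Real.one_le_rpow ((one_le_div (by positivity)).2 hxy) hε.le
  rcases le_total X x with hXx | hxX
  · refine (hX x hXx y hxy).trans ?_
    gcongr
    exact le_mul_of_one_le_right (by positivity) hC1
  rcases le_total y X with hyX | hXy
  · refine (hC x ⟨hx, hxX⟩ y ⟨hx.trans hxy, hyX⟩).trans ?_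
    gcongr
    calc C = 1 * C * 1 := by ring
      _ ≤ 2 ^ ε * C * (y / x) ^ ε := by gcongr
  · calc φ y ≤ 2 ^ ε * (y / X) ^ ε * φ X := (hX X le_rfl y hXy)
      _ ≤ 2 ^ ε * (y / x) ^ ε * (C * φ x) := by
        have hφX := hC x ⟨hx, hxX⟩ X ⟨hX1.le, le_rfl⟩
        have hφX0 := hφ.pos X hX1.le
        have hy0 : 0 ≤ y := (zero_le_one.trans hx).trans hxy
        gcongr
      _ = 2 ^ ε * C * (y / x) ^ ε * φ x := by ring

/-- Potter's bounds. -/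
theorem exists_le_mul_rpow_add_rpow (hφ : SlowlyVaryingClass φ) (hε : 0 < ε) :
    ∃ C, 1 ≤ C ∧ ∀ x y, 1 ≤ x → 1 ≤ y → φ y ≤ C * ((y / x) ^ ε + (x / y) ^ ε) * φ x := by
  obtain ⟨C, hC1, hC⟩ := hφ.exists_le_mul_rpow hε
  obtain ⟨D, -, hD⟩ := hφ.inv.exists_le_mul_rpow hε
  refine ⟨max C D, le_max_of_le_left hC1, fun x y hx hy => ?_⟩
  have hφx := hφ.pos x hx
  have hφy := hφ.pos y hy
  rcases le_total x y with h | h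
  · refine (hC x y hx h).trans ?_
    gcongr
    · exact le_max_left _ _
    · exact le_add_of_nonneg_right (by positivity)
  · have hinv := hD y x hy h
    rw [← div_eq_mul_inv, le_div_iff₀ hφy, inv_mul_le_iff₀ hφx, mul_comm (φ x)] at hinv
    refine hinv.trans ?_
    gcongr
    · exact le_max_right _ _
    · exact le_add_of_nonneg_left (by positivity)

theorem exists_dyadic_comparable (hφ : SlowlyVaryingClass φ) :
    ∃ C, 1 ≤ C ∧ ∀ m : ℕ, ∀ t ∈ Ico ((2 : ℝ) ^ m) (2 ^ (m + 1)),
      φ t ≤ C * φ (2 ^ m) ∧ φ (2 ^ m) ≤ C * φ t := by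
  obtain ⟨C, hC1, hC⟩ := hφ.exists_le_mul_rpow_add_rpow one_pos
  refine ⟨C * 3, by linarith, fun m t ht => ?_⟩
  have h2m : (1 : ℝ) ≤ 2 ^ m := one_le_pow₀ one_le_two
  have ht1 : 1 ≤ t := h2m.trans ht.1
  have hup : t / 2 ^ m ≤ 2 := (div_le_iff₀ (by positivity)).2 (pow_succ' (2 : ℝ) m ▸ ht.2.le)
  have hlow : 2 ^ m / t ≤ 1 := (div_le_one (by positivity)).2 ht.1
  have hφm := hφ.pos _ h2m
  have hφt := hφ.pos _ ht1
  have h₁ := hC _ t h2m ht1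
  have h₂ := hC t _ ht1 h2m
  rw [Real.rpow_one, Real.rpow_one] at h₁ h₂
  constructor
  · refine h₁.trans ?_
    gcongr
    linarith
  · refine h₂.trans ?_
    gcongr
    linarith

end SlowlyVaryingClass

theorem iUnion_Ico_two_pow : ⋃ m : ℕ, Ico ((2 : ℝ) ^ m) (2 ^ (m + 1)) = Ici 1 := by
  ext t
  simp only [mem_iUnion, mem_Ici]
  exact ⟨fun ⟨m, hm⟩ => (one_le_pow₀ one_le_two).trans hm.1,
    fun ht => exists_nat_pow_near ht one_lt_two⟩

theorem pairwise_disjoint_Ico_two_pow :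
    Pairwise (Function.onFun Disjoint fun m : ℕ => Ico ((2 : ℝ) ^ m) (2 ^ (m + 1))) :=
  (pow_right_mono₀ one_le_two).pairwise_disjoint_on_Ico_succ

theorem volume_Ico_two_pow (m : ℕ) :
    volume (Ico ((2 : ℝ) ^ m) (2 ^ (m + 1))) = ENNReal.ofReal (2 ^ m) := by
  rw [Real.volume_Ico, pow_succ', two_mul, add_sub_cancel_right]

namespace SlowlyVaryingClass

variable {φ : ℝ → ℝ}

theorem exists_lintegral_Ico_two_pow_le (hφ : SlowlyVaryingClass φ) :
    ∃ C : ENNReal, C < ⊤ ∧ ∀ m : ℕ,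
      ∫⁻ t in Ico ((2 : ℝ) ^ m) (2 ^ (m + 1)), ENNReal.ofReal (1 / (t * φ t ^ 2)) ≤
        C * ENNReal.ofReal (1 / φ (2 ^ m) ^ 2) := by
  obtain ⟨C, hC1, hC⟩ := hφ.exists_dyadic_comparable
  refine ⟨ENNReal.ofReal (C ^ 2), ENNReal.ofReal_lt_top, fun m => ?_⟩
  have hφm := hφ.pos (2 ^ m) (one_le_pow₀ one_le_two)
  calc ∫⁻ t in Ico ((2 : ℝ) ^ m) (2 ^ (m + 1)), ENNReal.ofReal (1 / (t * φ t ^ 2))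
      ≤ ∫⁻ _ in Ico ((2 : ℝ) ^ m) (2 ^ (m + 1)),
          ENNReal.ofReal (1 / (2 ^ m * (φ (2 ^ m) / C) ^ 2)) := by
        refine setLIntegral_mono' measurableSet_Ico fun t ht => ENNReal.ofReal_le_ofReal ?_
        have ht0 : 0 < t := (by positivity : (0 : ℝ) < 2 ^ m).trans_le ht.1
        gcongr
        · exact ht.1
        · rw [div_le_iff₀ (by positivity), mul_comm]
          exact (hC m t ht).2
    _ = ENNReal.ofReal (C ^ 2) * ENNReal.ofReal (1 / φ (2 ^ m) ^ 2) := by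
        rw [setLIntegral_const, volume_Ico_two_pow, ← ENNReal.ofReal_mul (by positivity),
          ← ENNReal.ofReal_mul (by positivity)]
        congr 1
        field_simp

theorem exists_ofReal_le_mul_lintegral_Ico_two_pow (hφ : SlowlyVaryingClass φ) :
    ∃ C : ENNReal, C < ⊤ ∧ ∀ m : ℕ, ENNReal.ofReal (1 / φ (2 ^ m) ^ 2) ≤
      C * ∫⁻ t in Ico ((2 : ℝ) ^ m) (2 ^ (m + 1)), ENNReal.ofReal (1 / (t * φ t ^ 2)) := by
  obtain ⟨C, hC1, hC⟩ := hφ.exists_dyadic_comparable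
  refine ⟨ENNReal.ofReal (2 * C ^ 2), ENNReal.ofReal_lt_top, fun m => ?_⟩
  have h2m : (1 : ℝ) ≤ 2 ^ m := one_le_pow₀ one_le_two
  have hφm := hφ.pos _ h2m
  calc ENNReal.ofReal (1 / φ (2 ^ m) ^ 2)
      = ENNReal.ofReal (2 * C ^ 2) * ∫⁻ _ in Ico ((2 : ℝ) ^ m) (2 ^ (m + 1)),
          ENNReal.ofReal (1 / (2 ^ (m + 1) * (C * φ (2 ^ m)) ^ 2)) := by
        rw [setLIntegral_const, volume_Ico_two_pow, ← ENNReal.ofReal_mul (by positivity),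
          ← ENNReal.ofReal_mul (by positivity)]
        congr 1
        field_simp
        ring
    _ ≤ _ := by
        refine mul_le_mul_right (setLIntegral_mono' measurableSet_Ico fun t ht =>
          ENNReal.ofReal_le_ofReal ?_) _
        have ht0 : 0 < t := (by positivity : (0 : ℝ) < 2 ^ m).trans_le ht.1
        have hφt := hφ.pos t (h2m.trans ht.1)
        gcongr
        · exact ht.2.le
        · exact (hC m t ht).1

theorem lintegral_lt_top_iff_tsum_lt_top (hφ : SlowlyVaryingClass φ) :
    (∫⁻ t in Ici (1 : ℝ), ENNReal.ofReal (1 / (t * φ t ^ 2)) < ⊤) ↔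
      ∑' m : ℕ, ENNReal.ofReal (1 / φ (2 ^ m) ^ 2) < ⊤ := by
  obtain ⟨C₁, hC₁, hupper⟩ := hφ.exists_lintegral_Ico_two_pow_le
  obtain ⟨C₂, hC₂, hlower⟩ := hφ.exists_ofReal_le_mul_lintegral_Ico_two_pow
  rw [← iUnion_Ico_two_pow,
    lintegral_iUnion (fun _ => measurableSet_Ico) pairwise_disjoint_Ico_two_pow]
  constructor <;> intro h
  · refine (ENNReal.tsum_le_tsum hlower).trans_lt ?_
    rw [ENNReal.tsum_mul_left]
    exact ENNReal.mul_lt_top hC₂ h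
  · refine (ENNReal.tsum_le_tsum hupper).trans_lt ?_
    rw [ENNReal.tsum_mul_left]
    exact ENNReal.mul_lt_top hC₁ h

end SlowlyVaryingClass

/-! ### The weight -/

section Weight

variable {n : ℕ} {φ : ℝ → ℝ}

theorem one_le_japaneseBracket (ξ : EuclSp n) : 1 ≤ japaneseBracket ξ :=
  Real.one_le_sqrt.2 (le_add_of_nonneg_right (sq_nonneg ‖ξ‖))

theorem japaneseBracket_pos (ξ : EuclSp n) : 0 < japaneseBracket ξ :=
  one_pos.trans_le (one_le_japaneseBracket ξ)

theorem norm_le_japaneseBracket (ξ : EuclSp n) : ‖ξ‖ ≤ japaneseBracket ξ :=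
  Real.le_sqrt_of_sq_le (by linarith)

theorem japaneseBracket_sq (ξ : EuclSp n) : japaneseBracket ξ ^ 2 = 1 + ‖ξ‖ ^ 2 :=
  Real.sq_sqrt (by positivity)

theorem continuous_japaneseBracket : Continuous (japaneseBracket : EuclSp n → ℝ) := by
  unfold japaneseBracket
  fun_prop

theorem volume_japaneseBracket_preimage_Ico_le (a : ℝ) {b : ℝ} (hb : 0 < b) :
    volume (japaneseBracket ⁻¹' Ico a b : Set (EuclSp n)) ≤
      ENNReal.ofReal (b ^ n) * volume (Metric.ball (0 : EuclSp n) 1) := by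
  have hsub : (japaneseBracket ⁻¹' Ico a b : Set (EuclSp n)) ⊆ Metric.ball 0 b := fun ξ hξ =>
    mem_ball_zero_iff.2 ((norm_le_japaneseBracket ξ).trans_lt hξ.2)
  calc volume (japaneseBracket ⁻¹' Ico a b : Set (EuclSp n))
      ≤ volume (Metric.ball (0 : EuclSp n) b) := measure_mono hsub
    _ = _ := by rw [Measure.addHaar_ball_of_pos _ _ hb, finrank_euclideanSpace_fin]

theorem lintegral_eq_tsum_dyadic_japaneseBracket (f : EuclSp n → ENNReal) :
    ∫⁻ ξ, f ξ =
      ∑' m : ℕ, ∫⁻ ξ in japaneseBracket ⁻¹' Ico ((2 : ℝ) ^ m) (2 ^ (m + 1)), f ξ := by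
  have hcover : ⋃ m : ℕ, (japaneseBracket ⁻¹' Ico ((2 : ℝ) ^ m) (2 ^ (m + 1)) :
      Set (EuclSp n)) = univ := by
    rw [← preimage_iUnion, iUnion_Ico_two_pow]
    exact eq_univ_of_forall one_le_japaneseBracket
  rw [← setLIntegral_univ, ← hcover, lintegral_iUnion
    (fun _ => continuous_japaneseBracket.measurable measurableSet_Ico)
    fun _ _ hij => (pairwise_disjoint_Ico_two_pow hij).preimage _]

namespace SlowlyVaryingClass

theorem measurable_refinedWeight (hφ : SlowlyVaryingClass φ) (s : ℝ) :
    Measurable (refinedWeight s φ : EuclSp n → ℝ) :=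
  (continuous_japaneseBracket.measurable.pow_const s).mul
    (hφ.measurable_comp continuous_japaneseBracket.measurable one_le_japaneseBracket)

theorem refinedWeight_pos (hφ : SlowlyVaryingClass φ) (s : ℝ) (ξ : EuclSp n) :
    0 < refinedWeight s φ ξ :=
  mul_pos (Real.rpow_pos_of_pos (japaneseBracket_pos ξ) s)
    (hφ.pos _ (one_le_japaneseBracket ξ))

theorem exists_lintegral_dyadic_japaneseBracket_le (hφ : SlowlyVaryingClass φ) :
    ∃ C : ENNReal, C < ⊤ ∧ ∀ m : ℕ,
      ∫⁻ ξ : EuclSp n in japaneseBracket ⁻¹' Ico ((2 : ℝ) ^ m) (2 ^ (m + 1)),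
          ENNReal.ofReal (1 / (japaneseBracket ξ ^ n * φ (japaneseBracket ξ) ^ 2)) ≤
        C * ENNReal.ofReal (1 / φ (2 ^ m) ^ 2) := by
  obtain ⟨C, hC1, hC⟩ := hφ.exists_dyadic_comparable
  refine ⟨ENNReal.ofReal (2 ^ n * C ^ 2) * volume (Metric.ball (0 : EuclSp n) 1),
    ENNReal.mul_lt_top ENNReal.ofReal_lt_top measure_ball_lt_top, fun m => ?_⟩
  have hφm := hφ.pos _ (one_le_pow₀ one_le_two : (1 : ℝ) ≤ 2 ^ m)
  calc _ ≤ ∫⁻ _ : EuclSp n in japaneseBracket ⁻¹' Ico ((2 : ℝ) ^ m) (2 ^ (m + 1)),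
          ENNReal.ofReal (1 / ((2 ^ m) ^ n * (φ (2 ^ m) / C) ^ 2)) := by
        refine setLIntegral_mono' (continuous_japaneseBracket.measurable measurableSet_Ico)
          fun ξ hξ => ENNReal.ofReal_le_ofReal ?_
        have hpos := (japaneseBracket_pos ξ).le
        gcongr
        · exact hξ.1
        · rw [div_le_iff₀ (by positivity), mul_comm]
          exact (hC m _ hξ).2
    _ ≤ ENNReal.ofReal (1 / ((2 ^ m) ^ n * (φ (2 ^ m) / C) ^ 2)) *
        (ENNReal.ofReal ((2 ^ (m + 1)) ^ n) * volume (Metric.ball (0 : EuclSp n) 1)) := by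
        rw [setLIntegral_const]
        exact mul_le_mul_right (volume_japaneseBracket_preimage_Ico_le _ (by positivity)) _
    _ = _ := by
        rw [← mul_assoc, ← ENNReal.ofReal_mul (by positivity), mul_right_comm,
          ← ENNReal.ofReal_mul (by positivity)]
        congr 2
        rw [pow_succ (2 : ℝ) m, mul_pow]
        field_simp

theorem sq_pow_div_refinedWeight (hφ : SlowlyVaryingClass φ) (ρ : ℕ) (ξ : EuclSp n) :
    (japaneseBracket ξ ^ ρ / refinedWeight ((ρ : ℝ) + (n : ℝ) / 2) φ ξ) ^ 2 =
      1 / (japaneseBracket ξ ^ n * φ (japaneseBracket ξ) ^ 2) := by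
  have hpos := japaneseBracket_pos ξ
  have hφpos := hφ.pos _ (one_le_japaneseBracket ξ)
  have hhalf : (japaneseBracket ξ ^ ((n : ℝ) / 2)) ^ 2 = japaneseBracket ξ ^ n := by
    rw [← Real.rpow_mul_natCast hpos.le, Nat.cast_two, div_mul_cancel₀ _ two_ne_zero,
      Real.rpow_natCast]
  rw [refinedWeight, Real.rpow_add hpos, Real.rpow_natCast, div_pow, mul_pow, mul_pow, hhalf]
  field_simp

theorem memLp_pow_div_refinedWeight (hφ : SlowlyVaryingClass φ)
    (hsum : ∑' m : ℕ, ENNReal.ofReal (1 / φ (2 ^ m) ^ 2) < ⊤) (ρ : ℕ) :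
    MemLp (fun ξ : EuclSp n => japaneseBracket ξ ^ ρ / refinedWeight ((ρ : ℝ) + (n : ℝ) / 2) φ ξ)
      2 volume := by
  have hmeas : Measurable fun ξ : EuclSp n =>
      japaneseBracket ξ ^ ρ / refinedWeight ((ρ : ℝ) + (n : ℝ) / 2) φ ξ :=
    (continuous_japaneseBracket.measurable.pow_const ρ).div (hφ.measurable_refinedWeight _)
  rw [memLp_two_iff_integrable_sq hmeas.aestronglyMeasurable]
  refine ⟨(hmeas.pow_const 2).aestronglyMeasurable, ?_⟩
  rw [hasFiniteIntegral_iff_ofReal (ae_of_all _ fun _ => sq_nonneg _)]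
  simp_rw [hφ.sq_pow_div_refinedWeight]
  rw [lintegral_eq_tsum_dyadic_japaneseBracket]
  obtain ⟨C, hC, hle⟩ := hφ.exists_lintegral_dyadic_japaneseBracket_le (n := n)
  refine (ENNReal.tsum_le_tsum hle).trans_lt ?_
  rw [ENNReal.tsum_mul_left]
  exact ENNReal.mul_lt_top hC hsum

end SlowlyVaryingClass

end Weight

/-! ### Compactly supported Schwartz functions -/

section Density

variable {E F : Type*} [NormedAddCommGroup E] [NormedSpace ℝ E] [NormedAddCommGroup F]
  [NormedSpace ℝ F]

theorem norm_iteratedFDeriv_comp_smul {f : E → F} {i : ℕ} (hf : ContDiff ℝ i f) (c : ℝ) (x : E) :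
    ‖iteratedFDeriv ℝ i (fun y => f (c • y)) x‖ = |c| ^ i * ‖iteratedFDeriv ℝ i f (c • x)‖ := by
  rw [iteratedFDeriv_comp_const_smul c hf, norm_smul, norm_pow, Real.norm_eq_abs]

theorem exists_norm_iteratedFDeriv_le_of_hasCompactSupport {f : E → F} (hf : ContDiff ℝ ∞ f)
    (hs : HasCompactSupport f) (i : ℕ) :
    ∃ B, 0 ≤ B ∧ ∀ l ≤ i, ∀ x, ‖iteratedFDeriv ℝ l f x‖ ≤ B := by
  have h : ∀ l : ℕ, ∃ B : ℝ, ∀ x, ‖iteratedFDeriv ℝ l f x‖ ≤ B := fun l =>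
    (hs.iteratedFDeriv l).exists_bound_of_continuous
      (hf.of_le (mod_cast le_top)).continuous_iteratedFDeriv'
  choose B hB using h
  refine ⟨∑ l ∈ Finset.range (i + 1), |B l|, Finset.sum_nonneg fun _ _ => abs_nonneg _,
    fun l hl x => ?_⟩
  exact (hB l x).trans ((le_abs_self _).trans (Finset.single_le_sum (f := fun l => |B l|)
    (fun _ _ => abs_nonneg _) (Finset.mem_range.2 (Nat.lt_succ_of_le hl))))

/-- If `θ (c • x) ≠ 0` then `1 ≤ c * ‖x‖`, so one more power of `‖x‖` yields the factor `c`. -/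
theorem norm_pow_mul_iteratedFDeriv_comp_smul_smul_le {θ : E → ℝ} (hθ : ContDiff ℝ ∞ θ)
    (hθ0 : EqOn θ 0 (Metric.ball 0 1)) {q : ℕ} {B : ℝ}
    (hB : ∀ l ≤ q, ∀ x, ‖iteratedFDeriv ℝ l θ x‖ ≤ B) {c : ℝ} (hc0 : 0 < c) (hc1 : c ≤ 1)
    (g : 𝓢(E, F)) (p : ℕ) (x : E) :
    ‖x‖ ^ p * ‖iteratedFDeriv ℝ q (fun y => θ (c • y) • g y) x‖ ≤
      c * ∑ i ∈ Finset.range (q + 1),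
        (q.choose i : ℝ) * B * SchwartzMap.seminorm ℝ (p + 1) (q - i) g := by
  have hB0 : 0 ≤ B := (norm_nonneg _).trans (hB 0 q.zero_le 0)
  rcases lt_or_ge ‖c • x‖ 1 with hx | hx
  · have hzero : (fun y => θ (c • y) • g y) =ᶠ[𝓝 x] 0 := by
      have hcont : ContinuousAt (fun y : E => ‖c • y‖) x := by fun_prop
      filter_upwards [hcont.eventually (gt_mem_nhds hx)] with y hy
      rw [hθ0 (mem_ball_zero_iff.2 hy), Pi.zero_apply, zero_smul, Pi.zero_apply]
    rw [(hzero.iteratedFDeriv ℝ q).eq_of_nhds, iteratedFDeriv_zero, Pi.zero_apply, norm_zero,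
      mul_zero]
    positivity
  · rw [norm_smul, Real.norm_of_nonneg hc0.le] at hx
    have hθc : ContDiff ℝ ∞ fun y => θ (c • y) := hθ.comp (contDiff_const_smul c)
    calc ‖x‖ ^ p * ‖iteratedFDeriv ℝ q (fun y => θ (c • y) • g y) x‖
        ≤ (c * ‖x‖) * ‖x‖ ^ p * ∑ i ∈ Finset.range (q + 1), (q.choose i : ℝ) *
            ‖iteratedFDeriv ℝ i (fun y => θ (c • y)) x‖ * ‖iteratedFDeriv ℝ (q - i) g x‖ := by
          gcongr
          · exact le_mul_of_one_le_left (by positivity) hx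
          · exact norm_iteratedFDeriv_smul_le hθc (g.smooth ⊤) x (mod_cast le_top)
      _ = c * ∑ i ∈ Finset.range (q + 1), (q.choose i : ℝ) *
            ‖iteratedFDeriv ℝ i (fun y => θ (c • y)) x‖ *
            (‖x‖ ^ (p + 1) * ‖iteratedFDeriv ℝ (q - i) g x‖) := by
          rw [mul_assoc, mul_assoc, Finset.mul_sum, Finset.mul_sum]
          congr 1
          refine Finset.sum_congr rfl fun i _ => ?_
          ring
      _ ≤ _ := by
          gcongr with i hi
          · rw [norm_iteratedFDeriv_comp_smul (hθ.of_le (mod_cast le_top)), abs_of_pos hc0]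
            calc c ^ i * ‖iteratedFDeriv ℝ i θ (c • x)‖ ≤ 1 * B :=
                  mul_le_mul (pow_le_one₀ hc0.le hc1)
                    (hB i (Nat.le_of_lt_succ (Finset.mem_range.1 hi)) _) (norm_nonneg _) zero_le_one
              _ = B := one_mul B
          · exact SchwartzMap.le_seminorm ℝ (p + 1) (q - i) g x

theorem exists_norm_iteratedFDeriv_sub_one_le {χ : E → ℝ} (hχ : ContDiff ℝ ∞ χ)
    (hχs : HasCompactSupport χ) (q : ℕ) :
    ∃ B, ∀ l ≤ q, ∀ x, ‖iteratedFDeriv ℝ l (fun y => χ y - 1) x‖ ≤ B := by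
  obtain ⟨B, -, hB⟩ := exists_norm_iteratedFDeriv_le_of_hasCompactSupport hχ hχs q
  refine ⟨B + 1, fun l hl x => ?_⟩
  have hsub : iteratedFDeriv ℝ l (fun y => χ y - 1) x =
      iteratedFDeriv ℝ l χ x - iteratedFDeriv ℝ l (fun _ => (1 : ℝ)) x :=
    iteratedFDeriv_sub_apply (hχ.of_le (mod_cast le_top)).contDiffAt contDiffAt_const
  rw [hsub]
  refine (norm_sub_le _ _).trans (add_le_add (hB l hl x) ?_)
  rcases Nat.eq_zero_or_pos l with rfl | hl0
  · simp
  · rw [iteratedFDeriv_const_of_ne hl0.ne', Pi.zero_apply, norm_zero]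
    exact zero_le_one

theorem dense_setOf_hasCompactSupport_schwartzMap [FiniteDimensional ℝ E] :
    Dense {g : 𝓢(E, F) | HasCompactSupport g} := by
  intro g
  let χ : ContDiffBump (0 : E) := ⟨1, 2, one_pos, one_lt_two⟩
  let c : ℕ → ℝ := fun k => 1 / ((k : ℝ) + 1)
  have hc0 : ∀ k, 0 < c k := fun k => Nat.one_div_pos_of_nat
  have hc1 : ∀ k, c k ≤ 1 := fun k =>
    (div_le_one k.cast_add_one_pos).2 (le_add_of_nonneg_left k.cast_nonneg)
  have hsupp : ∀ k, HasCompactSupport fun x => χ (c k • x) • g x := fun k =>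
    (χ.hasCompactSupport.comp_smul (hc0 k).ne').smul_right
  have hsmooth : ∀ k, ContDiff ℝ ∞ fun x => χ (c k • x) • g x := fun k =>
    (χ.contDiff.comp (contDiff_const_smul (c k))).smul (g.smooth ⊤)
  let G : ℕ → 𝓢(E, F) := fun k => (hsupp k).toSchwartzMap (hsmooth k)
  have hsub : ∀ k, ⇑(G k - g) = fun x => (χ (c k • x) - 1) • g x := fun k => by
    ext x
    rw [sub_smul, one_smul]
    rfl
  have hχ1 : EqOn (fun x => χ x - 1) 0 (Metric.ball 0 1) := fun x hx =>
    sub_eq_zero.2 (χ.one_of_mem_closedBall (Metric.ball_subset_closedBall hx))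
  suffices hG : Tendsto G atTop (𝓝 g) from mem_closure_of_tendsto hG (.of_forall hsupp)
  rw [(schwartz_withSeminorms ℝ E F).tendsto_nhds]
  rintro ⟨p, q⟩ ε hε
  obtain ⟨B, hB⟩ := exists_norm_iteratedFDeriv_sub_one_le χ.contDiff χ.hasCompactSupport q
  set D : ℝ := ∑ i ∈ Finset.range (q + 1),
    (q.choose i : ℝ) * B * SchwartzMap.seminorm ℝ (p + 1) (q - i) g
  have hB0 : 0 ≤ B := (norm_nonneg _).trans (hB 0 q.zero_le 0)
  have hle : ∀ k, SchwartzMap.seminorm ℝ p q (G k - g) ≤ c k * D := fun k =>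
    SchwartzMap.seminorm_le_bound ℝ p q _ (mul_nonneg (hc0 k).le (by positivity)) fun x => by
      rw [hsub]
      exact norm_pow_mul_iteratedFDeriv_comp_smul_smul_le (χ.contDiff.sub contDiff_const) hχ1 hB
        (hc0 k) (hc1 k) g p x
  have hlim : Tendsto (fun k => c k * D) atTop (𝓝 0) := by
    simpa only [zero_mul] using (tendsto_one_div_add_atTop_nhds_zero_nat (𝕜 := ℝ)).mul_const D
  filter_upwards [hlim.eventually (gt_mem_nhds hε)] with k hk
  exact (hle k).trans_lt hk

end Density

theorem norm_sq_eq_integral_norm_sq {α : Type*} [MeasurableSpace α] {μ : Measure α} {E : Type*}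
    [NormedAddCommGroup E] [InnerProductSpace ℂ E] (f : Lp E 2 μ) :
    ‖f‖ ^ 2 = ∫ a, ‖f a‖ ^ 2 ∂μ := by
  have h := inner_self_eq_norm_sq_to_K (𝕜 := ℂ) f
  rw [L2.inner_def] at h
  simp only [inner_self_eq_norm_sq_to_K, ← RCLike.ofReal_pow] at h
  rw [integral_ofReal] at h
  exact_mod_cast h.symm

/-! ### Fourier synthesis -/

section FourierChar

variable {E : Type*} [NormedAddCommGroup E] [InnerProductSpace ℝ E]

theorem continuous_fourierChar_inner_left (x : E) :
    Continuous fun ξ : E => ((𝐞 (inner ℝ ξ x) : Circle) : ℂ) :=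
  continuous_subtype_val.comp (Real.continuous_fourierChar.comp (by fun_prop))

theorem continuous_fourierChar_inner_right (ξ : E) :
    Continuous fun x : E => ((𝐞 (inner ℝ ξ x) : Circle) : ℂ) :=
  continuous_subtype_val.comp (Real.continuous_fourierChar.comp (by fun_prop))

variable [MeasurableSpace E] [BorelSpace E] {μ : Measure E} {p : E → ℂ}

theorem memLp_conj_fourierChar_mul (hp : MemLp p 2 μ) (x : E) :
    MemLp (fun ξ => conj (((𝐞 (inner ℝ ξ x) : Circle) : ℂ) * p ξ)) 2 μ := by
  refine hp.of_le ?_ (ae_of_all _ fun ξ => by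
    rw [RCLike.norm_conj, norm_mul, Circle.norm_coe, one_mul])
  exact Complex.continuous_conj.comp_aestronglyMeasurable
    ((continuous_fourierChar_inner_left x).measurable.aestronglyMeasurable.mul hp.1)

theorem tendsto_integral_norm_sub_fourierChar_sq_mul (hp : MemLp p 2 μ) (x₀ : E) :
    Tendsto (fun x => ∫ ξ, ‖((𝐞 (inner ℝ ξ x) : Circle) : ℂ) -
      ((𝐞 (inner ℝ ξ x₀) : Circle) : ℂ)‖ ^ 2 * ‖p ξ‖ ^ 2 ∂μ) (𝓝 x₀) (𝓝 0) := by
  have hzero : ∫ ξ, ‖((𝐞 (inner ℝ ξ x₀) : Circle) : ℂ) -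
      ((𝐞 (inner ℝ ξ x₀) : Circle) : ℂ)‖ ^ 2 * ‖p ξ‖ ^ 2 ∂μ = 0 := by
    simp
  rw [← hzero]
  refine tendsto_integral_filter_of_dominated_convergence (fun ξ => 2 ^ 2 * ‖p ξ‖ ^ 2)
    (.of_forall fun x => ?_) (.of_forall fun x => ae_of_all _ fun ξ => ?_)
    (hp.norm.integrable_sq.const_mul _) (ae_of_all _ fun ξ => ?_)
  · exact (((continuous_fourierChar_inner_left x).sub
      (continuous_fourierChar_inner_left x₀)).norm.pow 2).measurable.aestronglyMeasurable.mul
      (hp.1.norm.pow 2)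
  · rw [Real.norm_of_nonneg (by positivity)]
    gcongr
    refine (norm_sub_le _ _).trans ?_
    rw [Circle.norm_coe, Circle.norm_coe, one_add_one_eq_two]
  · have := continuous_fourierChar_inner_right ξ
    exact (by fun_prop : Continuous fun x : E => ‖((𝐞 (inner ℝ ξ x) : Circle) : ℂ) -
      ((𝐞 (inner ℝ ξ x₀) : Circle) : ℂ)‖ ^ 2 * ‖p ξ‖ ^ 2).tendsto x₀

theorem continuous_toLp_conj_fourierChar_mul (hp : MemLp p 2 μ) :
    Continuous fun x : E => (memLp_conj_fourierChar_mul hp x).toLp _ := by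
  refine continuous_iff_continuousAt.2 fun x₀ => tendsto_iff_norm_sub_tendsto_zero.2 ?_
  have hnorm : ∀ x, ‖(memLp_conj_fourierChar_mul hp x).toLp _ -
      (memLp_conj_fourierChar_mul hp x₀).toLp _‖ ^ 2 = ∫ ξ, ‖((𝐞 (inner ℝ ξ x) : Circle) : ℂ) -
        ((𝐞 (inner ℝ ξ x₀) : Circle) : ℂ)‖ ^ 2 * ‖p ξ‖ ^ 2 ∂μ := by
    intro x
    rw [← MemLp.toLp_sub, norm_sq_eq_integral_norm_sq]
    refine integral_congr_ae ?_
    filter_upwards [((memLp_conj_fourierChar_mul hp x).sub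
      (memLp_conj_fourierChar_mul hp x₀)).coeFn_toLp] with ξ hξ
    rw [hξ, Pi.sub_apply, ← map_sub, ← sub_mul, RCLike.norm_conj, norm_mul, mul_pow]
  have hsq := tendsto_integral_norm_sub_fourierChar_sq_mul hp x₀
  simp_rw [← hnorm] at hsq
  simpa only [Real.sqrt_sq (norm_nonneg _), Real.sqrt_zero] using hsq.sqrt

theorem continuous_inner_of_forall_continuous_inner {X Y H : Type*} [TopologicalSpace X]
    [TopologicalSpace Y] [NormedAddCommGroup H] [InnerProductSpace ℂ H] {κ : X → H} {γ : Y → H}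
    (hκ : Continuous κ) {R : ℝ} (hR : ∀ y, ‖γ y‖ ≤ R)
    (hγ : ∀ a, Continuous fun y => inner ℂ a (γ y)) :
    Continuous fun q : X × Y => inner ℂ (κ q.1) (γ q.2) := by
  refine continuous_iff_continuousAt.2 fun q₀ => ?_
  have hleft : Tendsto (fun q : X × Y => inner ℂ (κ q.1 - κ q₀.1) (γ q.2)) (𝓝 q₀) (𝓝 0) := by
    refine squeeze_zero_norm (a := fun q => ‖κ q.1 - κ q₀.1‖ * R) (fun q => ?_) ?_
    · exact (norm_inner_le_norm _ _).trans (by gcongr; exact hR _)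
    · have hcont : Continuous fun q : X × Y => ‖κ q.1 - κ q₀.1‖ * R := by fun_prop
      simpa only [sub_self, norm_zero, zero_mul] using hcont.tendsto q₀
  have hright := ((hγ (κ q₀.1)).comp continuous_snd).tendsto q₀
  have hsum := hleft.add hright
  simp only [Function.comp_apply, zero_add, ← inner_add_left, sub_add_cancel] at hsum
  exact hsum

theorem continuous_integral_fourierChar_mul (hp : MemLp p 2 μ) {Y : Type*} [TopologicalSpace Y]
    {γ : Y → Lp ℂ 2 μ} {R : ℝ} (hR : ∀ y, ‖γ y‖ ≤ R)
    (hγ : ∀ a, Continuous fun y => inner ℂ a (γ y)) :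
    Continuous fun q : E × Y => ∫ ξ, 𝐞 (inner ℝ ξ q.1) • (p ξ * γ q.2 ξ) ∂μ := by
  refine (continuous_inner_of_forall_continuous_inner (continuous_toLp_conj_fourierChar_mul hp)
    hR hγ).congr fun q => ?_
  rw [L2.inner_def]
  refine integral_congr_ae ?_
  filter_upwards [(memLp_conj_fourierChar_mul hp q.1).coeFn_toLp] with ξ hξ
  rw [hξ, RCLike.inner_apply, Complex.conj_conj, Circle.smul_def, smul_eq_mul]
  ring

end FourierChar

theorem integral_fourierInv_mul {E : Type*} [NormedAddCommGroup E] [InnerProductSpace ℝ E]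
    [FiniteDimensional ℝ E] [MeasurableSpace E] [BorelSpace E] {f g : E → ℂ} (hf : Integrable f)
    (hg : Integrable g) : ∫ ξ, (𝓕⁻ g) ξ * f ξ = ∫ x, g x * (𝓕⁻ f) x := by
  have hL : Continuous fun p : E × E => (-innerₗ E) p.1 p.2 :=
    (by fun_prop : Continuous fun p : E × E => -inner ℝ p.1 p.2)
  have hflip : (-innerₗ E).flip = -innerₗ E := by
    ext x y
    simp [real_inner_comm]
  have h := VectorFourier.integral_fourierIntegral_smul_eq_flip (μ := volume) (ν := volume)
    Real.continuous_fourierChar hL hg hf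
  rwa [hflip] at h

theorem continuous_schwartzMap_integral_mul {E : Type*} [NormedAddCommGroup E] [NormedSpace ℝ E]
    [MeasurableSpace E] [BorelSpace E] {μ : Measure E} [μ.HasTemperateGrowth] {f : E → ℂ}
    (hf : Integrable f μ) : Continuous fun g : 𝓢(E, ℂ) => ∫ ξ, g ξ * f ξ ∂μ := by
  refine (map_continuous (Lp.toTemperedDistribution
    ((memLp_one_iff_integrable.2 hf).toLp f))).congr fun g => ?_
  rw [Lp.toTemperedDistribution_apply]
  refine integral_congr_ae ?_
  filter_upwards [(memLp_one_iff_integrable.2 hf).coeFn_toLp] with ξ hξ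
  rw [hξ, smul_eq_mul]

theorem HasFourierFunction.fourier_apply_eq_integral {n : ℕ} {u : 𝓢'(EuclSp n, ℂ)}
    {f : EuclSp n → ℂ} (hu : HasFourierFunction u f) (hf : Integrable f) (g : 𝓢(EuclSp n, ℂ)) :
    (𝓕 u) g = ∫ ξ, g ξ * f ξ :=
  congrFun (Continuous.ext_on dense_setOf_hasCompactSupport_schwartzMap (map_continuous (𝓕 u))
    (continuous_schwartzMap_integral_mul hf) hu.2) g

theorem continuous_of_forall_continuous_apply {E F Z : Type*} [NormedAddCommGroup E]
    [NormedSpace ℝ E] [FiniteDimensional ℝ E] [NormedAddCommGroup F] [NormedSpace ℝ F]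
    [FiniteDimensional ℝ F] [TopologicalSpace Z] {k : ℕ} {D : Z → E [×k]→L[ℝ] F}
    (h : ∀ m, Continuous fun z => D z m) : Continuous D := by
  let ev : (E [×k]→L[ℝ] F) →ₗ[ℝ] ((Fin k → E) → F) :=
    { toFun := fun D m => D m
      map_add' := fun _ _ => rfl
      map_smul' := fun _ _ => rfl }
  have : FiniteDimensional ℝ (E [×k]→L[ℝ] F) :=
    Module.Finite.of_injective
      (ContinuousMultilinearMap.toMultilinearMapLinear :
        (E [×k]→L[ℝ] F) →ₗ[ℝ] MultilinearMap ℝ (fun _ : Fin k => E) F)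
      ContinuousMultilinearMap.toMultilinearMap_injective
  have hev : LinearMap.ker ev = ⊥ := LinearMap.ker_eq_bot.2 fun D D' hD =>
    ContinuousMultilinearMap.ext fun m => congrFun hD m
  exact (LinearMap.isClosedEmbedding_of_injective hev).isInducing.continuous_iff.2
    (continuous_pi h)

section Synthesis

variable {n : ℕ} {φ : ℝ → ℝ} {ρ : ℕ} {s : ℝ}

/-- The inverse Fourier transform of `g / (⟨ξ⟩^s φ(⟨ξ⟩))`; composed with `weightedFourier` it
recovers an element of `H^{s,φ}(ℝⁿ)` as a function. -/
noncomputable def weightedSynthesis (s : ℝ) (φ : ℝ → ℝ) (g : EuclSp n → ℂ) : EuclSp n → ℂ :=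
  𝓕⁻ fun ξ => (((refinedWeight s φ ξ)⁻¹ : ℝ) : ℂ) * g ξ

theorem weightedSynthesis_eq (s : ℝ) (φ : ℝ → ℝ) (g : EuclSp n → ℂ) :
    weightedSynthesis s φ g = VectorFourier.fourierIntegral 𝐞 volume
      (-(innerSL ℝ : EuclSp n →L[ℝ] EuclSp n →L[ℝ] ℝ)).toLinearMap₁₂
      fun ξ => (((refinedWeight s φ ξ)⁻¹ : ℝ) : ℂ) * g ξ := rfl

theorem weightedSynthesis_congr_ae {g g' : EuclSp n → ℂ} (h : g =ᵐ[volume] g') :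
    weightedSynthesis s φ g = weightedSynthesis s φ g' := by
  rw [weightedSynthesis_eq, weightedSynthesis_eq]
  refine VectorFourier.fourierIntegral_congr_ae _ _ _ ?_
  filter_upwards [h] with ξ hξ
  rw [hξ]

theorem weightedSynthesis_smul (c : ℂ) (g : EuclSp n → ℂ) :
    weightedSynthesis s φ (c • g) = c • weightedSynthesis s φ g := by
  rw [weightedSynthesis_eq, weightedSynthesis_eq, ← VectorFourier.fourierIntegral_const_smul]
  congr 1
  ext ξ
  exact mul_left_comm _ _ _

theorem norm_pow_le_japaneseBracket_pow {k : ℕ} (hk : k ≤ ρ) (ξ : EuclSp n) :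
    ‖ξ‖ ^ k ≤ japaneseBracket ξ ^ ρ :=
  (pow_le_pow_left₀ (norm_nonneg _) (norm_le_japaneseBracket ξ) k).trans
    (pow_le_pow_right₀ (one_le_japaneseBracket ξ) hk)

theorem aestronglyMeasurable_weight_inv_mul (hφ : SlowlyVaryingClass φ) {g : EuclSp n → ℂ}
    (hg : AEStronglyMeasurable g volume) :
    AEStronglyMeasurable (fun ξ => (((refinedWeight s φ ξ)⁻¹ : ℝ) : ℂ) * g ξ) volume :=
  (Complex.measurable_ofReal.comp
    (hφ.measurable_refinedWeight s).inv).aestronglyMeasurable.mul hg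

theorem integrable_pow_mul_weight_inv_mul (hφ : SlowlyVaryingClass φ)
    (hK : MemLp (fun ξ : EuclSp n => japaneseBracket ξ ^ ρ / refinedWeight s φ ξ) 2 volume)
    {g : EuclSp n → ℂ} (hg : MemLp g 2 volume) {k : ℕ} (hk : k ≤ ρ) :
    Integrable (fun ξ => ‖ξ‖ ^ k * ‖(((refinedWeight s φ ξ)⁻¹ : ℝ) : ℂ) * g ξ‖) := by
  refine (hK.integrable_mul hg.norm).mono' ?_ (ae_of_all _ fun ξ => ?_)
  · exact (by fun_prop : AEStronglyMeasurable (fun ξ : EuclSp n => ‖ξ‖ ^ k) volume).mul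
      (aestronglyMeasurable_weight_inv_mul hφ hg.1).norm
  · have hw := hφ.refinedWeight_pos s ξ
    rw [Real.norm_of_nonneg (by positivity), norm_mul, Complex.norm_real,
      Real.norm_of_nonneg (by positivity), Pi.mul_apply, div_eq_mul_inv, ← mul_assoc]
    gcongr
    exact norm_pow_le_japaneseBracket_pow hk ξ

theorem integrable_weight_inv_mul (hφ : SlowlyVaryingClass φ)
    (hK : MemLp (fun ξ : EuclSp n => japaneseBracket ξ ^ ρ / refinedWeight s φ ξ) 2 volume)
    {g : EuclSp n → ℂ} (hg : MemLp g 2 volume) :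
    Integrable (fun ξ => (((refinedWeight s φ ξ)⁻¹ : ℝ) : ℂ) * g ξ) := by
  rw [← integrable_norm_iff (aestronglyMeasurable_weight_inv_mul hφ hg.1)]
  simpa only [pow_zero, one_mul] using integrable_pow_mul_weight_inv_mul hφ hK hg (Nat.zero_le ρ)

theorem contDiff_weightedSynthesis (hφ : SlowlyVaryingClass φ)
    (hK : MemLp (fun ξ : EuclSp n => japaneseBracket ξ ^ ρ / refinedWeight s φ ξ) 2 volume)
    {g : EuclSp n → ℂ} (hg : MemLp g 2 volume) : ContDiff ℝ ρ (weightedSynthesis s φ g) := by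
  rw [weightedSynthesis_eq]
  exact VectorFourier.contDiff_fourierIntegral (N := (ρ : ℕ∞)) _ fun k hk =>
    integrable_pow_mul_weight_inv_mul hφ hK hg (mod_cast hk)

theorem weightedSynthesis_add (hφ : SlowlyVaryingClass φ)
    (hK : MemLp (fun ξ : EuclSp n => japaneseBracket ξ ^ ρ / refinedWeight s φ ξ) 2 volume)
    {g g' : EuclSp n → ℂ} (hg : MemLp g 2 volume) (hg' : MemLp g' 2 volume) :
    weightedSynthesis s φ (g + g') = weightedSynthesis s φ g + weightedSynthesis s φ g' := by
  rw [weightedSynthesis_eq, weightedSynthesis_eq, weightedSynthesis_eq,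
    ← VectorFourier.fourierIntegral_add Real.continuous_fourierChar
      ((-(innerSL ℝ : EuclSp n →L[ℝ] EuclSp n →L[ℝ] ℝ)).continuous₂)
      (integrable_weight_inv_mul hφ hK hg) (integrable_weight_inv_mul hφ hK hg')]
  congr 1
  ext ξ
  exact mul_add _ _ _

theorem norm_prod_inner_le {k : ℕ} (ξ : EuclSp n) (m : Fin k → EuclSp n) :
    ‖∏ i, inner ℝ ξ (m i)‖ ≤ ‖ξ‖ ^ k * ∏ i, ‖m i‖ := by
  calc ‖∏ i, inner ℝ ξ (m i)‖ = ∏ i, ‖inner ℝ ξ (m i)‖ := norm_prod _ _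
    _ ≤ ∏ i, ‖ξ‖ * ‖m i‖ :=
      Finset.prod_le_prod (fun _ _ => norm_nonneg _) fun i _ => norm_inner_le_norm ξ (m i)
    _ = ‖ξ‖ ^ k * ∏ i, ‖m i‖ := by
      rw [Finset.prod_mul_distrib, Finset.prod_const, Finset.card_univ, Fintype.card_fin]

theorem memLp_prod_inner_mul_weight_inv (hφ : SlowlyVaryingClass φ)
    (hK : MemLp (fun ξ : EuclSp n => japaneseBracket ξ ^ ρ / refinedWeight s φ ξ) 2 volume)
    {k : ℕ} (hk : k ≤ ρ) (m : Fin k → EuclSp n) :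
    MemLp (fun ξ : EuclSp n => ((∏ i, inner ℝ ξ (m i) : ℝ) : ℂ) *
      (((refinedWeight s φ ξ)⁻¹ : ℝ) : ℂ)) 2 volume := by
  refine hK.of_le_mul (c := ∏ i, ‖m i‖) ?_ (ae_of_all _ fun ξ => ?_)
  · have hcont : Continuous fun ξ : EuclSp n => ((∏ i, inner ℝ ξ (m i) : ℝ) : ℂ) := by fun_prop
    exact hcont.aestronglyMeasurable.mul (Complex.measurable_ofReal.comp
      (hφ.measurable_refinedWeight s).inv).aestronglyMeasurable
  · have hw := hφ.refinedWeight_pos s ξ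
    have hj := japaneseBracket_pos ξ
    rw [norm_mul, Complex.norm_real, Complex.norm_real, Real.norm_of_nonneg (inv_pos.2 hw).le,
      Real.norm_of_nonneg (by positivity : 0 ≤ japaneseBracket ξ ^ ρ / refinedWeight s φ ξ)]
    calc ‖∏ i, inner ℝ ξ (m i)‖ * (refinedWeight s φ ξ)⁻¹
        ≤ (japaneseBracket ξ ^ ρ * ∏ i, ‖m i‖) * (refinedWeight s φ ξ)⁻¹ := by
          gcongr
          refine (norm_prod_inner_le ξ m).trans ?_
          gcongr
          exact norm_pow_le_japaneseBracket_pow hk ξ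
      _ = (∏ i, ‖m i‖) * (japaneseBracket ξ ^ ρ / refinedWeight s φ ξ) := by
          rw [div_eq_mul_inv]
          ring

theorem iteratedFDeriv_weightedSynthesis_apply (hφ : SlowlyVaryingClass φ)
    (hK : MemLp (fun ξ : EuclSp n => japaneseBracket ξ ^ ρ / refinedWeight s φ ξ) 2 volume)
    {g : EuclSp n → ℂ} (hg : MemLp g 2 volume) {k : ℕ} (hk : k ≤ ρ) (x : EuclSp n)
    (m : Fin k → EuclSp n) :
    iteratedFDeriv ℝ k (weightedSynthesis s φ g) x m =
      (2 * Real.pi * Complex.I) ^ k * ∫ ξ, 𝐞 (inner ℝ ξ x) •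
        (((∏ i, inner ℝ ξ (m i) : ℝ) : ℂ) * (((refinedWeight s φ ξ)⁻¹ : ℝ) : ℂ) * g ξ) := by
  set L : EuclSp n →L[ℝ] EuclSp n →L[ℝ] ℝ := -(innerSL ℝ : EuclSp n →L[ℝ] EuclSp n →L[ℝ] ℝ)
  rw [weightedSynthesis_eq, VectorFourier.iteratedFDeriv_fourierIntegral (N := (ρ : ℕ∞)) L
    (fun j hj => integrable_pow_mul_weight_inv_mul hφ hK hg (mod_cast hj))
    (aestronglyMeasurable_weight_inv_mul hφ hg.1) (mod_cast hk),
    Real.fourierIntegral_continuousMultilinearMap_apply'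
      (VectorFourier.integrable_fourierPowSMulRight L
        (integrable_pow_mul_weight_inv_mul hφ hK hg hk)
        (aestronglyMeasurable_weight_inv_mul hφ hg.1)), ← integral_const_mul]
  refine integral_congr_ae (ae_of_all _ fun ξ => ?_)
  have hL : ∀ y, L ξ y = -inner ℝ ξ y := fun _ => rfl
  change 𝐞 (-(L ξ x)) • (VectorFourier.fourierPowSMulRight L _ ξ k :
    (EuclSp n) [×k]→L[ℝ] ℂ) m = _
  rw [VectorFourier.fourierPowSMulRight_apply, hL, neg_neg]
  simp only [hL, Finset.prod_neg, Finset.card_univ, Fintype.card_fin, smul_eq_mul,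
    Complex.real_smul, Circle.smul_def, Complex.ofReal_mul, Complex.ofReal_pow,
    Complex.ofReal_neg, Complex.ofReal_one]
  rw [neg_pow (2 * Real.pi * Complex.I : ℂ)]
  have hsign : ((-1 : ℂ) ^ k) * (-1) ^ k = 1 := by rw [← mul_pow]; norm_num
  linear_combination ((2 * Real.pi * Complex.I) ^ k * (𝐞 (inner ℝ ξ x) : ℂ) *
    ((∏ i, inner ℝ ξ (m i) : ℝ) : ℂ) * (((refinedWeight s φ ξ)⁻¹ : ℝ) : ℂ) * g ξ) * hsign

theorem continuous_iteratedFDeriv_weightedSynthesis (hφ : SlowlyVaryingClass φ)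
    (hK : MemLp (fun ξ : EuclSp n => japaneseBracket ξ ^ ρ / refinedWeight s φ ξ) 2 volume)
    {Y : Type*} [TopologicalSpace Y] {γ : Y → Lp ℂ 2 (volume : Measure (EuclSp n))} {R : ℝ}
    (hR : ∀ y, ‖γ y‖ ≤ R) (hγ : ∀ a, Continuous fun y => inner ℂ a (γ y)) {k : ℕ} (hk : k ≤ ρ) :
    Continuous fun q : EuclSp n × Y =>
      iteratedFDeriv ℝ k (weightedSynthesis s φ (γ q.2)) q.1 := by
  refine continuous_of_forall_continuous_apply fun m => ?_
  simp_rw [iteratedFDeriv_weightedSynthesis_apply hφ hK (Lp.memLp _) hk]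
  exact continuous_const.mul (continuous_integral_fourierChar_mul
    (memLp_prod_inner_mul_weight_inv hφ hK hk m) hR hγ)

theorem weight_inv_mul_weightedFourier_ae_eq (hφ : SlowlyVaryingClass φ) {u : 𝓢'(EuclSp n, ℂ)}
    (hu : u ∈ refinedSubmodule n s φ) {f : EuclSp n → ℂ} (hf : HasFourierFunction u f) :
    (fun ξ => (((refinedWeight s φ ξ)⁻¹ : ℝ) : ℂ) * weightedFourier n s φ ⟨u, hu⟩ ξ)
      =ᵐ[volume] f := by
  filter_upwards [hu.choose_spec.2.coeFn_toLp, hu.choose_spec.1.ae_eq hf] with ξ hcoe hξ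
  change _ * (hu.choose_spec.2.toLp _) ξ = _
  have hw : (refinedWeight s φ ξ : ℂ) ≠ 0 :=
    Complex.ofReal_ne_zero.2 (hφ.refinedWeight_pos s ξ).ne'
  rw [hcoe, hξ, Complex.ofReal_inv, inv_mul_cancel_left₀ hw]

theorem apply_eq_integral_weightedSynthesis (hφ : SlowlyVaryingClass φ)
    (hK : MemLp (fun ξ : EuclSp n => japaneseBracket ξ ^ ρ / refinedWeight s φ ξ) 2 volume)
    {u : 𝓢'(EuclSp n, ℂ)} (hu : u ∈ refinedSubmodule n s φ) (g : 𝓢(EuclSp n, ℂ)) :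
    u g = ∫ x, g x * weightedSynthesis s φ (weightedFourier n s φ ⟨u, hu⟩) x := by
  obtain ⟨f, hf, -⟩ := id hu
  have hae := weight_inv_mul_weightedFourier_ae_eq hφ hu hf
  have hfi : Integrable f :=
    (integrable_weight_inv_mul hφ hK (Lp.memLp (weightedFourier n s φ ⟨u, hu⟩))).congr hae
  have hsynth : weightedSynthesis s φ (weightedFourier n s φ ⟨u, hu⟩) = 𝓕⁻ f :=
    VectorFourier.fourierIntegral_congr_ae 𝐞 volume (-innerₗ (EuclSp n)) hae
  calc u g = (𝓕 u) (𝓕⁻ g) := by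
        rw [TemperedDistribution.fourier_apply, FourierTransform.fourier_fourierInv_eq]
    _ = ∫ ξ, (𝓕⁻ g) ξ * f ξ := hf.fourier_apply_eq_integral hfi _
    _ = _ := by rw [SchwartzMap.fourierInv_coe, integral_fourierInv_mul hfi g.integrable, hsynth]

end Synthesis

/-! ### Positive smooth densities -/

namespace SmoothDensity

variable {n : ℕ} {Γ : Type*} [TopologicalSpace Γ] [ChartedSpace (EuclSp n) Γ]
  [MeasurableSpace Γ] (d : SmoothDensity n Γ) {β : OpenPartialHomeomorph Γ (EuclSp n)}

theorem aemeasurable_ofReal_dens (hβ : β ∈ IsManifold.maximalAtlas (𝓡 n) ∞ Γ) :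
    AEMeasurable (fun x => ENNReal.ofReal (d.dens β x)) (volume.restrict β.target) :=
  ((d.contDiffOn_dens β hβ).continuousOn.aemeasurable β.open_target.measurableSet).ennreal_ofReal

theorem exists_forall_dens_le (hβ : β ∈ IsManifold.maximalAtlas (𝓡 n) ∞ Γ) {K : Set (EuclSp n)}
    (hK : IsCompact K) (hKβ : K ⊆ β.target) : ∃ C, ∀ x ∈ K, d.dens β x ≤ C := by
  obtain ⟨C, hC⟩ := hK.bddAbove_image ((d.contDiffOn_dens β hβ).continuousOn.mono hKβ)
  exact ⟨C, fun x hx => hC (mem_image_of_mem _ hx)⟩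

theorem exists_pos_forall_le_dens (hβ : β ∈ IsManifold.maximalAtlas (𝓡 n) ∞ Γ)
    {K : Set (EuclSp n)} (hK : IsCompact K) (hKβ : K ⊆ β.target) :
    ∃ c, 0 < c ∧ ∀ x ∈ K, c ≤ d.dens β x :=
  hK.exists_forall_le' ((d.contDiffOn_dens β hβ).continuousOn.mono hKβ)
    fun x hx => d.dens_pos β hβ x (hKβ hx)

variable [BorelSpace Γ]

theorem integral_eq_integral_chart (hβ : β ∈ IsManifold.maximalAtlas (𝓡 n) ∞ Γ) {F : Γ → ℂ}
    (hF : ContinuousOn F β.source) (hF0 : ∀ y, y ∉ β.source → F y = 0) :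
    ∫ y, F y ∂d.measure = ∫ x in β.target, (d.dens β x : ℂ) * F (β.symm x) := by
  have hac : AEStronglyMeasurable (fun x => F (β.symm x)) (volume.restrict β.target) :=
    (hF.comp β.continuousOn_symm β.mapsTo_symm).aestronglyMeasurable β.open_target.measurableSet
  have hmap : (d.measure.restrict β.source).map β =
      (volume.restrict β.target).withDensity fun x => ENNReal.ofReal (d.dens β x) :=
    d.map_restrict β hβ
  calc ∫ y, F y ∂d.measure
      = ∫ y in β.source, F y ∂d.measure :=
        (setIntegral_eq_integral_of_forall_compl_eq_zero hF0).symm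
    _ = ∫ y in β.source, F (β.symm (β y)) ∂d.measure :=
        setIntegral_congr_fun β.open_source.measurableSet fun y hy => by
          simp only [β.left_inv hy]
    _ = ∫ x, F (β.symm x) ∂(d.measure.restrict β.source).map β := by
        refine (integral_map (f := fun x => F (β.symm x))
          (β.continuousOn.aemeasurable β.open_source.measurableSet) ?_).symm
        rw [hmap]
        exact hac.mono_ac (withDensity_absolutelyContinuous _ _)
    _ = ∫ x in β.target, (ENNReal.ofReal (d.dens β x)).toReal • F (β.symm x) := by
        rw [hmap, integral_withDensity_eq_integral_toReal_smul₀ (d.aemeasurable_ofReal_dens hβ)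
          (ae_of_all _ fun _ => ENNReal.ofReal_lt_top)]
    _ = ∫ x in β.target, (d.dens β x : ℂ) * F (β.symm x) :=
        setIntegral_congr_fun β.open_target.measurableSet fun x hx => by
          simp only [ENNReal.toReal_ofReal (d.dens_pos β hβ x hx).le, Complex.real_smul]

theorem measure_source_inter_preimage (hβ : β ∈ IsManifold.maximalAtlas (𝓡 n) ∞ Γ)
    {S : Set (EuclSp n)} (hS : MeasurableSet S) :
    d.measure (β.source ∩ β ⁻¹' S) =
      ∫⁻ x in S ∩ β.target, ENNReal.ofReal (d.dens β x) := by
  have hmap := congrArg (fun μ => μ S) (d.map_restrict β hβ)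
  simp only [Measure.map_apply_of_aemeasurable
    (β.continuousOn.aemeasurable β.open_source.measurableSet) hS, withDensity_apply _ hS,
    Measure.restrict_restrict hS] at hmap
  rw [← hmap, Measure.restrict_apply' β.open_source.measurableSet, inter_comm]

theorem ofReal_mul_volume_le_measure (hβ : β ∈ IsManifold.maximalAtlas (𝓡 n) ∞ Γ)
    {S : Set (EuclSp n)} (hS : MeasurableSet S) (hSβ : S ⊆ β.target) {c : ℝ}
    (hc : ∀ x ∈ S, c ≤ d.dens β x) :
    ENNReal.ofReal c * volume S ≤ d.measure (β.source ∩ β ⁻¹' S) := by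
  rw [d.measure_source_inter_preimage hβ hS, inter_eq_left.2 hSβ, ← setLIntegral_const]
  exact setLIntegral_mono' hS fun x hx => ENNReal.ofReal_le_ofReal (hc x hx)

theorem measure_le_ofReal_mul_volume (hβ : β ∈ IsManifold.maximalAtlas (𝓡 n) ∞ Γ)
    {S : Set (EuclSp n)} (hS : MeasurableSet S) (hSβ : S ⊆ β.target) {C : ℝ}
    (hC : ∀ x ∈ S, d.dens β x ≤ C) :
    d.measure (β.source ∩ β ⁻¹' S) ≤ ENNReal.ofReal C * volume S := by
  rw [d.measure_source_inter_preimage hβ hS, inter_eq_left.2 hSβ, ← setLIntegral_const]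
  exact setLIntegral_mono' hS fun x hx => ENNReal.ofReal_le_ofReal (hC x hx)

variable [IsManifold (𝓡 n) ∞ Γ]

theorem isLocallyFiniteMeasure : IsLocallyFiniteMeasure d.measure := by
  refine ⟨fun p => ?_⟩
  set β := chartAt (EuclSp n) p
  have hβ : β ∈ IsManifold.maximalAtlas (𝓡 n) ∞ Γ := IsManifold.chart_mem_maximalAtlas p
  have hp : p ∈ β.source := mem_chart_source _ p
  obtain ⟨K, hK, hpK, hKβ⟩ := exists_compact_subset β.open_target (β.map_source hp)
  obtain ⟨C, hC⟩ := d.exists_forall_dens_le hβ hK hKβ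
  refine ⟨β.source ∩ β ⁻¹' K, ?_, ?_⟩
  · exact inter_mem (β.open_source.mem_nhds hp)
      ((β.continuousAt hp).preimage_mem_nhds (mem_interior_iff_mem_nhds.1 hpK))
  · exact (d.measure_le_ofReal_mul_volume hβ hK.measurableSet hKβ hC).trans_lt
      (ENNReal.mul_lt_top ENNReal.ofReal_lt_top hK.measure_lt_top)

theorem isOpenPosMeasure : d.measure.IsOpenPosMeasure := by
  refine ⟨fun U hU ⟨p, hpU⟩ => ?_⟩
  set β := chartAt (EuclSp n) p
  have hβ : β ∈ IsManifold.maximalAtlas (𝓡 n) ∞ Γ := IsManifold.chart_mem_maximalAtlas p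
  have hp : p ∈ β.source := mem_chart_source _ p
  set V : Set (EuclSp n) := β.target ∩ β.symm ⁻¹' U
  have hV : IsOpen V := β.isOpen_inter_preimage_symm hU
  have hpV : β p ∈ V := ⟨β.map_source hp, by rwa [mem_preimage, β.left_inv hp]⟩
  have hVU : β.source ∩ β ⁻¹' V ⊆ U := fun y hy => by
    rw [← β.left_inv hy.1]
    exact hy.2.2
  obtain ⟨K, hK, hpK, hKV⟩ := exists_compact_subset hV hpV
  obtain ⟨c, hc, hcK⟩ := d.exists_pos_forall_le_dens hβ hK (hKV.trans inter_subset_left)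
  have hKpos : volume K ≠ 0 :=
    ((isOpen_interior.measure_pos volume ⟨_, hpK⟩).trans_le (measure_mono interior_subset)).ne'
  have hpos : 0 < d.measure U := by
    calc (0 : ENNReal) < ENNReal.ofReal c * volume K :=
          ENNReal.mul_pos (ENNReal.ofReal_pos.2 hc).ne' hKpos
      _ ≤ d.measure (β.source ∩ β ⁻¹' K) :=
          d.ofReal_mul_volume_le_measure hβ hK.measurableSet (hKV.trans inter_subset_left) hcK
      _ ≤ d.measure U := measure_mono ((inter_subset_inter_right _ (preimage_mono hKV)).trans hVU)
  exact hpos.ne'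

variable [CompactSpace Γ]

theorem isFiniteMeasure : IsFiniteMeasure d.measure :=
  have := d.isLocallyFiniteMeasure
  CompactSpace.isFiniteMeasure

theorem integrable_mul_conj {f w : Γ → ℂ} (hf : Continuous f) (hw : Continuous w) :
    Integrable (fun y => f y * conj (w y)) d.measure :=
  have := d.isFiniteMeasure
  (hf.mul (Complex.continuous_conj.comp hw)).integrable_of_hasCompactSupport
    (HasCompactSupport.of_compactSpace _)

theorem eq_of_forall_integral_mul_conj_eq [T2Space Γ] {f g : Γ → ℂ} (hf : Continuous f)
    (hg : Continuous g) (h : ∀ w : CkSpace n Γ ⊤, ∫ x, f x * conj (w x) ∂d.measure =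
      ∫ x, g x * conj (w x) ∂d.measure) : f = g := by
  have := d.isFiniteMeasure
  have := d.isOpenPosMeasure
  have hint : ∀ {f : Γ → ℂ}, Continuous f → LocallyIntegrable f d.measure := fun hf =>
    (hf.integrable_of_hasCompactSupport (HasCompactSupport.of_compactSpace _)).locallyIntegrable
  refine (hf.ae_eq_iff_eq d.measure hg).1 ?_
  refine ae_eq_of_integral_contMDiff_smul_eq (𝓡 n) (hint hf) (hint hg) fun w hw _ => ?_
  have hw' : ContMDiff (𝓡 n) 𝓘(ℝ, ℂ) ∞ fun x => (w x : ℂ) :=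
    Complex.ofRealCLM.contDiff.contMDiff.comp hw
  simpa only [Complex.real_smul, Complex.conj_ofReal, mul_comm] using h ⟨fun x => (w x : ℂ), hw'⟩

end SmoothDensity

/-! ### Functions supported in a chart -/

theorem exists_norm_iteratedFDerivWithin_le_of_isCompact {𝕜 E F : Type*}
    [NontriviallyNormedField 𝕜] [NormedAddCommGroup E] [NormedSpace 𝕜 E] [NormedAddCommGroup F]
    [NormedSpace 𝕜 F] {O K : Set E} (hO : UniqueDiffOn 𝕜 O) (hK : IsCompact K) (hKO : K ⊆ O)
    {f : E → F} {i : ℕ} (hf : ContDiffOn 𝕜 i f O) :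
    ∃ B : ℝ, 1 ≤ B ∧ ∀ l ≤ i, ∀ x ∈ K, ‖iteratedFDerivWithin 𝕜 l f O x‖ ≤ B := by
  have hbound : ∀ l ≤ i, ∃ B : ℝ, ∀ x ∈ K, ‖iteratedFDerivWithin 𝕜 l f O x‖ ≤ B := fun l hl =>
    hK.exists_bound_of_continuousOn
      ((hf.continuousOn_iteratedFDerivWithin (mod_cast hl) hO).mono hKO)
  choose! B hB using hbound
  refine ⟨1 + ∑ l ∈ Finset.range (i + 1), |B l|,
    le_add_of_nonneg_right (Finset.sum_nonneg fun _ _ => abs_nonneg _), fun l hl x hx => ?_⟩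
  calc ‖iteratedFDerivWithin 𝕜 l f O x‖ ≤ |B l| := (hB l hl x hx).trans (le_abs_self _)
    _ ≤ ∑ l ∈ Finset.range (i + 1), |B l| :=
      Finset.single_le_sum (f := fun l => |B l|) (fun _ _ => abs_nonneg _)
        (Finset.mem_range_succ_iff.2 hl)
    _ ≤ 1 + ∑ l ∈ Finset.range (i + 1), |B l| := le_add_of_nonneg_left zero_le_one

theorem exists_norm_iteratedFDeriv_mul_comp_le {𝕜 E E' A : Type*} [NontriviallyNormedField 𝕜]
    [NormedAddCommGroup E] [NormedSpace 𝕜 E] [NormedAddCommGroup E'] [NormedSpace 𝕜 E']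
    [NormedRing A] [NormedAlgebra 𝕜 A] {O K : Set E} (hO : IsOpen O) (hK : IsCompact K)
    (hKO : K ⊆ O) {i : ℕ} {ψ : E → A} {τ : E → E'} (hψ : ContDiffOn 𝕜 i ψ O)
    (hτ : ContDiffOn 𝕜 i τ O) :
    ∃ C : ℝ, 0 ≤ C ∧ ∀ F : E' → A, ContDiff 𝕜 i F → ∀ p : ℝ, ∀ x ∈ K,
      (∀ l ≤ i, ‖iteratedFDeriv 𝕜 l F (τ x)‖ ≤ p) →
      ‖iteratedFDeriv 𝕜 i (fun y => ψ y * F (τ y)) x‖ ≤ C * p := by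
  obtain ⟨A, hA1, hA⟩ :=
    exists_norm_iteratedFDerivWithin_le_of_isCompact hO.uniqueDiffOn hK hKO hψ
  obtain ⟨B, hB1, hB⟩ :=
    exists_norm_iteratedFDerivWithin_le_of_isCompact hO.uniqueDiffOn hK hKO hτ
  refine ⟨∑ l ∈ Finset.range (i + 1), (i.choose l : ℝ) * A * ((i - l).factorial * B ^ (i - l)),
    Finset.sum_nonneg fun _ _ => by positivity, fun F hF p x hx hFp => ?_⟩
  have hxO := hKO hx
  have hcomp : ∀ m ≤ i, ‖iteratedFDerivWithin 𝕜 m (fun y => F (τ y)) O x‖ ≤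
      m.factorial * p * B ^ m := by
    intro m hm
    refine norm_iteratedFDerivWithin_comp_le (N := i) (g := F) (t := univ)
      hF.contDiffOn hτ (mod_cast hm) uniqueDiffOn_univ hO.uniqueDiffOn
      (mapsTo_univ _ _) hxO (fun l hl => ?_) (fun l hl₁ hl => ?_)
    · rw [iteratedFDerivWithin_univ]
      exact hFp l (hl.trans hm)
    · exact (hB l (hl.trans hm) x hx).trans (le_self_pow₀ hB1 (by omega))
  rw [← iteratedFDerivWithin_of_isOpen i hO hxO, Finset.sum_mul]
  refine (norm_iteratedFDerivWithin_mul_le (N := i) hψ (hF.comp_contDiffOn hτ) hO.uniqueDiffOn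
    hxO le_rfl).trans (Finset.sum_le_sum fun l hl => ?_)
  calc (i.choose l : ℝ) * ‖iteratedFDerivWithin 𝕜 l ψ O x‖ *
        ‖iteratedFDerivWithin 𝕜 (i - l) (fun y => F (τ y)) O x‖
      ≤ (i.choose l : ℝ) * A * ((i - l).factorial * p * B ^ (i - l)) := by
        gcongr
        · exact hA l (Finset.mem_range_succ_iff.1 hl) x hx
        · exact hcomp (i - l) (Nat.sub_le i l)
    _ = (i.choose l : ℝ) * A * ((i - l).factorial * B ^ (i - l)) * p := by ring

section CutoffComp

variable {n : ℕ} {Γ : Type*} [TopologicalSpace Γ]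

/-- The function `η · (F ∘ α)` on `Γ` obtained from a function `F` on `ℝⁿ`, a chart `α` and a
cutoff function `η` supported in the domain of the chart. -/
def cutoffComp (η : Γ → ℝ) (α : OpenPartialHomeomorph Γ (EuclSp n)) (F : EuclSp n → ℂ) : Γ → ℂ :=
  fun y => (η y : ℂ) * F (α y)

theorem cutoffComp_comp_symm_eventuallyEq_zero {η : Γ → ℝ}
    (α : OpenPartialHomeomorph Γ (EuclSp n)) {β : OpenPartialHomeomorph Γ (EuclSp n)}
    {x : EuclSp n} (hx : x ∈ β.target) (hxη : β.symm x ∉ tsupport η) (F : EuclSp n → ℂ) :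
    cutoffComp η α F ∘ β.symm =ᶠ[𝓝 x] 0 := by
  filter_upwards [(β.continuousAt_symm hx).eventually
    ((isClosed_tsupport η).isOpen_compl.mem_nhds hxη)] with z hz
  simp only [Function.comp_apply, cutoffComp, image_eq_zero_of_notMem_tsupport hz,
    Complex.ofReal_zero, zero_mul, Pi.zero_apply]

variable [ChartedSpace (EuclSp n) Γ]

theorem contMDiff_cutoffComp {η : Γ → ℝ} (hη : ContMDiff (𝓡 n) 𝓘(ℝ, ℝ) ∞ η)
    {α : OpenPartialHomeomorph Γ (EuclSp n)} (hα : α ∈ IsManifold.maximalAtlas (𝓡 n) ∞ Γ)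
    (hs : tsupport η ⊆ α.source) {k : ℕ∞} {F : EuclSp n → ℂ} (hF : ContDiff ℝ k F) :
    ContMDiff (𝓡 n) 𝓘(ℝ, ℂ) k (cutoffComp η α F) := by
  refine contMDiff_of_tsupport fun y hy => ?_
  have hy' : y ∈ α.source := by
    refine hs (closure_mono (Function.support_subset_iff'.2 fun z hz => ?_) hy)
    rw [cutoffComp, Function.notMem_support.1 hz, Complex.ofReal_zero, zero_mul]
  have hαy : ContMDiffAt (𝓡 n) (𝓡 n) k α y :=
    ((contMDiffOn_of_mem_maximalAtlas hα).contMDiffAt (α.open_source.mem_nhds hy')).of_le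
      (mod_cast le_top)
  have hηy : ContMDiffAt (𝓡 n) 𝓘(ℝ, ℂ) k (fun y => (η y : ℂ)) y :=
    ((Complex.ofRealCLM.contDiff (n := ∞)).contMDiff.comp hη).contMDiffAt.of_le (mod_cast le_top)
  exact (contDiff_mul (𝕜 := ℝ) (n := k) (𝔸 := ℂ)).contMDiff.contMDiffAt.comp y
    (hηy.prodMk_space (hF.contMDiff.contMDiffAt.comp y hαy))

theorem contDiffAt_comp_chart_symm {β : OpenPartialHomeomorph Γ (EuclSp n)}
    (hβ : β ∈ IsManifold.maximalAtlas (𝓡 n) ∞ Γ) {k : ℕ∞} {f : Γ → ℂ}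
    (hf : ContMDiff (𝓡 n) 𝓘(ℝ, ℂ) k f) {x : EuclSp n} (hx : x ∈ β.target) :
    ContDiffAt ℝ k (f ∘ β.symm) x := by
  have hsymm : ContMDiffAt (𝓡 n) (𝓡 n) k β.symm x :=
    ((contMDiffOn_symm_of_mem_maximalAtlas hβ).contMDiffAt
      (β.open_target.mem_nhds hx)).of_le (mod_cast le_top)
  exact (hf.contMDiffAt.comp x hsymm).contDiffAt

theorem contDiffOn_chart_comp_chart_symm {α β : OpenPartialHomeomorph Γ (EuclSp n)}
    (hα : α ∈ IsManifold.maximalAtlas (𝓡 n) ∞ Γ) (hβ : β ∈ IsManifold.maximalAtlas (𝓡 n) ∞ Γ) :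
    ContDiffOn ℝ ∞ (fun x => α (β.symm x)) (β.target ∩ β.symm ⁻¹' α.source) :=
  ((contMDiffOn_of_mem_maximalAtlas hα).comp
    ((contMDiffOn_symm_of_mem_maximalAtlas hβ).mono inter_subset_left)
      fun _ hx => hx.2).contDiffOn

theorem exists_norm_iteratedFDeriv_cutoffComp_le {η : Γ → ℝ}
    (hη : ContMDiff (𝓡 n) 𝓘(ℝ, ℝ) ∞ η)
    {α : OpenPartialHomeomorph Γ (EuclSp n)} (hα : α ∈ IsManifold.maximalAtlas (𝓡 n) ∞ Γ)
    (hs : tsupport η ⊆ α.source) {β : OpenPartialHomeomorph Γ (EuclSp n)}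
    (hβ : β ∈ IsManifold.maximalAtlas (𝓡 n) ∞ Γ) {K : Set (EuclSp n)} (hK : IsCompact K)
    (hKβ : K ⊆ β.target) (i : ℕ) :
    ∃ C : ℝ, 0 ≤ C ∧ ∀ F : EuclSp n → ℂ, ContDiff ℝ i F → ∀ p : ℝ,
      0 ≤ p → (∀ l ≤ i, ∀ z ∈ α '' tsupport η, ‖iteratedFDeriv ℝ l F z‖ ≤ p) →
      ∀ x ∈ K, ‖iteratedFDeriv ℝ i (cutoffComp η α F ∘ β.symm) x‖ ≤ C * p := by
  have hO : IsOpen (β.target ∩ β.symm ⁻¹' α.source) := β.isOpen_inter_preimage_symm α.open_source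
  have hKη : IsCompact (K ∩ β.symm ⁻¹' tsupport η) :=
    hK.of_isClosed_subset ((β.continuousOn_symm.mono hKβ).preimage_isClosed_of_isClosed
      hK.isClosed (isClosed_tsupport _)) inter_subset_left
  have hη' : ContDiffOn ℝ ∞ (fun x => (η (β.symm x) : ℂ)) (β.target ∩ β.symm ⁻¹' α.source) :=
    fun x hx => (contDiffAt_comp_chart_symm hβ (k := ⊤)
      ((Complex.ofRealCLM.contDiff (n := ∞)).contMDiff.comp hη) hx.1).contDiffWithinAt
  obtain ⟨C, hC0, hC⟩ := exists_norm_iteratedFDeriv_mul_comp_le hO hKη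
    (fun x hx => ⟨hKβ hx.1, hs hx.2⟩) (i := i) (hη'.of_le (mod_cast le_top))
    ((contDiffOn_chart_comp_chart_symm hα hβ).of_le (mod_cast le_top))
  refine ⟨C, hC0, fun F hF p hp hFp x hx => ?_⟩
  by_cases hxη : β.symm x ∈ tsupport η
  · exact hC F hF p x ⟨hx, hxη⟩ fun l hl => hFp l hl _ (mem_image_of_mem _ hxη)
  · rw [((cutoffComp_comp_symm_eventuallyEq_zero α (hKβ hx) hxη F).iteratedFDeriv ℝ i).eq_of_nhds,
      iteratedFDeriv_zero, Pi.zero_apply, norm_zero]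
    positivity

theorem exists_contMDiff_cutoff [T2Space Γ] [CompactSpace Γ] [IsManifold (𝓡 n) ∞ Γ] {C U : Set Γ}
    (hC : IsClosed C) (hU : IsOpen U) (hCU : C ⊆ U) :
    ∃ η : Γ → ℝ, ContMDiff (𝓡 n) 𝓘(ℝ, ℝ) ∞ η ∧ tsupport η ⊆ U ∧ ∀ y ∈ C, η y = 1 := by
  obtain ⟨f, hf0, hf1, -⟩ := exists_contMDiffMap_zero_one_nhds_of_isClosed (𝓡 n) (n := ⊤)
    hU.isClosed_compl hC (disjoint_compl_left_iff_subset.2 hCU)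
  refine ⟨f, f.contMDiff, fun y hy => ?_, fun y hy => hf1.self_of_nhdsSet y hy⟩
  by_contra hyU
  exact notMem_tsupport_iff_eventuallyEq.2
    (hf0.filter_mono (nhds_le_nhdsSet (mem_compl hyU))) hy

end CutoffComp

/-! ### The topology of `C^k(Γ)` -/

namespace CkSpace

variable {n : ℕ} {Γ : Type*} [TopologicalSpace Γ] [ChartedSpace (EuclSp n) Γ] {k : ℕ∞}

protected theorem continuous (u : CkSpace n Γ k) : Continuous (u : Γ → ℂ) :=
  ContMDiff.continuous (n := k) u.2

theorem coe_sum {ι : Type*} (t : Finset ι) (f : ι → CkSpace n Γ k) :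
    ((∑ i ∈ t, f i : CkSpace n Γ k) : Γ → ℂ) = ∑ i ∈ t, (f i : Γ → ℂ) :=
  map_sum (Submodule.subtype (ckSubmodule n Γ k)) f t

theorem continuous_ofFun_iteratedFDeriv {β : OpenPartialHomeomorph Γ (EuclSp n)}
    (hβ : β ∈ IsManifold.maximalAtlas (𝓡 n) ∞ Γ) {i : ℕ} (hi : (i : ℕ∞) ≤ k) :
    Continuous fun u : CkSpace n Γ k =>
      UniformOnFun.ofFun {K : Set (EuclSp n) | IsCompact K ∧ K ⊆ β.target}
        (iteratedFDeriv ℝ i ((u : Γ → ℂ) ∘ β.symm)) :=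
  continuous_iInf_dom (i := β) <| continuous_iInf_dom (i := hβ) <|
    continuous_iInf_dom (i := i) <| continuous_iInf_dom (i := hi) continuous_induced_dom

theorem continuous_iteratedFDeriv_apply {β : OpenPartialHomeomorph Γ (EuclSp n)}
    (hβ : β ∈ IsManifold.maximalAtlas (𝓡 n) ∞ Γ) {i : ℕ} (hi : (i : ℕ∞) ≤ k) {x : EuclSp n}
    (hx : x ∈ β.target) :
    Continuous fun u : CkSpace n Γ k => iteratedFDeriv ℝ i ((u : Γ → ℂ) ∘ β.symm) x :=
  have hK : ({x} : Set (EuclSp n)) ∈ {K : Set (EuclSp n) | IsCompact K ∧ K ⊆ β.target} :=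
    ⟨isCompact_singleton, singleton_subset_iff.2 hx⟩
  (UniformOnFun.uniformContinuous_eval_of_mem _ _ (mem_singleton x) hK).continuous.comp
    (continuous_ofFun_iteratedFDeriv hβ hi)

theorem continuous_of_forall_eventually_norm_sub_lt {X : Type*} [TopologicalSpace X]
    {f : X → CkSpace n Γ k}
    (h : ∀ x₀, ∀ β ∈ IsManifold.maximalAtlas (𝓡 n) ∞ Γ, ∀ i : ℕ, (i : ℕ∞) ≤ k →
      ∀ K ⊆ β.target, IsCompact K → ∀ ε > 0, ∀ᶠ x in 𝓝 x₀, ∀ z ∈ K,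
        ‖iteratedFDeriv ℝ i ((f x - f x₀ : CkSpace n Γ k) ∘ β.symm) z‖ < ε) :
    Continuous f := by
  refine continuous_iInf_rng.2 fun β => continuous_iInf_rng.2 fun hβ =>
    continuous_iInf_rng.2 fun i => continuous_iInf_rng.2 fun hi => continuous_induced_rng.2 <|
    continuous_iff_continuousAt.2 fun x₀ => ?_
  rw [ContinuousAt, UniformOnFun.tendsto_iff_tendstoUniformlyOn]
  rintro K ⟨hK, hKβ⟩
  refine Metric.tendstoUniformlyOn_iff.2 fun ε hε => ?_
  filter_upwards [h x₀ β hβ i hi K hKβ hK ε hε] with x hx z hz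
  have hsmooth : ∀ u : CkSpace n Γ k, ContDiffAt ℝ i ((u : Γ → ℂ) ∘ β.symm) z := fun u =>
    (contDiffAt_comp_chart_symm hβ u.2 (hKβ hz)).of_le (mod_cast hi)
  have hsub : ((f x - f x₀ : CkSpace n Γ k) : Γ → ℂ) ∘ β.symm =
      (f x : Γ → ℂ) ∘ β.symm - (f x₀ : Γ → ℂ) ∘ β.symm := rfl
  have hlt := hx z hz
  rw [hsub, iteratedFDeriv_sub_apply (hsmooth _) (hsmooth _)] at hlt
  rw [dist_comm, dist_eq_norm]
  exact hlt

end CkSpace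

/-! ### Synthesis on the manifold -/

section Synthesis

variable {n : ℕ} {Γ : Type*} [TopologicalSpace Γ]

theorem cutoffComp_add (η : Γ → ℝ) (α : OpenPartialHomeomorph Γ (EuclSp n))
    (F G : EuclSp n → ℂ) : cutoffComp η α (F + G) = cutoffComp η α F + cutoffComp η α G :=
  funext fun _ => mul_add _ _ _

theorem cutoffComp_smul (η : Γ → ℝ) (α : OpenPartialHomeomorph Γ (EuclSp n)) (a : ℂ)
    (F : EuclSp n → ℂ) : cutoffComp η α (a • F) = a • cutoffComp η α F :=
  funext fun _ => mul_left_comm _ _ _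

variable [ChartedSpace (EuclSp n) Γ]

/-- Cutoff functions adapted to an atlas with a partition of unity: each is supported in the domain
of its chart and equal to one on the support of the corresponding function of the partition. -/
structure AdaptedAtlas.Cutoffs (A : AdaptedAtlas n Γ) where
  η : Fin A.r → Γ → ℝ
  contMDiff : ∀ j, ContMDiff (𝓡 n) 𝓘(ℝ, ℝ) ∞ (η j)
  tsupport_subset : ∀ j, tsupport (η j) ⊆ (A.chart j).source
  eq_one : ∀ j, ∀ y ∈ tsupport (A.χ j), η j y = 1

theorem AdaptedAtlas.nonempty_cutoffs [T2Space Γ] [CompactSpace Γ] [IsManifold (𝓡 n) ∞ Γ]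
    (A : AdaptedAtlas n Γ) : Nonempty A.Cutoffs := by
  choose η hsmooth hsupp hone using fun j => exists_contMDiff_cutoff (n := n)
    (isClosed_tsupport (A.χ j)) (A.chart j).open_source (A.χ_subordinate j)
  exact ⟨⟨η, hsmooth, hsupp, hone⟩⟩

/-- The Hilbert sum of the spaces `L₂(ℝⁿ)` over the charts of an atlas, which contains
`H^{s,φ}(Γ)` through `RefinedSpaceOn.toL2`. -/
abbrev AdaptedAtlas.L2Sum (A : AdaptedAtlas n Γ) : Type :=
  PiLp 2 (fun _ : Fin A.r => Lp ℂ 2 (volume : Measure (EuclSp n)))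

variable {A : AdaptedAtlas n Γ} {s : ℝ} {φ : ℝ → ℝ} {ρ : ℕ}

theorem AdaptedAtlas.Cutoffs.contMDiff_cutoffComp (c : A.Cutoffs) (j : Fin A.r) {k : ℕ∞}
    {F : EuclSp n → ℂ} (hF : ContDiff ℝ k F) :
    ContMDiff (𝓡 n) 𝓘(ℝ, ℂ) k (cutoffComp (c.η j) (A.chart j) F) :=
  _root_.contMDiff_cutoffComp (c.contMDiff j) (A.chart_mem j) (c.tsupport_subset j) hF

/-- The map which recovers a `C^ρ` function on `Γ` from the weighted Fourier transforms of its local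
representations. -/
noncomputable def synthesisOn (hφ : SlowlyVaryingClass φ)
    (hK : MemLp (fun ξ : EuclSp n => japaneseBracket ξ ^ ρ / refinedWeight s φ ξ) 2 volume)
    (c : A.Cutoffs) : A.L2Sum →ₗ[ℂ] CkSpace n Γ (ρ : ℕ∞) where
  toFun g := ⟨∑ j, cutoffComp (c.η j) (A.chart j) (weightedSynthesis s φ (g j)),
    Submodule.sum_mem (ckSubmodule n Γ ρ) fun j _ =>
      c.contMDiff_cutoffComp j (contDiff_weightedSynthesis hφ hK (Lp.memLp (g j)))⟩
  map_add' g g' := Subtype.ext <| by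
    change (∑ j, cutoffComp (c.η j) (A.chart j) (weightedSynthesis s φ ((g + g') j)) : Γ → ℂ) =
      (∑ j, cutoffComp (c.η j) (A.chart j) (weightedSynthesis s φ (g j))) +
        ∑ j, cutoffComp (c.η j) (A.chart j) (weightedSynthesis s φ (g' j))
    rw [← Finset.sum_add_distrib]
    refine Finset.sum_congr rfl fun j _ => ?_
    rw [← cutoffComp_add, ← weightedSynthesis_add hφ hK (Lp.memLp (g j)) (Lp.memLp (g' j))]
    exact congrArg _ (weightedSynthesis_congr_ae (Lp.coeFn_add (g j) (g' j)))
  map_smul' a g := Subtype.ext <| by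
    change (∑ j, cutoffComp (c.η j) (A.chart j) (weightedSynthesis s φ ((a • g) j)) : Γ → ℂ) =
      a • ∑ j, cutoffComp (c.η j) (A.chart j) (weightedSynthesis s φ (g j))
    rw [Finset.smul_sum]
    refine Finset.sum_congr rfl fun j _ => ?_
    rw [← cutoffComp_smul, ← weightedSynthesis_smul]
    exact congrArg _ (weightedSynthesis_congr_ae (Lp.coeFn_smul a (g j)))

theorem coe_synthesisOn (hφ : SlowlyVaryingClass φ)
    (hK : MemLp (fun ξ : EuclSp n => japaneseBracket ξ ^ ρ / refinedWeight s φ ξ) 2 volume)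
    (c : A.Cutoffs) (g : A.L2Sum) : (synthesisOn hφ hK c g : Γ → ℂ) =
      ∑ j, cutoffComp (c.η j) (A.chart j) (weightedSynthesis s φ (g j)) :=
  rfl

theorem exists_norm_iteratedFDeriv_synthesisOn_le (hφ : SlowlyVaryingClass φ)
    (hK : MemLp (fun ξ : EuclSp n => japaneseBracket ξ ^ ρ / refinedWeight s φ ξ) 2 volume)
    (c : A.Cutoffs) {β : OpenPartialHomeomorph Γ (EuclSp n)}
    (hβ : β ∈ IsManifold.maximalAtlas (𝓡 n) ∞ Γ) {K : Set (EuclSp n)} (hKc : IsCompact K)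
    (hKβ : K ⊆ β.target) {i : ℕ} (hi : i ≤ ρ) :
    ∃ C : ℝ, 0 ≤ C ∧ ∀ (g : A.L2Sum) (p : ℝ), 0 ≤ p →
      (∀ j, ∀ l ∈ Finset.range (i + 1), ∀ z ∈ A.chart j '' tsupport (c.η j),
        ‖iteratedFDeriv ℝ l (weightedSynthesis s φ (g j)) z‖ ≤ p) →
      ∀ x ∈ K, ‖iteratedFDeriv ℝ i ((synthesisOn hφ hK c g : Γ → ℂ) ∘ β.symm) x‖ ≤ C * p := by
  choose C hC0 hC using fun j => exists_norm_iteratedFDeriv_cutoffComp_le (c.contMDiff j)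
    (A.chart_mem j) (c.tsupport_subset j) hβ hKc hKβ i
  refine ⟨∑ j, C j, Finset.sum_nonneg fun j _ => hC0 j, fun g p hp hg x hx => ?_⟩
  have hsmooth : ∀ j, ContDiff ℝ (ρ : ℕ∞) (weightedSynthesis s φ (g j)) := fun j =>
    contDiff_weightedSynthesis hφ hK (Lp.memLp (g j))
  have hcomp : (synthesisOn hφ hK c g : Γ → ℂ) ∘ β.symm = fun z =>
      ∑ j, (cutoffComp (c.η j) (A.chart j) (weightedSynthesis s φ (g j)) ∘ β.symm) z := by
    ext z
    rw [coe_synthesisOn, Function.comp_apply, Finset.sum_apply]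
    rfl
  rw [hcomp, iteratedFDeriv_fun_sum_apply fun j _ =>
    (contDiffAt_comp_chart_symm hβ (c.contMDiff_cutoffComp j (hsmooth j)) (hKβ hx)).of_le
      (mod_cast hi), Finset.sum_mul]
  exact (norm_sum_le _ _).trans (Finset.sum_le_sum fun j _ =>
    hC j _ ((hsmooth j).of_le (mod_cast hi)) p hp
      (fun l hl z hz => hg j l (Finset.mem_range_succ_iff.2 hl) z hz) x hx)

theorem eventually_forall_norm_iteratedFDeriv_weightedSynthesis_lt (hφ : SlowlyVaryingClass φ)
    (hK : MemLp (fun ξ : EuclSp n => japaneseBracket ξ ^ ρ / refinedWeight s φ ξ) 2 volume)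
    {Y : Type*} [TopologicalSpace Y] {γ : Y → Lp ℂ 2 (volume : Measure (EuclSp n))} {R : ℝ}
    (hR : ∀ y, ‖γ y‖ ≤ R) (hγ : ∀ a, Continuous fun y => inner ℂ a (γ y)) {y₀ : Y}
    (hy₀ : γ y₀ = 0) {l : ℕ} (hl : l ≤ ρ) {L : Set (EuclSp n)} (hL : IsCompact L) {δ : ℝ}
    (hδ : 0 < δ) :
    ∀ᶠ y in 𝓝 y₀, ∀ z ∈ L, ‖iteratedFDeriv ℝ l (weightedSynthesis s φ (γ y)) z‖ < δ := by
  have hcont : Continuous fun q : Y × EuclSp n =>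
      ‖iteratedFDeriv ℝ l (weightedSynthesis s φ (γ q.1)) q.2‖ :=
    ((continuous_iteratedFDeriv_weightedSynthesis hφ hK hR hγ hl).comp continuous_swap).norm
  have hzero : weightedSynthesis s φ (γ y₀) = 0 := by
    rw [hy₀, ← zero_smul ℂ (weightedSynthesis s φ 0), ← weightedSynthesis_smul, zero_smul]
    exact weightedSynthesis_congr_ae (Lp.coeFn_zero ℂ 2 volume)
  refine hL.eventually_forall_of_forall_eventually fun z _ => ?_
  refine hcont.tendsto (y₀, z) |>.eventually (gt_mem_nhds ?_)
  rw [hzero, iteratedFDeriv_zero, Pi.zero_apply, norm_zero]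
  exact hδ

/-- Continuity on bounded sets from the weak topology is what makes the inclusion compact. -/
theorem continuous_synthesisOn_of_forall_continuous_inner [CompactSpace Γ]
    (hφ : SlowlyVaryingClass φ)
    (hK : MemLp (fun ξ : EuclSp n => japaneseBracket ξ ^ ρ / refinedWeight s φ ξ) 2 volume)
    (c : A.Cutoffs) {Y : Type*} [TopologicalSpace Y] {γ : Y → A.L2Sum} {R : ℝ}
    (hR : ∀ y, ‖γ y‖ ≤ R) (hγ : ∀ a, Continuous fun y => inner ℂ a (γ y)) :
    Continuous fun y => synthesisOn hφ hK c (γ y) := by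
  refine CkSpace.continuous_of_forall_eventually_norm_sub_lt fun y₀ β hβ i hi K hKβ hKc ε hε => ?_
  obtain ⟨C, hC0, hC⟩ :=
    exists_norm_iteratedFDeriv_synthesisOn_le hφ hK c hβ hKc hKβ (i := i) (mod_cast hi)
  have hδ : 0 < ε / (1 + C) := by positivity
  have hbound : ∀ j y, ‖(γ y - γ y₀) j‖ ≤ R + R := fun j y =>
    (PiLp.norm_apply_le _ j).trans ((norm_sub_le _ _).trans (add_le_add (hR y) (hR y₀)))
  have hweak : ∀ j a, Continuous fun y => inner ℂ a ((γ y - γ y₀) j) := by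
    intro j a
    set P := PiLp.proj (𝕜 := ℂ) 2 (fun _ : Fin A.r => Lp ℂ 2 (volume : Measure (EuclSp n))) j
    refine ((hγ (ContinuousLinearMap.adjoint P a)).sub
      (continuous_const (y := inner ℂ (ContinuousLinearMap.adjoint P a) (γ y₀)))).congr fun y => ?_
    rw [Pi.sub_apply, ← inner_sub_right, ContinuousLinearMap.adjoint_inner_left]
    rfl
  have hsmall : ∀ᶠ y in 𝓝 y₀, ∀ j, ∀ l ∈ Finset.range (i + 1),
      ∀ z ∈ A.chart j '' tsupport (c.η j),
        ‖iteratedFDeriv ℝ l (weightedSynthesis s φ ((γ y - γ y₀) j)) z‖ < ε / (1 + C) := by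
    refine eventually_all.2 fun j => (Finset.eventually_all _).2 fun l hl => ?_
    refine eventually_forall_norm_iteratedFDeriv_weightedSynthesis_lt hφ hK (hbound j) (hweak j)
      (by rw [sub_self]; rfl) ((Finset.mem_range_succ_iff.1 hl).trans (mod_cast hi)) ?_ hδ
    exact (isClosed_tsupport _).isCompact.image_of_continuousOn
      ((A.chart j).continuousOn.mono (c.tsupport_subset j))
  filter_upwards [hsmall] with y hy x hx
  rw [← map_sub]
  calc ‖iteratedFDeriv ℝ i ((synthesisOn hφ hK c (γ y - γ y₀) : Γ → ℂ) ∘ β.symm) x‖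
      ≤ C * (ε / (1 + C)) := hC _ _ hδ.le (fun j l hl z hz => (hy j l hl z hz).le) x hx
    _ < (1 + C) * (ε / (1 + C)) := by gcongr; linarith
    _ = ε := mul_div_cancel₀ ε (by positivity)

theorem isCompact_synthesisOn_image_closedBall [CompactSpace Γ] (hφ : SlowlyVaryingClass φ)
    (hK : MemLp (fun ξ : EuclSp n => japaneseBracket ξ ^ ρ / refinedWeight s φ ξ) 2 volume)
    (c : A.Cutoffs) : IsCompact (synthesisOn hφ hK c '' Metric.closedBall 0 1) := by
  set D := InnerProductSpace.toDual ℂ A.L2Sum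
  set B : Set (WeakDual ℂ A.L2Sum) := WeakDual.toStrongDual ⁻¹' Metric.closedBall 0 1
  have : CompactSpace B := isCompact_iff_compactSpace.1 (WeakDual.isCompact_closedBall 0 1)
  set γ : B → A.L2Sum := fun y => D.symm (WeakDual.toStrongDual (y : WeakDual ℂ A.L2Sum))
  have hγ : ∀ y, ‖γ y‖ ≤ 1 := fun y =>
    (D.symm.norm_map _).trans_le (mem_closedBall_zero_iff.1 y.2)
  have hinner : ∀ a y, inner ℂ a (γ y) = conj ((y : WeakDual ℂ A.L2Sum) a) := fun a y => by
    rw [← inner_conj_symm, InnerProductSpace.toDual_symm_apply]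
    rfl
  have hcont : Continuous fun y => synthesisOn hφ hK c (γ y) := by
    refine continuous_synthesisOn_of_forall_continuous_inner hφ hK c hγ fun a => ?_
    simp_rw [hinner]
    exact Complex.continuous_conj.comp ((WeakDual.eval_continuous a).comp continuous_subtype_val)
  have hrange : range γ = Metric.closedBall 0 1 := by
    refine Subset.antisymm (range_subset_iff.2 fun y => mem_closedBall_zero_iff.2 (hγ y)) ?_
    refine fun g hg => ⟨⟨StrongDual.toWeakDual (D g), mem_closedBall_zero_iff.2 ?_⟩,
      D.symm_apply_apply g⟩
    exact (D.norm_map g).trans_le (mem_closedBall_zero_iff.1 hg)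
  rw [← hrange, ← range_comp]
  exact isCompact_range hcont

end Synthesis

section Inclusion

theorem hasCompactSupport_comp_chart_symm {n : ℕ} {Γ : Type*} [TopologicalSpace Γ]
    [CompactSpace Γ] {η : Γ → ℝ} {α : OpenPartialHomeomorph Γ (EuclSp n)}
    (hη : tsupport η ⊆ α.source) (hα : α.target = univ) {F : EuclSp n → ℂ}
    (hF : ∀ x, η (α.symm x) = 0 → F x = 0) : HasCompactSupport F := by
  refine HasCompactSupport.intro ((isClosed_tsupport η).isCompact.image_of_continuousOn
    (α.continuousOn.mono hη)) fun x hx => hF x ?_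
  by_contra h
  exact hx ⟨α.symm x, subset_tsupport _ h, α.right_inv (hα ▸ mem_univ x)⟩

variable {n : ℕ} {Γ : Type*} [TopologicalSpace Γ] [ChartedSpace (EuclSp n) Γ]

theorem contDiff_mul_conj_mul_dens_comp_chart_symm [MeasurableSpace Γ] (d : SmoothDensity n Γ)
    {α : OpenPartialHomeomorph Γ (EuclSp n)} (hα : α ∈ IsManifold.maximalAtlas (𝓡 n) ∞ Γ)
    (hα' : α.target = univ) {η : Γ → ℝ} (hη : ContMDiff (𝓡 n) 𝓘(ℝ, ℝ) ∞ η) {w : Γ → ℂ}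
    (hw : ContMDiff (𝓡 n) 𝓘(ℝ, ℂ) ∞ w) :
    ContDiff ℝ ∞ fun x => (η (α.symm x) : ℂ) * conj (w (α.symm x)) * (d.dens α x : ℂ) := by
  refine contDiff_iff_contDiffAt.2 fun x => ?_
  have hx : x ∈ α.target := hα' ▸ mem_univ x
  have hηx : ContDiffAt ℝ ∞ (fun x => (η (α.symm x) : ℂ)) x :=
    contDiffAt_comp_chart_symm (k := ⊤) (f := fun y => (η y : ℂ)) hα
      ((Complex.ofRealCLM.contDiff (n := ∞)).contMDiff.comp hη) hx
  have hwx : ContDiffAt ℝ ∞ (fun x => w (α.symm x)) x :=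
    contDiffAt_comp_chart_symm (k := ⊤) hα hw hx
  have hdx : ContDiffAt ℝ ∞ (fun x => (d.dens α x : ℂ)) x :=
    Complex.ofRealCLM.contDiff.contDiffAt.comp x
      ((d.contDiffOn_dens _ hα).contDiffAt (α.open_target.mem_nhds hx))
  exact (hηx.mul (Complex.conjCLE.contDiff.contDiffAt.comp x hwx)).mul hdx

variable [MeasurableSpace Γ] {A : AdaptedAtlas n Γ} {d : SmoothDensity n Γ} {s : ℝ} {φ : ℝ → ℝ}
  {ρ : ℕ}

theorem chartTest_apply_eq_mul (c : A.Cutoffs) {j : Fin A.r} {w : Γ → ℂ} {g : 𝓢(EuclSp n, ℂ)}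
    (hg : ∀ x, g x = (c.η j ((A.chart j).symm x) : ℂ) * conj (w ((A.chart j).symm x)) *
      (d.dens (A.chart j) x : ℂ)) (y : Γ) :
    chartTest A d j g y = (A.χ j y : ℂ) * w y := by
  change ((A.χ j y * (d.dens (A.chart j) (A.chart j y))⁻¹ : ℝ) : ℂ) * conj (g (A.chart j y)) = _
  rw [hg]
  by_cases hy : y ∈ tsupport (A.χ j)
  · have hys := A.χ_subordinate j hy
    have hd : (d.dens (A.chart j) (A.chart j y) : ℂ) ≠ 0 := Complex.ofReal_ne_zero.2
      (d.dens_pos _ (A.chart_mem j) _ ((A.chart j).map_source hys)).ne'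
    rw [(A.chart j).left_inv hys, c.eq_one j y hy]
    simp only [Complex.ofReal_one, one_mul, map_mul, Complex.conj_conj, Complex.conj_ofReal,
      Complex.ofReal_mul, Complex.ofReal_inv]
    field_simp
  · rw [show A.χ j y = 0 from image_eq_zero_of_notMem_tsupport hy, zero_mul, Complex.ofReal_zero,
      zero_mul, zero_mul]

theorem exists_sum_chartTest_eq [CompactSpace Γ] (c : A.Cutoffs) (w : CkSpace n Γ ⊤) :
    ∃ g : Fin A.r → 𝓢(EuclSp n, ℂ), (∀ j x, g j x = (c.η j ((A.chart j).symm x) : ℂ) *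
      conj (w ((A.chart j).symm x)) * (d.dens (A.chart j) x : ℂ)) ∧
      ∑ j, chartTest A d j (g j) = w := by
  have hsupp : ∀ j, HasCompactSupport fun x => (c.η j ((A.chart j).symm x) : ℂ) *
      conj (w ((A.chart j).symm x)) * (d.dens (A.chart j) x : ℂ) := fun j =>
    hasCompactSupport_comp_chart_symm (c.tsupport_subset j) (A.chart_target j) fun x hx => by
      rw [hx, Complex.ofReal_zero, zero_mul, zero_mul]
  have hsmooth := fun j => contDiff_mul_conj_mul_dens_comp_chart_symm d (A.chart_mem j)
    (A.chart_target j) (c.contMDiff j) w.2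
  refine ⟨fun j => (hsupp j).toSchwartzMap (hsmooth j), fun j x => rfl, ?_⟩
  refine Subtype.ext (funext fun y => ?_)
  have hχ : ∑ j, A.χ j y = 1 := by
    rw [← finsum_eq_sum_of_fintype]
    exact A.χ.sum_eq_one (mem_univ y)
  rw [CkSpace.coe_sum, Finset.sum_apply,
    Finset.sum_congr rfl fun j _ => chartTest_apply_eq_mul c (w := w) (fun x => rfl) y,
    ← Finset.sum_mul, ← Complex.ofReal_sum, hχ, Complex.ofReal_one, one_mul]

variable [T2Space Γ] [IsManifold (𝓡 n) ∞ Γ] [BorelSpace Γ]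

theorem toDistribution_chartTest_eq_integral_cutoffComp (hφ : SlowlyVaryingClass φ)
    (hK : MemLp (fun ξ : EuclSp n => japaneseBracket ξ ^ ρ / refinedWeight s φ ξ) 2 volume)
    (c : A.Cutoffs) (h : RefinedSpaceOn A d s φ) {w : Γ → ℂ} (hw : Continuous w) {j : Fin A.r}
    {g : 𝓢(EuclSp n, ℂ)} (hg : ∀ x, g x = (c.η j ((A.chart j).symm x) : ℂ) *
      conj (w ((A.chart j).symm x)) * (d.dens (A.chart j) x : ℂ)) :
    h.toDistribution (chartTest A d j g) =
      ∫ y, cutoffComp (c.η j) (A.chart j)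
        (weightedSynthesis s φ (RefinedSpaceOn.toL2 A d s φ h j)) y * conj (w y) ∂d.measure := by
  set S := weightedSynthesis s φ (RefinedSpaceOn.toL2 A d s φ h j)
  have hcont : Continuous (cutoffComp (c.η j) (A.chart j) S) :=
    (c.contMDiff_cutoffComp j (contDiff_weightedSynthesis hφ hK (Lp.memLp _))).continuous
  have hzero : ∀ y ∉ (A.chart j).source, cutoffComp (c.η j) (A.chart j) S y * conj (w y) = 0 := by
    intro y hy
    have hη : c.η j y = 0 :=
      image_eq_zero_of_notMem_tsupport fun hy' => hy (c.tsupport_subset j hy')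
    simp [cutoffComp, hη]
  calc h.toDistribution (chartTest A d j g) = ∫ x, g x * S x :=
        apply_eq_integral_weightedSynthesis hφ hK (h.2 j) g
    _ = _ := by
        rw [d.integral_eq_integral_chart (A.chart_mem j) (F := fun y =>
            cutoffComp (c.η j) (A.chart j) S y * conj (w y))
          (hcont.mul (Complex.continuous_conj.comp hw)).continuousOn hzero, A.chart_target j,
          setIntegral_univ]
        refine integral_congr_ae (ae_of_all _ fun x => ?_)
        simp only [hg, cutoffComp, (A.chart j).right_inv (A.chart_target j ▸ mem_univ x)]
        ring

variable [CompactSpace Γ]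

theorem toDistribution_eq_integral_synthesisOn (hφ : SlowlyVaryingClass φ)
    (hK : MemLp (fun ξ : EuclSp n => japaneseBracket ξ ^ ρ / refinedWeight s φ ξ) 2 volume)
    (c : A.Cutoffs) (h : RefinedSpaceOn A d s φ) (w : CkSpace n Γ ⊤) :
    h.toDistribution w =
      ∫ x, synthesisOn hφ hK c (RefinedSpaceOn.toL2 A d s φ h) x * conj (w x) ∂d.measure := by
  obtain ⟨g, hg, hgw⟩ := exists_sum_chartTest_eq (d := d) c w
  have hint : ∀ j, Integrable (fun x => cutoffComp (c.η j) (A.chart j)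
      (weightedSynthesis s φ (RefinedSpaceOn.toL2 A d s φ h j)) x * conj (w x)) d.measure :=
    fun j => d.integrable_mul_conj
      (c.contMDiff_cutoffComp j (contDiff_weightedSynthesis hφ hK (Lp.memLp _))).continuous
      w.continuous
  calc h.toDistribution w = ∑ j, h.toDistribution (chartTest A d j (g j)) := by
        rw [← map_sum, hgw]
    _ = ∑ j, ∫ x, cutoffComp (c.η j) (A.chart j)
          (weightedSynthesis s φ (RefinedSpaceOn.toL2 A d s φ h j)) x * conj (w x) ∂d.measure :=
        Finset.sum_congr rfl fun j _ =>
          toDistribution_chartTest_eq_integral_cutoffComp hφ hK c h w.continuous (hg j)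
    _ = _ := by
        rw [← integral_finsetSum _ fun j _ => hint j]
        simp_rw [coe_synthesisOn, Finset.sum_apply, Finset.sum_mul]

theorem RefinedSpaceOn.IsInclusion.coe_eq {k : ℕ∞} {T : RefinedSpaceOn A d s φ → CkSpace n Γ k}
    (hT : RefinedSpaceOn.IsInclusion T) {h : RefinedSpaceOn A d s φ} {f : Γ → ℂ}
    (hf : Continuous f)
    (hh : ∀ w : CkSpace n Γ ⊤, h.toDistribution w = ∫ y, f y * conj (w y) ∂d.measure) :
    (T h : Γ → ℂ) = f :=
  d.eq_of_forall_integral_mul_conj_eq (T h).continuous hf fun w => (hT h w).symm.trans (hh w)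

theorem RefinedSpaceOn.IsInclusion.eq_synthesisOn (hφ : SlowlyVaryingClass φ)
    (hK : MemLp (fun ξ : EuclSp n => japaneseBracket ξ ^ ρ / refinedWeight s φ ξ) 2 volume)
    (c : A.Cutoffs) {T : RefinedSpaceOn A d s φ → CkSpace n Γ (ρ : ℕ∞)}
    (hT : RefinedSpaceOn.IsInclusion T) (h : RefinedSpaceOn A d s φ) :
    T h = synthesisOn hφ hK c (RefinedSpaceOn.toL2 A d s φ h) :=
  Subtype.ext <| hT.coe_eq (synthesisOn hφ hK c _).continuous
    (toDistribution_eq_integral_synthesisOn hφ hK c h)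

theorem exists_continuous_inclusion (hφ : SlowlyVaryingClass φ)
    (hK : MemLp (fun ξ : EuclSp n => japaneseBracket ξ ^ ρ / refinedWeight s φ ξ) 2 volume) :
    ∃ T : RefinedSpaceOn A d s φ →L[ℂ] CkSpace n Γ (ρ : ℕ∞), RefinedSpaceOn.IsInclusion T := by
  obtain ⟨c⟩ := A.nonempty_cutoffs
  refine ⟨⟨synthesisOn hφ hK c ∘ₗ RefinedSpaceOn.toL2 A d s φ, ?_⟩,
    toDistribution_eq_integral_synthesisOn hφ hK c⟩
  refine continuous_iff_continuousAt.2 fun h₀ => ?_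
  have hL2 : Continuous (RefinedSpaceOn.toL2 A d s φ) :=
    AddMonoidHomClass.continuous_of_bound _ 1 fun h => (one_mul ‖h‖).ge
  have hball : ContinuousOn (fun h => synthesisOn hφ hK c (RefinedSpaceOn.toL2 A d s φ h))
      (Metric.ball h₀ 1) := by
    rw [continuousOn_iff_continuous_domRestrict]
    refine continuous_synthesisOn_of_forall_continuous_inner hφ hK c (R := ‖h₀‖ + 1)
      (γ := fun y : Metric.ball h₀ 1 => RefinedSpaceOn.toL2 A d s φ y) (fun y => ?_)
      fun a => continuous_const.inner (hL2.comp continuous_subtype_val)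
    exact (norm_le_norm_add_norm_sub' (y : RefinedSpaceOn A d s φ) h₀).trans
      (add_le_add_right (mem_ball_iff_norm.1 y.2).le _)
  exact hball.continuousAt (Metric.ball_mem_nhds h₀ one_pos)

theorem RefinedSpaceOn.IsInclusion.isCompactOperator (hφ : SlowlyVaryingClass φ)
    (hK : MemLp (fun ξ : EuclSp n => japaneseBracket ξ ^ ρ / refinedWeight s φ ξ) 2 volume)
    {T : RefinedSpaceOn A d s φ → CkSpace n Γ (ρ : ℕ∞)} (hT : RefinedSpaceOn.IsInclusion T) :
    IsCompactOperator T := by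
  obtain ⟨c⟩ := A.nonempty_cutoffs
  refine ⟨_, isCompact_synthesisOn_image_closedBall hφ hK c, ?_⟩
  filter_upwards [Metric.closedBall_mem_nhds (0 : RefinedSpaceOn A d s φ) one_pos] with h hh
  exact ⟨RefinedSpaceOn.toL2 A d s φ h, mem_closedBall_zero_iff.2
    (mem_closedBall_zero_iff (a := h).1 hh), (hT.eq_synthesisOn hφ hK c h).symm⟩

end Inclusion

/-! ### Almost orthogonality of dyadic pieces -/

section SobolevEstimates

open LineDeriv

variable {n : ℕ}

theorem norm_fourier_iteratedLineDerivOp_const (N : ℕ) (e : EuclSp n) (G : 𝓢(EuclSp n, ℂ))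
    (ξ : EuclSp n) :
    ‖𝓕 (∂^{fun _ : Fin N => e} G) ξ‖ = (2 * Real.pi * |inner ℝ ξ e|) ^ N * ‖𝓕 G ξ‖ := by
  induction N with
  | zero => rw [iteratedLineDerivOp_fin_zero, pow_zero, one_mul]
  | succ N ih =>
    have he : (fun ξ : EuclSp n => inner ℝ ξ e).HasTemperateGrowth := by fun_prop
    have htail : Fin.tail (fun _ : Fin (N + 1) => e) = fun _ : Fin N => e := rfl
    rw [iteratedLineDerivOp_succ_left, SchwartzMap.fourier_lineDerivOp_eq, smul_apply,
      SchwartzMap.smulLeftCLM_apply_apply he, norm_smul, norm_smul, htail, ih, pow_succ]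
    simp only [norm_mul, Complex.norm_ofNat, Complex.norm_real, Complex.norm_I, mul_one,
      Real.norm_eq_abs, abs_of_pos Real.pi_pos]
    ring

theorem norm_sq_pow_succ_le_sum (K : ℕ) (ξ : EuclSp n) :
    (‖ξ‖ ^ 2) ^ (K + 1) ≤ (n : ℝ) ^ K * ∑ i, (ξ i ^ 2) ^ (K + 1) := by
  rcases n.eq_zero_or_pos with rfl | hn
  · simp [Subsingleton.elim ξ 0]
  have h := pow_sum_div_card_le_sum_pow (s := Finset.univ) (f := fun i => ξ i ^ 2)
    (fun i _ => sq_nonneg _) K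
  rw [Finset.card_univ, Fintype.card_fin, div_le_iff₀ (by positivity), mul_comm] at h
  rwa [EuclideanSpace.real_norm_sq_eq]

theorem norm_sq_pow_succ_mul_norm_fourier_sq_le (K : ℕ) (G : 𝓢(EuclSp n, ℂ)) (ξ : EuclSp n) :
    (‖ξ‖ ^ 2) ^ (K + 1) * ‖𝓕 G ξ‖ ^ 2 ≤ (n : ℝ) ^ K * ∑ i : Fin n,
      ‖𝓕 (∂^{fun _ : Fin (K + 1) => EuclideanSpace.single i (1 : ℝ)} G) ξ‖ ^ 2 := by
  have hcoord : ∀ i, ξ i ^ 2 ≤ (2 * Real.pi * |ξ i|) ^ 2 := fun i => by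
    have hpi : (1 : ℝ) ≤ (2 * Real.pi) ^ 2 := by nlinarith [Real.pi_gt_three]
    rw [mul_pow, sq_abs]
    exact le_mul_of_one_le_left (sq_nonneg _) hpi
  calc _ ≤ ((n : ℝ) ^ K * ∑ i, (ξ i ^ 2) ^ (K + 1)) * ‖𝓕 G ξ‖ ^ 2 := by
        gcongr
        exact norm_sq_pow_succ_le_sum K ξ
    _ = (n : ℝ) ^ K * ∑ i, (ξ i ^ 2) ^ (K + 1) * ‖𝓕 G ξ‖ ^ 2 := by rw [mul_assoc, Finset.sum_mul]
    _ ≤ _ := by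
        gcongr with i
        rw [norm_fourier_iteratedLineDerivOp_const, mul_pow, pow_right_comm (2 * Real.pi * |_|),
          EuclideanSpace.inner_single_right, one_mul, conj_trivial]
        exact mul_le_mul_of_nonneg_right (pow_le_pow_left₀ (sq_nonneg _) (hcoord i) _)
          (sq_nonneg _)

theorem one_add_div_pow_mul_norm_fourier_sq_le (K : ℕ) (G : 𝓢(EuclSp n, ℂ)) {q : ℝ} (hq : 1 ≤ q)
    (ξ : EuclSp n) : (1 + (japaneseBracket ξ / q) ^ (2 * (K + 1))) * ‖𝓕 G ξ‖ ^ 2 ≤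
      (1 + 2 ^ (K + 1)) * ‖𝓕 G ξ‖ ^ 2 + 2 ^ (K + 1) / q ^ (2 * (K + 1)) * ((n : ℝ) ^ K *
        ∑ i : Fin n,
          ‖𝓕 (∂^{fun _ : Fin (K + 1) => EuclideanSpace.single i (1 : ℝ)} G) ξ‖ ^ 2) := by
  have hbracket : japaneseBracket ξ ^ (2 * (K + 1)) ≤ 2 ^ (K + 1) * (1 + (‖ξ‖ ^ 2) ^ (K + 1)) := by
    rw [pow_mul, japaneseBracket_sq]
    refine (add_pow_le (zero_le_one' ℝ) (sq_nonneg ‖ξ‖) (K + 1)).trans ?_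
    rw [one_pow, Nat.add_sub_cancel]
    gcongr
    · exact one_le_two
    · exact K.le_succ
  have hq' : 1 ≤ q ^ (2 * (K + 1)) := one_le_pow₀ hq
  calc (1 + (japaneseBracket ξ / q) ^ (2 * (K + 1))) * ‖𝓕 G ξ‖ ^ 2
      ≤ (1 + 2 ^ (K + 1) * (1 + (‖ξ‖ ^ 2) ^ (K + 1)) / q ^ (2 * (K + 1))) * ‖𝓕 G ξ‖ ^ 2 := by
        rw [div_pow]
        gcongr
    _ = (1 + 2 ^ (K + 1) / q ^ (2 * (K + 1))) * ‖𝓕 G ξ‖ ^ 2 +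
        2 ^ (K + 1) / q ^ (2 * (K + 1)) * ((‖ξ‖ ^ 2) ^ (K + 1) * ‖𝓕 G ξ‖ ^ 2) := by ring
    _ ≤ _ := by
        refine add_le_add ?_ (mul_le_mul_of_nonneg_left
          (norm_sq_pow_succ_mul_norm_fourier_sq_le K G ξ) (by positivity))
        gcongr
        exact div_le_self (by positivity) hq'

theorem integrable_norm_sq_schwartzMap (G : 𝓢(EuclSp n, ℂ)) : Integrable fun ξ => ‖G ξ‖ ^ 2 :=
  (memLp_two_iff_integrable_sq_norm G.continuous.aestronglyMeasurable).1 (G.memLp 2 volume)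

theorem integral_norm_sq_le_of_norm_le {X E : Type*} [MeasurableSpace X] {μ : Measure X}
    [NormedAddCommGroup E] {H : X → E} {S : Set X} {B V : ℝ} (hV : 0 ≤ V)
    (hH : ∀ x, ‖H x‖ ≤ B) (hS : ∀ x ∉ S, H x = 0) (hvol : μ S ≤ ENNReal.ofReal V) :
    ∫ x, ‖H x‖ ^ 2 ∂μ ≤ B ^ 2 * V := by
  have hsupp : ∀ x ∉ S, ‖H x‖ ^ 2 = 0 := fun x hx => by
    rw [hS x hx, norm_zero, zero_pow two_ne_zero]
  have hbound : ∀ x ∈ S, ‖‖H x‖ ^ 2‖ ≤ B ^ 2 := fun x _ => by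
    rw [norm_pow, norm_norm]
    exact pow_le_pow_left₀ (norm_nonneg _) (hH x) 2
  rw [← setIntegral_eq_integral_of_forall_compl_eq_zero hsupp]
  calc ∫ x in S, ‖H x‖ ^ 2 ∂μ ≤ B ^ 2 * μ.real S := (le_abs_self _).trans
        (norm_setIntegral_le_of_norm_le_const (hvol.trans_lt ENNReal.ofReal_lt_top) hbound)
    _ ≤ B ^ 2 * V := by
        gcongr
        exact ENNReal.toReal_le_of_le_ofReal hV hvol

theorem integral_norm_fourier_iteratedLineDerivOp_sq_le (N : ℕ) {e : EuclSp n} (he : ‖e‖ = 1)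
    {G : 𝓢(EuclSp n, ℂ)} {S : Set (EuclSp n)} {B V : ℝ} (hV : 0 ≤ V) (hS : tsupport G ⊆ S)
    (hvol : volume S ≤ ENNReal.ofReal V) (hB : ∀ x, ‖iteratedFDeriv ℝ N G x‖ ≤ B) :
    ∫ ξ, ‖𝓕 (∂^{fun _ : Fin N => e} G) ξ‖ ^ 2 ≤ B ^ 2 * V := by
  rw [SchwartzMap.integral_norm_sq_fourier]
  refine integral_norm_sq_le_of_norm_le hV (fun x => ?_) (fun x hx => ?_) hvol
  · rw [SchwartzMap.iteratedLineDerivOp_eq_iteratedFDeriv]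
    refine (ContinuousMultilinearMap.le_opNorm _ _).trans ?_
    rw [Finset.prod_const, he, one_pow, mul_one]
    exact hB x
  · exact image_eq_zero_of_notMem_tsupport fun h =>
      hx (hS (SchwartzMap.tsupport_iteratedLineDerivOp_subset _ G h))

theorem integrable_one_add_div_pow_mul_norm_fourier_sq (K : ℕ) (G : 𝓢(EuclSp n, ℂ)) {q : ℝ}
    (hq : 1 ≤ q) :
    Integrable fun ξ => (1 + (japaneseBracket ξ / q) ^ (2 * (K + 1))) * ‖𝓕 G ξ‖ ^ 2 := by
  have hcont : Continuous fun ξ : EuclSp n =>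
      (1 + (japaneseBracket ξ / q) ^ (2 * (K + 1))) * ‖𝓕 G ξ‖ ^ 2 :=
    (continuous_const.add ((continuous_japaneseBracket.div_const q).pow _)).mul
      ((𝓕 G).continuous.norm.pow 2)
  have hsum := integrable_finsetSum Finset.univ fun (i : Fin n) _ => integrable_norm_sq_schwartzMap
    (𝓕 (∂^{fun _ : Fin (K + 1) => EuclideanSpace.single i (1 : ℝ)} G))
  refine Integrable.mono'
    (((integrable_norm_sq_schwartzMap (𝓕 G)).const_mul (1 + 2 ^ (K + 1))).add
      ((hsum.const_mul ((n : ℝ) ^ K)).const_mul (2 ^ (K + 1) / q ^ (2 * (K + 1)))))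
    hcont.aestronglyMeasurable (ae_of_all _ fun ξ => ?_)
  have := (japaneseBracket_pos ξ).le
  rw [Real.norm_of_nonneg (by positivity)]
  exact one_add_div_pow_mul_norm_fourier_sq_le K G hq ξ

theorem integral_one_add_div_pow_mul_norm_fourier_sq_le (K : ℕ) {G : 𝓢(EuclSp n, ℂ)}
    {S : Set (EuclSp n)} {B V q : ℝ} (hV : 0 ≤ V) (hq : 1 ≤ q) (hS : tsupport G ⊆ S)
    (hvol : volume S ≤ ENNReal.ofReal V) (hB : ∀ x, ‖G x‖ ≤ B)
    (hBq : ∀ x, ‖iteratedFDeriv ℝ (K + 1) G x‖ ≤ B * q ^ (K + 1)) :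
    ∫ ξ, (1 + (japaneseBracket ξ / q) ^ (2 * (K + 1))) * ‖𝓕 G ξ‖ ^ 2 ≤
      (1 + 2 ^ (K + 1) + 2 ^ (K + 1) * (n : ℝ) ^ (K + 1)) * (B ^ 2 * V) := by
  set D : Fin n → 𝓢(EuclSp n, ℂ) := fun i =>
    ∂^{fun _ : Fin (K + 1) => EuclideanSpace.single i (1 : ℝ)} G
  have hG : ∫ ξ, ‖𝓕 G ξ‖ ^ 2 ≤ B ^ 2 * V := by
    rw [SchwartzMap.integral_norm_sq_fourier]
    exact integral_norm_sq_le_of_norm_le hV hB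
      (fun x hx => image_eq_zero_of_notMem_tsupport fun h => hx (hS h)) hvol
  have hD : ∀ i, ∫ ξ, ‖𝓕 (D i) ξ‖ ^ 2 ≤ (B * q ^ (K + 1)) ^ 2 * V := fun i =>
    integral_norm_fourier_iteratedLineDerivOp_sq_le (K + 1)
      (by rw [PiLp.norm_single, norm_one]) hV hS hvol hBq
  have hGint := (integrable_norm_sq_schwartzMap (𝓕 G)).const_mul ((1 : ℝ) + 2 ^ (K + 1))
  have hDint := integrable_finsetSum Finset.univ fun i _ => integrable_norm_sq_schwartzMap (𝓕 (D i))
  calc _ ≤ ∫ ξ, ((1 + 2 ^ (K + 1)) * ‖𝓕 G ξ‖ ^ 2 +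
        2 ^ (K + 1) / q ^ (2 * (K + 1)) * ((n : ℝ) ^ K * ∑ i, ‖𝓕 (D i) ξ‖ ^ 2)) :=
        integral_mono (integrable_one_add_div_pow_mul_norm_fourier_sq K G hq)
          (hGint.add ((hDint.const_mul _).const_mul _))
          (one_add_div_pow_mul_norm_fourier_sq_le K G hq)
    _ = (1 + 2 ^ (K + 1)) * (∫ ξ, ‖𝓕 G ξ‖ ^ 2) +
        2 ^ (K + 1) / q ^ (2 * (K + 1)) * ((n : ℝ) ^ K * ∑ i, ∫ ξ, ‖𝓕 (D i) ξ‖ ^ 2) := by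
        rw [integral_add hGint ((hDint.const_mul _).const_mul _), integral_const_mul,
          integral_const_mul, integral_const_mul,
          integral_finsetSum _ fun i _ => integrable_norm_sq_schwartzMap (𝓕 (D i))]
    _ ≤ (1 + 2 ^ (K + 1)) * (B ^ 2 * V) + 2 ^ (K + 1) / q ^ (2 * (K + 1)) *
        ((n : ℝ) ^ K * ∑ _i : Fin n, (B * q ^ (K + 1)) ^ 2 * V) := by
        gcongr with i
        exact hD i
    _ = _ := by
        rw [Finset.sum_const, Finset.card_univ, Fintype.card_fin, nsmul_eq_mul]
        field_simp
        ring

end SobolevEstimates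

section AlmostOrthogonality

/-- The weight `r^{1/4} + r^{-1/4}`, which measures how far apart two frequency scales of ratio `r`
are. It grows fast enough for its reciprocals to be summable over dyadic scales, and slowly enough
to be absorbed by the decay of the Fourier transforms of dyadic pieces. -/
noncomputable def scaleGap (r : ℝ) : ℝ :=
  r ^ (1 / 4 : ℝ) + r⁻¹ ^ (1 / 4 : ℝ)

theorem scaleGap_pos {r : ℝ} (hr : 0 < r) : 0 < scaleGap r := by
  unfold scaleGap
  positivity

theorem rpow_le_one_add_pow {q a : ℝ} {N : ℕ} (hq : 0 < q) (ha : 0 ≤ a) (haN : a ≤ N) :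
    q ^ a ≤ 1 + q ^ N := by
  rcases le_total q 1 with h | h
  · exact (Real.rpow_le_one hq.le h ha).trans (le_add_of_nonneg_right (by positivity))
  · rw [← Real.rpow_natCast]
    exact (Real.rpow_le_rpow_of_exponent_le h haN).trans (le_add_of_nonneg_left zero_le_one)

theorem scaleGap_pow_three_mul_rpow_le {q s : ℝ} {N : ℕ} (hq : 0 < q) (hs : 1 / 2 ≤ s)
    (hsN : s + 1 / 2 ≤ N) : scaleGap q ^ 3 * q ^ (2 * s) ≤ 8 * (1 + q ^ (2 * N)) := by
  have hplus : (q ^ (1 / 4 : ℝ)) ^ 3 = q ^ (3 / 4 : ℝ) := by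
    rw [← Real.rpow_mul_natCast hq.le]
    norm_num
  have hminus : (q⁻¹ ^ (1 / 4 : ℝ)) ^ 3 = q ^ (-(3 / 4) : ℝ) := by
    rw [Real.inv_rpow hq.le, inv_pow, hplus, Real.rpow_neg hq.le]
  calc scaleGap q ^ 3 * q ^ (2 * s)
      ≤ 2 ^ 2 * ((q ^ (1 / 4 : ℝ)) ^ 3 + (q⁻¹ ^ (1 / 4 : ℝ)) ^ 3) * q ^ (2 * s) := by
        gcongr
        exact add_pow_le (by positivity) (by positivity) 3
    _ = 4 * (q ^ (3 / 4 + 2 * s) + q ^ (-(3 / 4) + 2 * s)) := by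
        rw [hplus, hminus, Real.rpow_add hq, Real.rpow_add hq]
        ring
    _ ≤ 4 * ((1 + q ^ (2 * N)) + (1 + q ^ (2 * N))) := by
        gcongr <;> refine rpow_le_one_add_pow hq (by linarith) ?_ <;> push_cast <;> linarith
    _ = _ := by ring

theorem inv_scaleGap_le {q : ℝ} (hq : 0 < q) {k : ℕ} (h : 2 ^ k ≤ q ∨ 2 ^ k ≤ q⁻¹) :
    (scaleGap q)⁻¹ ≤ ((2 : ℝ) ^ (1 / 4 : ℝ))⁻¹ ^ k := by
  rw [inv_pow, ← Real.rpow_mul_natCast zero_le_two, mul_comm, Real.rpow_natCast_mul zero_le_two]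
  gcongr
  rcases h with h | h
  · exact (Real.rpow_le_rpow (by positivity) h (by norm_num)).trans
      (le_add_of_nonneg_right (by positivity))
  · exact (Real.rpow_le_rpow (by positivity) h (by norm_num)).trans
      (le_add_of_nonneg_left (by positivity))

theorem inv_scaleGap_div_two_pow_le {t : ℝ} {l : ℕ} (hl : 2 ^ l ≤ t) (hl' : t < 2 ^ (l + 1))
    (m : ℕ) : (scaleGap (t / 2 ^ m))⁻¹ ≤
      2 ^ (1 / 4 : ℝ) * ((2 : ℝ) ^ (1 / 4 : ℝ))⁻¹ ^ ((l : ℤ) - m).natAbs := by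
  have ht : 0 < t := lt_of_lt_of_le (by positivity) hl
  have hone : (1 : ℝ) ≤ 2 ^ (1 / 4 : ℝ) := Real.one_le_rpow one_le_two (by norm_num)
  rcases le_or_gt m l with h | h
  · have hpow : (2 : ℝ) ^ (l - m) ≤ t / 2 ^ m := by
      rwa [le_div_iff₀ (by positivity), ← pow_add, Nat.sub_add_cancel h]
    rw [show ((l : ℤ) - m).natAbs = l - m by omega]
    exact (inv_scaleGap_le (by positivity) (Or.inl hpow)).trans
      (le_mul_of_one_le_left (by positivity) hone)
  · have hpow : (2 : ℝ) ^ (m - l - 1) ≤ (t / 2 ^ m)⁻¹ := by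
      rw [inv_div, le_div_iff₀ ht]
      calc (2 : ℝ) ^ (m - l - 1) * t ≤ 2 ^ (m - l - 1) * 2 ^ (l + 1) := by gcongr
        _ = 2 ^ m := by rw [← pow_add]; congr 1; omega
    rw [show ((l : ℤ) - m).natAbs = (m - l - 1) + 1 by omega, pow_succ', ← mul_assoc,
      mul_inv_cancel₀ (by positivity), one_mul]
    exact inv_scaleGap_le (by positivity) (Or.inr hpow)

theorem exists_sum_inv_scaleGap_le : ∃ C : ℝ, 0 ≤ C ∧ ∀ t : ℝ, 1 ≤ t → ∀ M : ℕ,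
    ∑ m ∈ Finset.range M, (scaleGap (t / 2 ^ m))⁻¹ ≤ C := by
  set a : ℝ := 2 ^ (1 / 4 : ℝ)
  have ha : 1 < a := Real.one_lt_rpow one_lt_two (by norm_num)
  have ha0 : 0 < a := zero_lt_one.trans ha
  have hgeom : Summable fun k : ℕ => a⁻¹ ^ k :=
    summable_geometric_of_lt_one (by positivity) (inv_lt_one_of_one_lt₀ ha)
  have hsum : Summable fun k : ℤ => a⁻¹ ^ k.natAbs :=
    Summable.of_nat_of_neg hgeom (by simpa only [Int.natAbs_neg, Int.natAbs_natCast] using hgeom)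
  refine ⟨a * ∑' k : ℤ, a⁻¹ ^ k.natAbs, mul_nonneg ha0.le (tsum_nonneg fun _ => by positivity),
    fun t ht M => ?_⟩
  obtain ⟨l, hl, hl'⟩ := exists_nat_pow_near ht one_lt_two
  calc _ ≤ ∑ m ∈ Finset.range M, a * a⁻¹ ^ ((l : ℤ) - m).natAbs :=
        Finset.sum_le_sum fun m _ => inv_scaleGap_div_two_pow_le hl hl' m
    _ = a * ∑ k ∈ (Finset.range M).image (fun m : ℕ => (l : ℤ) - m), a⁻¹ ^ k.natAbs := by
        rw [← Finset.mul_sum, Finset.sum_image fun i _ j _ hij => by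
          simpa only [sub_right_inj, Nat.cast_inj] using hij]
    _ ≤ _ := by
        gcongr
        exact hsum.sum_le_tsum _ fun _ _ => by positivity

theorem norm_sum_sq_le_sum_inv_mul_sum {ι E : Type*} [SeminormedAddCommGroup E] (t : Finset ι)
    {θ : ι → ℝ} (hθ : ∀ i ∈ t, 0 < θ i) (f : ι → E) :
    ‖∑ i ∈ t, f i‖ ^ 2 ≤ (∑ i ∈ t, (θ i)⁻¹) * ∑ i ∈ t, θ i * ‖f i‖ ^ 2 := by
  calc ‖∑ i ∈ t, f i‖ ^ 2 ≤ (∑ i ∈ t, ‖f i‖) ^ 2 := by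
        gcongr
        exact norm_sum_le _ _
    _ ≤ _ := Finset.sum_sq_le_sum_mul_sum_of_sq_le_mul _ (fun i hi => (inv_pos.2 (hθ i hi)).le)
        (fun i hi => mul_nonneg (hθ i hi).le (by positivity))
        fun i hi => (inv_mul_cancel_left₀ (hθ i hi).ne' _).ge

variable {n : ℕ} {φ : ℝ → ℝ}

theorem SlowlyVaryingClass.exists_scaleGap_mul_refinedWeight_sq_le (hφ : SlowlyVaryingClass φ)
    {s : ℝ} (hs : 1 / 2 ≤ s) {N : ℕ} (hsN : s + 1 / 2 ≤ N) :
    ∃ C, 0 ≤ C ∧ ∀ (m : ℕ) (ξ : EuclSp n),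
      scaleGap (japaneseBracket ξ / 2 ^ m) * refinedWeight s φ ξ ^ 2 ≤
        C * (((2 : ℝ) ^ m) ^ (2 * s) * φ (2 ^ m) ^ 2) *
          (1 + (japaneseBracket ξ / 2 ^ m) ^ (2 * N)) := by
  obtain ⟨C, hC1, hC⟩ := hφ.exists_le_mul_rpow_add_rpow (ε := 1 / 4) (by norm_num)
  refine ⟨8 * C ^ 2, by positivity, fun m ξ => ?_⟩
  set t := japaneseBracket ξ with ht
  have ht1 : 1 ≤ t := one_le_japaneseBracket ξ
  have hm1 : (1 : ℝ) ≤ 2 ^ m := one_le_pow₀ one_le_two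
  set q : ℝ := t / 2 ^ m with hq
  have hq0 : 0 < q := by positivity
  have hgap := (scaleGap_pos hq0).le
  have hφt : φ t ≤ C * scaleGap q * φ (2 ^ m) := by
    rw [scaleGap, hq, inv_div]
    exact hC _ _ hm1 ht1
  have hts : (t ^ s) ^ 2 = q ^ (2 * s) * ((2 : ℝ) ^ m) ^ (2 * s) := by
    rw [← Real.mul_rpow hq0.le (by positivity), hq, div_mul_cancel₀ _ (by positivity),
      ← Real.rpow_mul_natCast (by positivity), Nat.cast_ofNat, mul_comm s]
  have := hφ.pos _ hm1
  have := hφ.pos _ ht1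
  calc scaleGap q * refinedWeight s φ ξ ^ 2 = scaleGap q * ((t ^ s) ^ 2 * φ t ^ 2) := by
        rw [refinedWeight, ← ht, mul_pow]
    _ ≤ scaleGap q * ((t ^ s) ^ 2 * (C * scaleGap q * φ (2 ^ m)) ^ 2) := by gcongr
    _ = C ^ 2 * (((2 : ℝ) ^ m) ^ (2 * s) * φ (2 ^ m) ^ 2) * (scaleGap q ^ 3 * q ^ (2 * s)) := by
        rw [hts]
        ring
    _ ≤ C ^ 2 * (((2 : ℝ) ^ m) ^ (2 * s) * φ (2 ^ m) ^ 2) * (8 * (1 + q ^ (2 * N))) := by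
        exact mul_le_mul_of_nonneg_left (scaleGap_pow_three_mul_rpow_le hq0 hs hsN) (by positivity)
    _ = _ := by ring

theorem SlowlyVaryingClass.exists_refinedWeight_sq_mul_norm_sum_sq_le (hφ : SlowlyVaryingClass φ)
    {s : ℝ} (hs : 1 / 2 ≤ s) {N : ℕ} (hsN : s + 1 / 2 ≤ N) :
    ∃ C, 0 ≤ C ∧ ∀ (M : ℕ) (f : ℕ → ℂ) (ξ : EuclSp n),
      refinedWeight s φ ξ ^ 2 * ‖∑ m ∈ Finset.range M, f m‖ ^ 2 ≤
        C * ∑ m ∈ Finset.range M, ((2 : ℝ) ^ m) ^ (2 * s) * φ (2 ^ m) ^ 2 *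
          ((1 + (japaneseBracket ξ / 2 ^ m) ^ (2 * N)) * ‖f m‖ ^ 2) := by
  obtain ⟨C₁, hC₁, hsum⟩ := exists_sum_inv_scaleGap_le
  obtain ⟨C₂, hC₂, hweight⟩ := hφ.exists_scaleGap_mul_refinedWeight_sq_le (n := n) hs hsN
  refine ⟨C₁ * C₂, by positivity, fun M f ξ => ?_⟩
  set θ : ℕ → ℝ := fun m => scaleGap (japaneseBracket ξ / 2 ^ m)
  have hθ : ∀ m, 0 < θ m := fun m => scaleGap_pos (by have := japaneseBracket_pos ξ; positivity)
  have hθf : ∀ m ∈ Finset.range M, 0 ≤ θ m * ‖f m‖ ^ 2 := fun m _ =>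
    mul_nonneg (hθ m).le (sq_nonneg _)
  calc refinedWeight s φ ξ ^ 2 * ‖∑ m ∈ Finset.range M, f m‖ ^ 2
      ≤ refinedWeight s φ ξ ^ 2 * (C₁ * ∑ m ∈ Finset.range M, θ m * ‖f m‖ ^ 2) := by
        gcongr
        refine (norm_sum_sq_le_sum_inv_mul_sum _ (fun m _ => hθ m) f).trans ?_
        exact mul_le_mul_of_nonneg_right (hsum _ (one_le_japaneseBracket ξ) M)
          (Finset.sum_nonneg hθf)
    _ = C₁ * ∑ m ∈ Finset.range M, ‖f m‖ ^ 2 * (θ m * refinedWeight s φ ξ ^ 2) := by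
        rw [mul_left_comm, Finset.mul_sum]
        exact congrArg _ (Finset.sum_congr rfl fun m _ => by ring)
    _ ≤ C₁ * ∑ m ∈ Finset.range M, ‖f m‖ ^ 2 * (C₂ * (((2 : ℝ) ^ m) ^ (2 * s) * φ (2 ^ m) ^ 2) *
          (1 + (japaneseBracket ξ / 2 ^ m) ^ (2 * N))) := by
        gcongr C₁ * ∑ m ∈ _, ?_ with m
        exact mul_le_mul_of_nonneg_left (hweight m ξ) (by positivity)
    _ = _ := by
        rw [mul_assoc, Finset.mul_sum (a := C₂)]
        exact congrArg _ (Finset.sum_congr rfl fun m _ => by ring)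

theorem memLp_two_and_integral_norm_sq_le {X E : Type*} [MeasurableSpace X] {μ : Measure X}
    [NormedAddCommGroup E] {f : X → E} {g : X → ℝ} (hf : AEStronglyMeasurable f μ)
    (hg : Integrable g μ) (hfg : ∀ x, ‖f x‖ ^ 2 ≤ g x) :
    MemLp f 2 μ ∧ ∫ x, ‖f x‖ ^ 2 ∂μ ≤ ∫ x, g x ∂μ := by
  have hint : Integrable (fun x => ‖f x‖ ^ 2) μ :=
    hg.mono' (hf.norm.pow 2) (ae_of_all _ fun x => by
      rw [norm_pow, norm_norm]
      exact hfg x)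
  exact ⟨(memLp_two_iff_integrable_sq_norm hf).2 hint, integral_mono hint hg hfg⟩

theorem SlowlyVaryingClass.exists_norm_weight_mul_fourier_sum_sq_le (hφ : SlowlyVaryingClass φ)
    {s : ℝ} (hs : 1 / 2 ≤ s) {N : ℕ} (hsN : s + 1 / 2 ≤ N) (G : ℕ → 𝓢(EuclSp n, ℂ)) :
    ∃ C, 0 ≤ C ∧ ∀ (M : ℕ) (b : ℕ → ℝ) (ξ : EuclSp n),
      ‖(refinedWeight s φ ξ : ℂ) * 𝓕 (∑ m ∈ Finset.range M, (b m : ℂ) • G m) ξ‖ ^ 2 ≤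
        C * ∑ m ∈ Finset.range M, ((2 : ℝ) ^ m) ^ (2 * s) * φ (2 ^ m) ^ 2 *
          (b m ^ 2 * ((1 + (japaneseBracket ξ / 2 ^ m) ^ (2 * N)) * ‖𝓕 (G m) ξ‖ ^ 2)) := by
  obtain ⟨C, hC, horth⟩ := hφ.exists_refinedWeight_sq_mul_norm_sum_sq_le (n := n) hs hsN
  refine ⟨C, hC, fun M b ξ => ?_⟩
  have hfourier : 𝓕 (∑ m ∈ Finset.range M, (b m : ℂ) • G m) ξ =
      ∑ m ∈ Finset.range M, (b m : ℂ) * 𝓕 (G m) ξ := by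
    simp only [FourierTransform.fourier_sum, FourierTransform.fourier_smul, sum_apply, smul_apply,
      smul_eq_mul]
  rw [norm_mul, mul_pow, Complex.norm_real, Real.norm_eq_abs, sq_abs, hfourier]
  refine (horth M _ ξ).trans_eq (congrArg _ (Finset.sum_congr rfl fun m _ => ?_))
  rw [norm_mul, mul_pow, Complex.norm_real, Real.norm_eq_abs, sq_abs]
  ring

/-- The functions `G m` behave like `ψ(2^m ·)` for a fixed bump `ψ`. -/
theorem SlowlyVaryingClass.exists_integral_norm_weight_mul_fourier_sum_sq_le
    (hφ : SlowlyVaryingClass φ) (hn : 1 ≤ n) {ρ K : ℕ}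
    (hK : (ρ : ℝ) + (n : ℝ) / 2 + 1 / 2 ≤ (K + 1 : ℕ)) {G : ℕ → 𝓢(EuclSp n, ℂ)}
    {S : ℕ → Set (EuclSp n)} {B V : ℝ} (hV : 0 ≤ V) (hS : ∀ m, tsupport (G m) ⊆ S m)
    (hvol : ∀ m, volume (S m) ≤ ENNReal.ofReal (V / (2 ^ m) ^ n)) (hB : ∀ m x, ‖G m x‖ ≤ B)
    (hBK : ∀ m x, ‖iteratedFDeriv ℝ (K + 1) (G m) x‖ ≤ B * (2 ^ m) ^ (K + 1)) :
    ∃ C, 0 ≤ C ∧ ∀ (M : ℕ) (b : ℕ → ℝ),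
      MemLp (fun ξ => (refinedWeight ((ρ : ℝ) + (n : ℝ) / 2) φ ξ : ℂ) *
        𝓕 (∑ m ∈ Finset.range M, (b m : ℂ) • G m) ξ) 2 volume ∧
      ∫ ξ, ‖(refinedWeight ((ρ : ℝ) + (n : ℝ) / 2) φ ξ : ℂ) *
        𝓕 (∑ m ∈ Finset.range M, (b m : ℂ) • G m) ξ‖ ^ 2 ≤
        C * ∑ m ∈ Finset.range M, (b m * (2 ^ m) ^ ρ * φ (2 ^ m)) ^ 2 := by
  set s : ℝ := (ρ : ℝ) + (n : ℝ) / 2 with hs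
  have hs' : 1 / 2 ≤ s := by
    have : (1 : ℝ) ≤ n := mod_cast hn
    have : (0 : ℝ) ≤ ρ := ρ.cast_nonneg
    linarith
  obtain ⟨C, hC, hbound⟩ := hφ.exists_norm_weight_mul_fourier_sum_sq_le hs' hK G
  set C' : ℝ := 1 + 2 ^ (K + 1) + 2 ^ (K + 1) * (n : ℝ) ^ (K + 1)
  refine ⟨C * (C' * (B ^ 2 * V)), by positivity, fun M b => ?_⟩
  have hGint := fun m => ((integrable_one_add_div_pow_mul_norm_fourier_sq K (G m)
    (one_le_pow₀ one_le_two (n := m))).const_mul (b m ^ 2)).const_mul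
      (((2 : ℝ) ^ m) ^ (2 * s) * φ (2 ^ m) ^ 2)
  have hmeas : AEStronglyMeasurable (fun ξ => (refinedWeight s φ ξ : ℂ) *
      𝓕 (∑ m ∈ Finset.range M, (b m : ℂ) • G m) ξ) volume :=
    (Complex.measurable_ofReal.comp (hφ.measurable_refinedWeight s)).aestronglyMeasurable.mul
      (𝓕 (∑ m ∈ Finset.range M, (b m : ℂ) • G m)).continuous.aestronglyMeasurable
  obtain ⟨hmem, hle⟩ := memLp_two_and_integral_norm_sq_le hmeas
    ((integrable_finsetSum _ fun m _ => hGint m).const_mul C) (hbound M b)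
  refine ⟨hmem, hle.trans ?_⟩
  rw [integral_const_mul, integral_finsetSum _ fun m _ => hGint m, mul_assoc C]
  refine mul_le_mul_of_nonneg_left ?_ hC
  rw [Finset.mul_sum]
  refine Finset.sum_le_sum fun m _ => ?_
  rw [integral_const_mul, integral_const_mul]
  have hpow : ((2 : ℝ) ^ m) ^ (2 * s) = ((2 ^ m) ^ ρ) ^ 2 * (2 ^ m) ^ n := by
    rw [← pow_mul _ ρ 2, ← pow_add, ← Real.rpow_natCast ((2 : ℝ) ^ m), hs]
    push_cast
    ring_nf
  calc _ ≤ ((2 : ℝ) ^ m) ^ (2 * s) * φ (2 ^ m) ^ 2 *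
        (b m ^ 2 * (C' * (B ^ 2 * (V / (2 ^ m) ^ n)))) := by
        gcongr
        exact integral_one_add_div_pow_mul_norm_fourier_sq_le K (by positivity)
          (one_le_pow₀ one_le_two) (hS m) (hvol m) (hB m) (hBK m)
    _ = _ := by
        rw [hpow]
        field_simp

end AlmostOrthogonality

/-! ### Distributions given by smooth functions -/

section SchwartzDistributions

variable {n : ℕ} {u : 𝓢'(EuclSp n, ℂ)}

theorem HasFourierFunction.of_forall_apply_eq_integral {G : 𝓢(EuclSp n, ℂ)}
    (hu : ∀ g : 𝓢(EuclSp n, ℂ), u g = ∫ x, g x * G x) :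
    HasFourierFunction u fun ξ => 𝓕 G ξ := by
  refine ⟨(𝓕 G).continuous.locallyIntegrable, fun g _ => ?_⟩
  rw [TemperedDistribution.fourier_apply, hu, SchwartzMap.integral_fourier_mul_eq]

theorem HasFourierFunction.norm_sq_weightedFourier {s : ℝ} {φ : ℝ → ℝ} {f : EuclSp n → ℂ}
    (hf : HasFourierFunction u f) (hu : u ∈ refinedSubmodule n s φ) :
    ‖weightedFourier n s φ ⟨u, hu⟩‖ ^ 2 = ∫ ξ, ‖(refinedWeight s φ ξ : ℂ) * f ξ‖ ^ 2 := by
  rw [norm_sq_eq_integral_norm_sq]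
  refine integral_congr_ae ?_
  filter_upwards [hu.choose_spec.2.coeFn_toLp, hu.choose_spec.1.ae_eq hf] with ξ htoLp hae
  change ‖(hu.choose_spec.2.toLp _) ξ‖ ^ 2 = _
  rw [htoLp, hae]

end SchwartzDistributions

section FunctionDistributions

variable {n : ℕ} {Γ : Type*} [TopologicalSpace Γ] [ChartedSpace (EuclSp n) Γ]

theorem contDiff_partition_mul_comp_chart_symm (A : AdaptedAtlas n Γ) (j : Fin A.r)
    (f : CkSpace n Γ ⊤) :
    ContDiff ℝ ∞ fun x => (A.χ j ((A.chart j).symm x) : ℂ) * f ((A.chart j).symm x) := by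
  refine contDiff_iff_contDiffAt.2 fun x => ?_
  have hx : x ∈ (A.chart j).target := A.chart_target j ▸ mem_univ x
  have hχ : ContDiffAt ℝ ∞ (fun x => (A.χ j ((A.chart j).symm x) : ℂ)) x :=
    contDiffAt_comp_chart_symm (k := ⊤) (f := fun y => (A.χ j y : ℂ)) (A.chart_mem j)
      ((Complex.ofRealCLM.contDiff (n := ∞)).contMDiff.comp (A.χ j).contMDiff) hx
  exact hχ.mul (contDiffAt_comp_chart_symm (k := ⊤) (A.chart_mem j) f.2 hx)

theorem AdaptedAtlas.subset_target (A : AdaptedAtlas n Γ) (j : Fin A.r) (K : Set (EuclSp n)) :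
    K ⊆ (A.chart j).target :=
  A.chart_target j ▸ subset_univ K

variable [CompactSpace Γ]

/-- The representation `(χ_j f) ∘ α_j` of a smooth function `f` in the `j`-th chart. -/
noncomputable def localSchwartz (A : AdaptedAtlas n Γ) (j : Fin A.r) (f : CkSpace n Γ ⊤) :
    𝓢(EuclSp n, ℂ) :=
  (hasCompactSupport_comp_chart_symm (A.χ_subordinate j) (A.chart_target j) fun x hx => by
    rw [hx, Complex.ofReal_zero, zero_mul]).toSchwartzMap
      (contDiff_partition_mul_comp_chart_symm A j f)

theorem localSchwartz_apply (A : AdaptedAtlas n Γ) (j : Fin A.r) (f : CkSpace n Γ ⊤)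
    (x : EuclSp n) : localSchwartz A j f x =
      (A.χ j ((A.chart j).symm x) : ℂ) * f ((A.chart j).symm x) := rfl

theorem localSchwartz_sum_smul {ι : Type*} (A : AdaptedAtlas n Γ) (j : Fin A.r) (t : Finset ι)
    (a : ι → ℂ) (f : ι → CkSpace n Γ ⊤) :
    localSchwartz A j (∑ i ∈ t, a i • f i) = ∑ i ∈ t, a i • localSchwartz A j (f i) := by
  ext x
  rw [localSchwartz_apply, CkSpace.coe_sum, Finset.sum_apply, Finset.mul_sum, sum_apply]
  exact Finset.sum_congr rfl fun i _ => mul_left_comm _ _ _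

theorem AdaptedAtlas.isCompact_image_tsupport (A : AdaptedAtlas n Γ) (j : Fin A.r) :
    IsCompact (A.chart j '' tsupport (A.χ j)) :=
  (isClosed_tsupport _).isCompact.image_of_continuousOn
    ((A.chart j).continuousOn.mono (A.χ_subordinate j))

theorem CkSpace.eventually_forall_norm_sub_lt (A : AdaptedAtlas n Γ) {k : ℕ∞}
    (w₀ : CkSpace n Γ k) {ε : ℝ} (hε : 0 < ε) :
    ∀ᶠ w : CkSpace n Γ k in 𝓝 w₀, ∀ y, ‖w y - w₀ y‖ < ε := by
  have hsupp : ∀ j, ∀ᶠ w : CkSpace n Γ k in 𝓝 w₀, ∀ y ∈ tsupport (A.χ j),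
      ‖w y - w₀ y‖ < ε := fun j => by
    have hunif := (CkSpace.continuous_ofFun_iteratedFDeriv (A.chart_mem j)
      (i := 0) (zero_le (a := k))).tendsto w₀
    rw [UniformOnFun.tendsto_iff_tendstoUniformlyOn] at hunif
    filter_upwards [Metric.tendstoUniformlyOn_iff.1 (hunif _ ⟨A.isCompact_image_tsupport j,
      A.subset_target j _⟩) ε hε] with w hw y hy
    have hwy := hw _ (mem_image_of_mem _ hy)
    simp only [Function.comp_apply, UniformOnFun.toFun_ofFun, iteratedFDeriv_zero_eq_comp,
      LinearIsometryEquiv.dist_map, (A.chart j).left_inv (A.χ_subordinate j hy)] at hwy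
    rwa [dist_comm, dist_eq_norm] at hwy
  filter_upwards [eventually_all.2 hsupp] with w hw y
  obtain ⟨j, hj⟩ := A.χ.exists_pos_of_mem (mem_univ y)
  exact hw j y (subset_tsupport _ hj.ne')

variable [MeasurableSpace Γ] [BorelSpace Γ] [IsManifold (𝓡 n) ∞ Γ]

theorem continuous_integral_mul_conj (A : AdaptedAtlas n Γ) (d : SmoothDensity n Γ) {f : Γ → ℂ}
    (hf : Continuous f) {k : ℕ∞} :
    Continuous fun w : CkSpace n Γ k => ∫ y, f y * conj (w y) ∂d.measure := by
  have := d.isFiniteMeasure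
  have hint : ∀ w : CkSpace n Γ k, Integrable (fun y => f y * conj (w y)) d.measure := fun w =>
    d.integrable_mul_conj hf w.continuous
  have hf_norm : Integrable (fun y => ‖f y‖) d.measure :=
    (hf.integrable_of_hasCompactSupport (HasCompactSupport.of_compactSpace _)).norm
  refine continuous_iff_continuousAt.2 fun w₀ => Metric.tendsto_nhds.2 fun ε hε => ?_
  set I : ℝ := ∫ y, ‖f y‖ ∂d.measure
  have : 0 ≤ I := integral_nonneg fun _ => norm_nonneg _
  filter_upwards [CkSpace.eventually_forall_norm_sub_lt A w₀ (ε := ε / (I + 1)) (by positivity)]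
    with w hw
  rw [dist_eq_norm, ← integral_sub (hint w) (hint w₀)]
  calc _ ≤ ∫ y, ‖f y * conj (w y) - f y * conj (w₀ y)‖ ∂d.measure :=
        norm_integral_le_integral_norm _
    _ ≤ ∫ y, ‖f y‖ * (ε / (I + 1)) ∂d.measure := by
        refine integral_mono ((hint w).sub (hint w₀)).norm (hf_norm.mul_const _) fun y => ?_
        simp only [← mul_sub, ← map_sub, norm_mul, RCLike.norm_conj]
        gcongr
        exact (hw y).le
    _ = I * (ε / (I + 1)) := integral_mul_const _ _
    _ < ε := by
        rw [mul_div_assoc', div_lt_iff₀ (by positivity)]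
        linarith [mul_comm I ε]

/-- The distribution `w ↦ ∫ f · conj w dx` with which a continuous function `f` is identified; the
atlas only serves to prove its continuity. -/
noncomputable def distributionOfContinuous (A : AdaptedAtlas n Γ) (d : SmoothDensity n Γ)
    {f : Γ → ℂ} (hf : Continuous f) : DistributionOn n Γ where
  toFun w := ∫ y, f y * conj (w y) ∂d.measure
  map_add' w w' := by
    rw [← integral_add (d.integrable_mul_conj hf w.continuous)
      (d.integrable_mul_conj hf w'.continuous)]
    refine integral_congr_ae (ae_of_all _ fun y => ?_)
    change f y * conj (w y + w' y) = _
    rw [map_add, mul_add]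
  map_smul' c w := by
    rw [smul_eq_mul, ← integral_const_mul]
    refine integral_congr_ae (ae_of_all _ fun y => ?_)
    change f y * conj (c * w y) = _
    rw [map_mul, mul_left_comm]
  cont := continuous_integral_mul_conj A d hf

theorem localRep_distributionOfContinuous [T2Space Γ] (A : AdaptedAtlas n Γ)
    (d : SmoothDensity n Γ) (j : Fin A.r) (f : CkSpace n Γ ⊤) (g : 𝓢(EuclSp n, ℂ)) :
    localRep A d j (distributionOfContinuous A d f.continuous) g =
      ∫ x, g x * localSchwartz A j f x := by
  have hzero : ∀ y ∉ (A.chart j).source, f y * conj (chartTest A d j g y) = 0 := fun y hy => by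
    have hχ : A.χ j y = 0 := image_eq_zero_of_notMem_tsupport fun h => hy (A.χ_subordinate j h)
    change f y * conj (((A.χ j y * _ : ℝ) : ℂ) * _) = 0
    rw [hχ, zero_mul, Complex.ofReal_zero, zero_mul, map_zero, mul_zero]
  change ∫ y, f y * conj (chartTest A d j g y) ∂d.measure = _
  refine (d.integral_eq_integral_chart (A.chart_mem j) (f.continuous.mul
    (Complex.continuous_conj.comp (chartTest A d j g).continuous)).continuousOn hzero).trans ?_
  rw [A.chart_target j, setIntegral_univ]
  refine integral_congr_ae (ae_of_all _ fun x => ?_)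
  have hx : x ∈ (A.chart j).target := A.chart_target j ▸ mem_univ x
  have hd : (d.dens (A.chart j) x : ℂ) ≠ 0 :=
    Complex.ofReal_ne_zero.2 (d.dens_pos _ (A.chart_mem j) x hx).ne'
  simp only [Pi.mul_apply, Function.comp_apply, chartTest, localSchwartz_apply,
    (A.chart j).right_inv hx, map_mul, Complex.conj_conj, Complex.conj_ofReal, Complex.ofReal_mul,
    Complex.ofReal_inv, map_inv₀]
  field_simp

variable [T2Space Γ] {A : AdaptedAtlas n Γ} {d : SmoothDensity n Γ} {s : ℝ} {φ : ℝ → ℝ}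

theorem exists_refinedSpaceOn_of_memLp (f : CkSpace n Γ ⊤)
    (hf : ∀ k, MemLp (fun ξ => (refinedWeight s φ ξ : ℂ) * 𝓕 (localSchwartz A k f) ξ) 2 volume) :
    ∃ h : RefinedSpaceOn A d s φ,
      (∀ w : CkSpace n Γ ⊤, h.toDistribution w = ∫ y, f y * conj (w y) ∂d.measure) ∧
      ‖h‖ ^ 2 = ∑ k, ∫ ξ, ‖(refinedWeight s φ ξ : ℂ) * 𝓕 (localSchwartz A k f) ξ‖ ^ 2 := by
  have hFourier : ∀ k, HasFourierFunction
      (localRep A d k (distributionOfContinuous A d f.continuous))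
      (fun ξ => 𝓕 (localSchwartz A k f) ξ) := fun k =>
    .of_forall_apply_eq_integral (localRep_distributionOfContinuous A d k f)
  refine ⟨⟨distributionOfContinuous A d f.continuous, fun k => ⟨_, hFourier k, hf k⟩⟩,
    fun w => rfl, ?_⟩
  change ‖RefinedSpaceOn.toL2 A d s φ _‖ ^ 2 = _
  rw [PiLp.norm_sq_eq_of_L2]
  exact Finset.sum_congr rfl fun k _ => (hFourier k).norm_sq_weightedFourier _

end FunctionDistributions

/-! ### Rescaled bumps -/

section Profile

variable {E : Type*} [NormedAddCommGroup E] [NormedSpace ℝ E]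

theorem iteratedFDeriv_ne_zero_of_comp_smul_eventuallyEq_exp {f : E → ℝ} {i : ℕ}
    (hf : ContDiff ℝ i f) {e : E} (he : (fun t : ℝ => f (t • e)) =ᶠ[𝓝 0] Real.exp) :
    iteratedFDeriv ℝ i f 0 ≠ 0 := by
  intro h
  set ℓ : ℝ →L[ℝ] E := ContinuousLinearMap.toSpanSingleton ℝ e
  have hcomp : iteratedFDeriv ℝ i (f ∘ ℓ) 0 = 0 := by
    rw [ℓ.iteratedFDeriv_comp_right hf 0 le_rfl, map_zero, h]
    rfl
  have hexp : iteratedDeriv i Real.exp 0 = 0 := by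
    rw [iteratedDeriv_eq_iteratedFDeriv, ← (he.iteratedFDeriv ℝ i).eq_of_nhds]
    exact congrArg (fun D => D fun _ => (1 : ℝ)) hcomp
  rw [iteratedDeriv_eq_iterate, Real.iter_deriv_exp, Real.exp_zero] at hexp
  exact one_ne_zero hexp

theorem exists_contDiff_tsupport_subset_closedBall_iteratedFDeriv_ne_zero (E : Type*)
    [NormedAddCommGroup E] [InnerProductSpace ℝ E] [FiniteDimensional ℝ E] [Nontrivial E] (i : ℕ) :
    ∃ ψ : E → ℂ, ContDiff ℝ ∞ ψ ∧ tsupport ψ ⊆ Metric.closedBall 0 1 ∧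
      iteratedFDeriv ℝ i ψ 0 ≠ 0 := by
  obtain ⟨e, he⟩ := exists_norm_eq E zero_le_one
  let f : ContDiffBump (0 : E) := ⟨1 / 2, 1, by norm_num, by norm_num⟩
  set ψ : E → ℝ := fun x => f x * Real.exp (inner ℝ e x)
  have hψ : ContDiff ℝ ∞ ψ :=
    f.contDiff.mul (Real.contDiff_exp.comp (contDiff_const.inner ℝ contDiff_id))
  have hψ_exp : (fun t : ℝ => ψ (t • e)) =ᶠ[𝓝 0] Real.exp := by
    have hlim : Tendsto (fun t : ℝ => t • e) (𝓝 0) (𝓝 0) := by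
      simpa only [zero_smul] using (show Continuous fun t : ℝ => t • e by fun_prop).tendsto 0
    filter_upwards [hlim.eventually f.eventuallyEq_one] with t ht
    simp only [ψ, ht, Pi.one_apply, one_mul, inner_smul_right, real_inner_self_eq_norm_sq, he,
      one_pow, mul_one]
  refine ⟨fun x => (ψ x : ℂ), Complex.ofRealCLM.contDiff.comp hψ, ?_, fun h => ?_⟩
  · refine closure_minimal (fun x hx => Metric.ball_subset_closedBall (f.support_eq ▸ ?_))
      Metric.isClosed_closedBall
    exact left_ne_zero_of_mul (Complex.ofReal_ne_zero.1 hx)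
  · have hi : ContDiff ℝ i ψ := hψ.of_le (mod_cast le_top)
    refine iteratedFDeriv_ne_zero_of_comp_smul_eventuallyEq_exp hi hψ_exp (norm_eq_zero.1 ?_)
    rw [← Complex.ofRealLI.norm_iteratedFDeriv_comp_left hi.contDiffAt le_rfl]
    exact norm_eq_zero.2 h

variable {F : Type*} [NormedAddCommGroup F] [NormedSpace ℝ F] {ψ : E → F}

theorem contDiff_comp_smul_sub {k : ℕ∞ω} (hψ : ContDiff ℝ k ψ) (c : ℝ) (x₀ : E) :
    ContDiff ℝ k fun y => ψ (c • (y - x₀)) :=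
  hψ.comp (by fun_prop)

theorem iteratedFDeriv_comp_smul_sub {i : ℕ} (hψ : ContDiff ℝ i ψ) (c : ℝ) (x₀ x : E) :
    iteratedFDeriv ℝ i (fun y => ψ (c • (y - x₀))) x =
      c ^ i • iteratedFDeriv ℝ i ψ (c • (x - x₀)) := by
  rw [iteratedFDeriv_comp_sub (f := fun y => ψ (c • y)), iteratedFDeriv_comp_const_smul c hψ]

end Profile

section DyadicBumps

variable {n : ℕ} {Γ : Type*} [TopologicalSpace Γ] [ChartedSpace (EuclSp n) Γ]
  {A : AdaptedAtlas n Γ} (c : A.Cutoffs) {ψ : EuclSp n → ℂ}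

/-- The function `ψ(2^m (x - x₀))` of the coordinate `x` of the `j`-th chart, cut off to a smooth
function on `Γ`. -/
noncomputable def dyadicBump (j : Fin A.r) (hψ : ContDiff ℝ ∞ ψ) (x₀ : EuclSp n) (m : ℕ) :
    CkSpace n Γ ⊤ :=
  ⟨cutoffComp (c.η j) (A.chart j) fun x => ψ ((2 : ℝ) ^ m • (x - x₀)),
    c.contMDiff_cutoffComp j (k := ⊤) (contDiff_comp_smul_sub hψ _ _)⟩

theorem iteratedFDeriv_sum_dyadicBump_comp_chart_symm {j : Fin A.r} {p : Γ} (hp : A.χ j p ≠ 0)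
    (hψ : ContDiff ℝ ∞ ψ) (t : Finset ℕ) (b : ℕ → ℝ) (i : ℕ) :
    iteratedFDeriv ℝ i
      ((∑ m ∈ t, (b m : ℂ) • dyadicBump c j hψ (A.chart j p) m : CkSpace n Γ ⊤) ∘
        (A.chart j).symm) (A.chart j p) =
      (∑ m ∈ t, b m * (2 ^ m) ^ i) • iteratedFDeriv ℝ i ψ 0 := by
  set x₀ := A.chart j p
  have hps : p ∈ (A.chart j).source := A.χ_subordinate j (subset_tsupport _ hp)
  have hx₀ : x₀ ∈ (A.chart j).target := (A.chart j).map_source hps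
  have hη : ∀ᶠ x in 𝓝 x₀, c.η j ((A.chart j).symm x) = 1 := by
    have hsymm := (A.chart j).continuousAt_symm hx₀
    rw [ContinuousAt, (A.chart j).left_inv hps] at hsymm
    exact (hsymm.eventually ((A.χ j).contMDiff.continuous.continuousAt.eventually_ne hp)).mono
      fun x hx => c.eq_one j _ (subset_tsupport _ hx)
  have hsum : (∑ m ∈ t, (b m : ℂ) • dyadicBump c j hψ x₀ m : CkSpace n Γ ⊤) ∘ (A.chart j).symm
      =ᶠ[𝓝 x₀] fun x => ∑ m ∈ t, b m • ψ ((2 : ℝ) ^ m • (x - x₀)) := by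
    filter_upwards [hη, (A.chart j).open_target.mem_nhds hx₀] with x hx hxt
    rw [Function.comp_apply, CkSpace.coe_sum, Finset.sum_apply]
    refine Finset.sum_congr rfl fun m _ => ?_
    change _ * ((c.η j _ : ℂ) * ψ ((2 : ℝ) ^ m • (A.chart j _ - x₀))) = _
    rw [hx, (A.chart j).right_inv hxt, Complex.ofReal_one, one_mul, Complex.real_smul]
  have hψi : ContDiff ℝ i ψ := hψ.of_le (mod_cast le_top)
  have hbump : ∀ m : ℕ, ContDiffAt ℝ i (fun x => ψ ((2 : ℝ) ^ m • (x - x₀))) x₀ := fun m =>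
    (contDiff_comp_smul_sub hψi _ x₀).contDiffAt
  rw [(hsum.iteratedFDeriv ℝ i).eq_of_nhds,
    iteratedFDeriv_fun_sum_apply fun m _ => (hbump m).const_smul (b m), Finset.sum_smul]
  refine Finset.sum_congr rfl fun m _ => ?_
  rw [iteratedFDeriv_const_smul_apply' (hbump m), iteratedFDeriv_comp_smul_sub hψi, sub_self,
    smul_zero, smul_smul]

/-- The part of the support of `χ_k` that is covered by the ball of radius `r` around `x₀` in the
`j`-th chart, seen in the `k`-th chart. -/
def chartOverlapBall (A : AdaptedAtlas n Γ) (j k : Fin A.r) (x₀ : EuclSp n) (r : ℝ) :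
    Set (EuclSp n) :=
  A.chart k '' tsupport (A.χ k) ∩
    (A.chart k).symm ⁻¹' ((A.chart j).symm '' Metric.closedBall x₀ r)

theorem measure_preimage_chartOverlapBall_le [MeasurableSpace Γ] (A : AdaptedAtlas n Γ)
    (d : SmoothDensity n Γ) (j k : Fin A.r) (x₀ : EuclSp n) (r : ℝ) :
    d.measure ((A.chart k).source ∩ A.chart k ⁻¹' chartOverlapBall A j k x₀ r) ≤
      d.measure ((A.chart j).source ∩ A.chart j ⁻¹' Metric.closedBall x₀ r) := by
  refine measure_mono ?_
  rintro y ⟨hy, -, z, hz, hzy⟩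
  have hzt : z ∈ (A.chart j).target := A.chart_target j ▸ mem_univ z
  rw [(A.chart k).left_inv hy] at hzy
  subst hzy
  exact ⟨(A.chart j).map_target hzt, by rwa [mem_preimage, (A.chart j).right_inv hzt]⟩

variable [CompactSpace Γ]

theorem localSchwartz_dyadicBump_eq_cutoffComp (j k : Fin A.r) (hψ : ContDiff ℝ ∞ ψ)
    (x₀ : EuclSp n) (m : ℕ) :
    (localSchwartz A k (dyadicBump c j hψ x₀ m) : EuclSp n → ℂ) =
      cutoffComp (fun y => A.χ k y * c.η j y) (A.chart j)
        (fun x => ψ ((2 : ℝ) ^ m • (x - x₀))) ∘ (A.chart k).symm := by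
  ext x
  simp only [cutoffComp, Function.comp_apply, Complex.ofReal_mul, mul_assoc]
  rfl

variable [T2Space Γ]

theorem isClosed_chartOverlapBall (A : AdaptedAtlas n Γ) (j k : Fin A.r) (x₀ : EuclSp n) (r : ℝ) :
    IsClosed (chartOverlapBall A j k x₀ r) := by
  have hsymm : ∀ k, Continuous (A.chart k).symm := fun k => by
    rw [← continuousOn_univ, ← A.chart_target k]
    exact (A.chart k).continuousOn_symm
  exact (A.isCompact_image_tsupport k).isClosed.inter
    (((isCompact_closedBall x₀ r).image (hsymm j)).isClosed.preimage (hsymm k))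

theorem tsupport_localSchwartz_dyadicBump_subset (hψ : ContDiff ℝ ∞ ψ)
    (hψs : tsupport ψ ⊆ Metric.closedBall 0 1) (j k : Fin A.r) (x₀ : EuclSp n) (m : ℕ) :
    tsupport (localSchwartz A k (dyadicBump c j hψ x₀ m)) ⊆
      chartOverlapBall A j k x₀ ((2 ^ m)⁻¹) := by
  refine closure_minimal (fun x hx => ?_) (isClosed_chartOverlapBall A j k x₀ _)
  have hprod : (A.χ k ((A.chart k).symm x) : ℂ) * ((c.η j ((A.chart k).symm x) : ℂ) *
    ψ ((2 : ℝ) ^ m • (A.chart j ((A.chart k).symm x) - x₀))) ≠ 0 := hx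
  have hχ := Complex.ofReal_ne_zero.1 (left_ne_zero_of_mul hprod)
  have hη := Complex.ofReal_ne_zero.1 (left_ne_zero_of_mul (right_ne_zero_of_mul hprod))
  have hball := hψs (subset_tsupport _ (right_ne_zero_of_mul (right_ne_zero_of_mul hprod)))
  refine ⟨⟨_, subset_tsupport _ hχ, (A.chart k).right_inv (A.chart_target k ▸ mem_univ x)⟩, _, ?_,
    (A.chart j).left_inv (c.tsupport_subset j (subset_tsupport _ hη))⟩
  rw [mem_closedBall_zero_iff, norm_smul, norm_pow, Real.norm_ofNat] at hball
  rwa [mem_closedBall_iff_norm, ← one_div, le_div_iff₀' (by positivity)]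

theorem exists_norm_iteratedFDeriv_localSchwartz_dyadicBump_le (hψ : ContDiff ℝ ∞ ψ)
    (hψs : tsupport ψ ⊆ Metric.closedBall 0 1) (j k : Fin A.r) (x₀ : EuclSp n) (i : ℕ) :
    ∃ B, 0 ≤ B ∧ ∀ m x,
      ‖iteratedFDeriv ℝ i (localSchwartz A k (dyadicBump c j hψ x₀ m)) x‖ ≤ B * (2 ^ m) ^ i := by
  obtain ⟨C, hC0, hC⟩ := exists_norm_iteratedFDeriv_cutoffComp_le
    ((A.χ k).contMDiff.mul (c.contMDiff j)) (A.chart_mem j)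
    ((closure_mono (Function.support_mul_subset_right _ _)).trans (c.tsupport_subset j))
    (A.chart_mem k) (A.isCompact_image_tsupport k) (A.subset_target k _) i
  obtain ⟨B, hB0, hB⟩ := exists_norm_iteratedFDeriv_le_of_hasCompactSupport hψ
    ((isCompact_closedBall (0 : EuclSp n) 1).of_isClosed_subset (isClosed_tsupport ψ) hψs) i
  refine ⟨C * B, by positivity, fun m x => ?_⟩
  have h2m : (1 : ℝ) ≤ 2 ^ m := one_le_pow₀ one_le_two
  by_cases hx : x ∈ A.chart k '' tsupport (A.χ k)
  · rw [localSchwartz_dyadicBump_eq_cutoffComp, mul_assoc]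
    refine hC _ (contDiff_comp_smul_sub (hψ.of_le (mod_cast le_top)) _ _) (B * (2 ^ m) ^ i)
      (by positivity) (fun l hl z _ => ?_) x hx
    rw [iteratedFDeriv_comp_smul_sub (hψ.of_le (mod_cast le_top)), norm_smul, norm_pow, norm_pow,
      Real.norm_ofNat, mul_comm]
    exact mul_le_mul (hB l hl _) (pow_le_pow_right₀ h2m hl) (by positivity) hB0
  · have hzero : iteratedFDeriv ℝ i (localSchwartz A k (dyadicBump c j hψ x₀ m)) x = 0 :=
      image_eq_zero_of_notMem_tsupport fun h => hx
        (tsupport_localSchwartz_dyadicBump_subset c hψ hψs j k x₀ m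
          (tsupport_iteratedFDeriv_subset i h)).1
    rw [hzero, norm_zero]
    positivity

variable [MeasurableSpace Γ] [BorelSpace Γ]

theorem exists_volume_chartOverlapBall_le (A : AdaptedAtlas n Γ) (d : SmoothDensity n Γ)
    (j k : Fin A.r) (x₀ : EuclSp n) : ∃ V, 0 ≤ V ∧ ∀ r, 0 ≤ r → r ≤ 1 →
      volume (chartOverlapBall A j k x₀ r) ≤ ENNReal.ofReal (V * r ^ n) := by
  obtain ⟨c, hc, hcd⟩ := d.exists_pos_forall_le_dens (A.chart_mem k) (A.isCompact_image_tsupport k)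
    (A.subset_target k _)
  obtain ⟨C, hC⟩ := d.exists_forall_dens_le (A.chart_mem j) (isCompact_closedBall x₀ 1)
    (A.subset_target j _)
  have hC0 : 0 ≤ C := (d.dens_pos _ (A.chart_mem j) x₀ (A.chart_target j ▸ mem_univ x₀)).le.trans
    (hC x₀ (Metric.mem_closedBall_self zero_le_one))
  set v : ℝ := volume.real (Metric.ball (0 : EuclSp n) 1)
  refine ⟨C * v / c, by positivity, fun r hr hr1 => ?_⟩
  set S := chartOverlapBall A j k x₀ r
  have hmul : ENNReal.ofReal c * volume S ≤ ENNReal.ofReal (C * v * r ^ n) :=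
    calc ENNReal.ofReal c * volume S
      _ ≤ d.measure ((A.chart k).source ∩ A.chart k ⁻¹' S) :=
          d.ofReal_mul_volume_le_measure (A.chart_mem k)
            (isClosed_chartOverlapBall A j k x₀ r).measurableSet (A.subset_target k _)
            fun x hx => hcd x hx.1
      _ ≤ d.measure ((A.chart j).source ∩ A.chart j ⁻¹' Metric.closedBall x₀ r) :=
          measure_preimage_chartOverlapBall_le A d j k x₀ r
      _ ≤ ENNReal.ofReal C * volume (Metric.closedBall x₀ r) :=
          d.measure_le_ofReal_mul_volume (A.chart_mem j) measurableSet_closedBall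
            (A.subset_target j _) fun x hx => hC x (Metric.closedBall_subset_closedBall hr1 hx)
      _ = _ := by
          rw [Measure.addHaar_closedBall _ _ hr, finrank_euclideanSpace_fin,
            ← ofReal_measureReal measure_ball_lt_top.ne, ← ENNReal.ofReal_mul (by positivity),
            ← ENNReal.ofReal_mul hC0, mul_comm (r ^ n), mul_assoc]
  rw [div_mul_eq_mul_div, ENNReal.ofReal_div_of_pos hc]
  exact (ENNReal.le_div_iff_mul_le (.inl (ENNReal.ofReal_pos.2 hc).ne')
    (.inl ENNReal.ofReal_ne_top)).2 (mul_comm (volume S) _ ▸ hmul)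

end DyadicBumps

/-! ### Necessity of the integral condition -/

section Necessity

theorem sum_one_div_sq_div_sum_mul_sq {ι : Type*} {t : Finset ι} {x : ι → ℝ}
    (hx : ∀ i ∈ t, x i ≠ 0) :
    ∑ i ∈ t, (1 / x i ^ 2 / (∑ l ∈ t, 1 / x l ^ 2) * x i) ^ 2 = (∑ i ∈ t, 1 / x i ^ 2)⁻¹ := by
  set σ := ∑ l ∈ t, 1 / x l ^ 2
  calc _ = ∑ i ∈ t, 1 / x i ^ 2 * (σ⁻¹) ^ 2 :=
        Finset.sum_congr rfl fun i hi => by field [hx i hi]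
    _ = σ⁻¹ := by
        rw [← Finset.sum_mul, mul_comm, sq]
        exact (congrArg _ (inv_inv σ).symm).trans (mul_self_mul_inv σ⁻¹)

theorem tendsto_zero_of_norm_sq_le_mul_inv {α E : Type*} [SeminormedAddCommGroup E] {l : Filter α}
    {f : α → E} {σ : α → ℝ} (hσ : Tendsto σ l atTop) {C : ℝ}
    (hf : ∀ a, ‖f a‖ ^ 2 ≤ C * (σ a)⁻¹) : Tendsto f l (𝓝 0) := by
  refine tendsto_zero_iff_norm_tendsto_zero.2 ?_
  have hsq : Tendsto (fun a => ‖f a‖ ^ 2) l (𝓝 0) :=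
    squeeze_zero (fun a => sq_nonneg _) hf
      (by simpa only [mul_zero, Pi.inv_apply] using hσ.inv_tendsto_atTop.const_mul C)
  simpa only [Real.sqrt_sq (norm_nonneg _), Real.sqrt_zero] using hsq.sqrt

variable {n : ℕ} {Γ : Type*} [TopologicalSpace Γ] [ChartedSpace (EuclSp n) Γ] [T2Space Γ]
  [CompactSpace Γ] [MeasurableSpace Γ] [BorelSpace Γ] {A : AdaptedAtlas n Γ} (c : A.Cutoffs)
  {φ : ℝ → ℝ} (ρ : ℕ) {ψ : EuclSp n → ℂ}

theorem exists_integral_norm_weight_mul_fourier_sum_dyadicBump_sq_le (hn : 1 ≤ n)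
    (hφ : SlowlyVaryingClass φ) (hψ : ContDiff ℝ ∞ ψ) (hψs : tsupport ψ ⊆ Metric.closedBall 0 1)
    (d : SmoothDensity n Γ) (j k : Fin A.r) (x₀ : EuclSp n) :
    ∃ C, 0 ≤ C ∧ ∀ (M : ℕ) (b : ℕ → ℝ),
      MemLp (fun ξ => (refinedWeight ((ρ : ℝ) + (n : ℝ) / 2) φ ξ : ℂ) *
        𝓕 (localSchwartz A k
          (∑ m ∈ Finset.range M, (b m : ℂ) • dyadicBump c j hψ x₀ m)) ξ) 2 volume ∧
      ∫ ξ, ‖(refinedWeight ((ρ : ℝ) + (n : ℝ) / 2) φ ξ : ℂ) *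
        𝓕 (localSchwartz A k
          (∑ m ∈ Finset.range M, (b m : ℂ) • dyadicBump c j hψ x₀ m)) ξ‖ ^ 2 ≤
        C * ∑ m ∈ Finset.range M, (b m * (2 ^ m) ^ ρ * φ (2 ^ m)) ^ 2 := by
  have hK : (ρ : ℝ) + (n : ℝ) / 2 + 1 / 2 ≤ ((ρ + n + 1 : ℕ) : ℝ) := by
    push_cast
    linarith [n.cast_nonneg (α := ℝ)]
  obtain ⟨V, hV0, hV⟩ := exists_volume_chartOverlapBall_le A d j k x₀
  obtain ⟨B₀, -, hB₀⟩ := exists_norm_iteratedFDeriv_localSchwartz_dyadicBump_le c hψ hψs j k x₀ 0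
  obtain ⟨B₁, -, hB₁⟩ :=
    exists_norm_iteratedFDeriv_localSchwartz_dyadicBump_le c hψ hψs j k x₀ (ρ + n + 1)
  simp only [localSchwartz_sum_smul]
  refine hφ.exists_integral_norm_weight_mul_fourier_sum_sq_le hn hK (B := max B₀ B₁) hV0
    (tsupport_localSchwartz_dyadicBump_subset c hψ hψs j k x₀)
    (fun m => ?_) (fun m x => ?_)
    fun m x => (hB₁ m x).trans (by gcongr; exact le_max_right _ _)
  · rw [div_eq_mul_inv, ← inv_pow (2 ^ m)]
    exact hV _ (by positivity) (inv_le_one_of_one_le₀ (one_le_pow₀ one_le_two))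
  · have hB := hB₀ m x
    rw [norm_iteratedFDeriv_zero, pow_zero, mul_one] at hB
    exact hB.trans (le_max_left _ _)

variable [IsManifold (𝓡 n) ∞ Γ]

theorem exists_refinedSpaceOn_sum_dyadicBump (hn : 1 ≤ n) (hφ : SlowlyVaryingClass φ)
    (hψ : ContDiff ℝ ∞ ψ) (hψs : tsupport ψ ⊆ Metric.closedBall 0 1)
    (d : SmoothDensity n Γ) (j : Fin A.r) (x₀ : EuclSp n) :
    ∃ C, 0 ≤ C ∧ ∀ (M : ℕ) (b : ℕ → ℝ),
      ∃ h : RefinedSpaceOn A d ((ρ : ℝ) + (n : ℝ) / 2) φ,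
      (∀ w : CkSpace n Γ ⊤, h.toDistribution w =
        ∫ y, (∑ m ∈ Finset.range M, (b m : ℂ) • dyadicBump c j hψ x₀ m : CkSpace n Γ ⊤) y *
          conj (w y) ∂d.measure) ∧
      ‖h‖ ^ 2 ≤ C * ∑ m ∈ Finset.range M, (b m * (2 ^ m) ^ ρ * φ (2 ^ m)) ^ 2 := by
  choose C hC0 hC using fun k =>
    exists_integral_norm_weight_mul_fourier_sum_dyadicBump_sq_le c ρ hn hφ hψ hψs d j k x₀
  refine ⟨∑ k, C k, Finset.sum_nonneg fun k _ => hC0 k, fun M b => ?_⟩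
  obtain ⟨h, hh, hnorm⟩ := exists_refinedSpaceOn_of_memLp (A := A) (d := d) _
    fun k => (hC k M b).1
  refine ⟨h, hh, hnorm.trans_le ?_⟩
  rw [Finset.sum_mul]
  exact Finset.sum_le_sum fun k _ => (hC k M b).2

variable {ρ} {d : SmoothDensity n Γ}

/-- With `σ_M = ∑_{m < M} φ(2^m)⁻²`, the combination of the rescaled bumps with the coefficients
`b_m = φ(2^m)⁻² 2^{-mρ} / σ_M` has squared norm `O(1/σ_M)`, whereas its derivative of order `ρ` at
the center does not depend on `M`. -/
theorem RefinedSpaceOn.IsInclusion.summable [Nonempty Γ] (hn : 1 ≤ n) (hφ : SlowlyVaryingClass φ)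
    {T : RefinedSpaceOn A d ((ρ : ℝ) + (n : ℝ) / 2) φ →L[ℂ] CkSpace n Γ (ρ : ℕ∞)}
    (hT : RefinedSpaceOn.IsInclusion T) : Summable fun m : ℕ => 1 / φ (2 ^ m) ^ 2 := by
  by_contra hdiv
  rw [not_summable_iff_tendsto_nat_atTop_of_nonneg fun m => by positivity] at hdiv
  obtain ⟨p⟩ := ‹Nonempty Γ›
  obtain ⟨j, hj⟩ := A.χ.exists_pos_of_mem (mem_univ p)
  obtain ⟨c⟩ := A.nonempty_cutoffs
  have : Nonempty (Fin n) := ⟨⟨0, hn⟩⟩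
  obtain ⟨ψ, hψ, hψs, hψ0⟩ :=
    exists_contDiff_tsupport_subset_closedBall_iteratedFDeriv_ne_zero (EuclSp n) ρ
  have hx₀ : A.chart j p ∈ (A.chart j).target := A.chart_target j ▸ mem_univ _
  obtain ⟨C, -, hC⟩ :=
    exists_refinedSpaceOn_sum_dyadicBump c ρ hn hφ hψ hψs d j (A.chart j p)
  set σ : ℕ → ℝ := fun M => ∑ m ∈ Finset.range M, 1 / φ (2 ^ m) ^ 2
  choose h hh hnorm using fun M => hC M fun m => 1 / φ (2 ^ m) ^ 2 / σ M / (2 ^ m) ^ ρ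
  have hcancel : ∀ M m : ℕ, 1 / φ (2 ^ m) ^ 2 / σ M / (2 ^ m) ^ ρ * (2 ^ m) ^ ρ =
      1 / φ (2 ^ m) ^ 2 / σ M := fun M m => div_mul_cancel₀ _ (by positivity)
  have hlim : Tendsto h atTop (𝓝 0) := by
    refine tendsto_zero_of_norm_sq_le_mul_inv hdiv (C := C) fun M => (hnorm M).trans_eq ?_
    simp only [hcancel]
    exact congrArg _ (sum_one_div_sq_div_sum_mul_sq fun m _ =>
      (hφ.pos _ (one_le_pow₀ one_le_two)).ne')
  have hderiv : Tendsto (fun M => iteratedFDeriv ℝ ρ ((T (h M) : Γ → ℂ) ∘ (A.chart j).symm)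
      (A.chart j p)) atTop (𝓝 0) := by
    have hcont := (CkSpace.continuous_iteratedFDeriv_apply (A.chart_mem j) (k := (ρ : ℕ∞)) le_rfl
      hx₀).comp T.continuous
    have hzero : iteratedFDeriv ℝ ρ ((T 0 : Γ → ℂ) ∘ (A.chart j).symm) (A.chart j p) = 0 := by
      rw [map_zero]
      exact congrFun (iteratedFDeriv_fun_zero (n := ρ)) _
    exact hzero ▸ (hcont.tendsto 0).comp hlim
  refine hψ0 (tendsto_nhds_unique (tendsto_const_nhds.congr' ?_) hderiv)
  filter_upwards [hdiv.eventually_gt_atTop 0] with M hM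
  rw [hT.coe_eq (CkSpace.continuous _) (hh M),
    iteratedFDeriv_sum_dyadicBump_comp_chart_symm c hj.ne' hψ]
  simp only [hcancel]
  rw [← Finset.sum_div, div_self hM.ne', one_smul]

end Necessity

theorem proposition2 {n : ℕ} (hn : 1 ≤ n)
    {Γ : Type*} [TopologicalSpace Γ] [T2Space Γ] [CompactSpace Γ] [Nonempty Γ]
    [ChartedSpace (EuclSp n) Γ] [IsManifold (𝓡 n) ∞ Γ]
    [MeasurableSpace Γ] [BorelSpace Γ]
    (A : AdaptedAtlas n Γ) (d : SmoothDensity n Γ)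
    (φ : ℝ → ℝ) (hφ : SlowlyVaryingClass φ) (ρ : ℕ) :
    ((∫⁻ t in Ici (1 : ℝ), ENNReal.ofReal (1 / (t * φ t ^ 2)) < ⊤) ↔
      ∃ T : RefinedSpaceOn A d ((ρ : ℝ) + (n : ℝ) / 2) φ →L[ℂ] CkSpace n Γ (ρ : ℕ∞),
        RefinedSpaceOn.IsInclusion T) ∧
    ∀ T : RefinedSpaceOn A d ((ρ : ℝ) + (n : ℝ) / 2) φ →L[ℂ] CkSpace n Γ (ρ : ℕ∞),
      RefinedSpaceOn.IsInclusion T → IsCompactOperator T := by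
  have hnec : ∀ T : RefinedSpaceOn A d ((ρ : ℝ) + (n : ℝ) / 2) φ →L[ℂ] CkSpace n Γ (ρ : ℕ∞),
      RefinedSpaceOn.IsInclusion T → ∑' m : ℕ, ENNReal.ofReal (1 / φ (2 ^ m) ^ 2) < ⊤ :=
    fun T hT => (hT.summable hn hφ).tsum_ofReal_lt_top
  rw [hφ.lintegral_lt_top_iff_tsum_lt_top]
  exact ⟨⟨fun h => exists_continuous_inclusion hφ (hφ.memLp_pow_div_refinedWeight h ρ),
    fun ⟨T, hT⟩ => hnec T hT⟩,
    fun T hT => hT.isCompactOperator hφ (hφ.memLp_pow_div_refinedWeight (hnec T hT) ρ)⟩
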